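/- **Proposition.** Let $3<p<5$ and $s_p=\frac32-\frac2{p-1}$. Let $u=u(|x|,t)$ be a real-valued radial solution, defined for all $t\in\mathbb R$, of the wave equation $$\partial_t^2u-\Delta u=F(|x|,t),\qquad (x,t)\in\mathbb R^3\times\mathbb R ;$$ that is, $(u,\partial_tu)\in C(\mathbb R;\dot H^{s_p}\times\dot H^{s_p-1}(\mathbb R^3))$ and, for all $t\in\mathbb R$, $$u(t)=\cos(t\sqrt{-\Delta})\,u(0)+\frac{\sin(t\sqrt{-\Delta})}{\sqrt{-\Delta}}\,\partial_tu(0)+\int_0^t\frac{\sin((t-\tau)\sqrt{-\Delta})}{\sqrt{-\Delta}}F(|\cdot|,\tau)\,d\tau .$$ Suppose that * the set $\{(u(\cdot,t),\partial_tu(\cdot,t)) : t\in\mathbb R\}$ is pre-compact in $\dot H^{s_p}\times\dot H^{s_p-1}(\mathbb R^3)$; * $F$ is measurable, has a finite norm in $L^{\frac{2}{1+s_p}}_tL^{\frac{2}{2-s_p}}_x(I\times\mathbb R^3)$ for every bounded time interval $I$, and satisfies $|F(|x|,t)|\le C_0|x|^{-\frac{2p}{p-1}}$ for all $x\in\mathbb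 R^3\setminus\{0\}$ and $t\in\mathbb R$, with a constant $C_0$. Put $w(r,t)=r\,u(r,t)$. Then for every $R>0$ the distributional derivatives satisfy $\partial_rw,\ \partial_tw\in C(\mathbb R_t;L^2([R,\infty)))$, and there is a constant $C_1$ such that, for all $R>0$ and $t_0\in\mathbb R$, $$\int_R^{4R}\big[(\partial_rw(r,t_0))^2+(\partial_tw(r,t_0))^2\big]\,dr\le\frac12\int_R^{4R}\Big[\Big(\int_0^\infty(r+t)F(r+t,t_0-t)\,dt\Big)^2+\Big(\int_0^\infty(r+t)F(r+t,t_0+t)\,dt\Big)^2\Big]\,dr\le C_1R^{-2(1-s_p)} .$$ Moreover, for every $R>0$, $(u,\partial_tu)\in C(\mathbb R;\dot H^1\times L^2(\mathbb R^3\setminus B(0,R)))$, where $\dot H^1(\mathbb R^3\setminus B(0,R))$ is the space of functions in $L^6$ with weak gradient in $L^2$, normed by the $L^2$ norm of the gradient; and there is a constant $C_2$ such that, for all $R>0$ and $t\in\mathbb R$, $$\int_{R<|x|<4R}\big(|\nabla u(x,t)|^2+|\partial_tu(x,t)|^2\big)\,dx\le C_2R^{-2(1-s_p)} .$$ The constants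 $C_1$ and $C_2$ do not depend on $t$, $t_0$ and $R$. -/

import Mathlib

open MeasureTheory Filter Topology Set
open scoped ContDiff ENNReal FourierTransform SchwartzMap

noncomputable section

namespace RadialWave

/-- The physical space `ℝ³` with its Euclidean norm. -/
abbrev E3 : Type := EuclideanSpace ℝ (Fin 3)

/-! ### Homogeneous Sobolev spaces -/

/-- The Fourier transform of the tempered distribution `T` is the locally integrable function `g`. -/
def IsFourierDensity (T : 𝓢'(E3, ℂ)) (g : E3 → ℂ) : Prop :=
  LocallyIntegrable g ∧
    ∀ φ : 𝓢(E3, ℂ), Integrable (fun ξ => φ ξ * g ξ) ∧ (𝓕 T) φ = ∫ ξ, φ ξ * g ξ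

/-- `T ∈ Ḣˢ(ℝ³)`: the Fourier transform of `T` is a locally integrable function `g` and
`|ξ|ˢ g ∈ L²`. -/
def MemHomSobolev (s : ℝ) (T : 𝓢'(E3, ℂ)) : Prop :=
  ∃ g : E3 → ℂ, IsFourierDensity T g ∧ MemLp (fun ξ => ((‖ξ‖ ^ s : ℝ) : ℂ) * g ξ) 2 volume

theorem IsFourierDensity.ae_eq {T : 𝓢'(E3, ℂ)} {g h : E3 → ℂ} (hg : IsFourierDensity T g)
    (hh : IsFourierDensity T h) : g =ᵐ[volume] h := by
  refine ae_eq_of_integral_contDiff_smul_eq hg.1 hh.1 fun ψ hψ hψc => ?_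
  have hc : HasCompactSupport (fun x => (ψ x : ℂ)) :=
    hψc.comp_left (g := fun y : ℝ => (y : ℂ)) (by simp)
  have hd : ContDiff ℝ ∞ (fun x => (ψ x : ℂ)) := Complex.ofRealCLM.contDiff.comp hψ
  have h1 := (hg.2 (hc.toSchwartzMap hd)).2
  have h2 := (hh.2 (hc.toSchwartzMap hd)).2
  simpa [Complex.real_smul] using h1.symm.trans h2

theorem IsFourierDensity.add {T S : 𝓢'(E3, ℂ)} {g h : E3 → ℂ} (hg : IsFourierDensity T g)
    (hh : IsFourierDensity S h) : IsFourierDensity (T + S) (fun ξ => g ξ + h ξ) := by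
  refine ⟨hg.1.add hh.1, fun φ => ⟨?_, ?_⟩⟩
  · simp only [mul_add]
    exact (hg.2 φ).1.add (hh.2 φ).1
  · have h1 := (hg.2 φ).2
    have h2 := (hh.2 φ).2
    simp only [TemperedDistribution.fourier_apply] at h1 h2 ⊢
    simp only [mul_add]
    rw [integral_add (hg.2 φ).1 (hh.2 φ).1, ← h1, ← h2]
    rfl

theorem IsFourierDensity.smul {T : 𝓢'(E3, ℂ)} {g : E3 → ℂ} (c : ℂ) (hg : IsFourierDensity T g) :
    IsFourierDensity (c • T) (fun ξ => c * g ξ) := by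
  refine ⟨hg.1.smul c, fun φ => ⟨?_, ?_⟩⟩
  · simpa [mul_left_comm] using (hg.2 φ).1.const_mul c
  · have h1 := (hg.2 φ).2
    simp only [TemperedDistribution.fourier_apply] at h1 ⊢
    simp only [mul_left_comm _ c]
    rw [integral_const_mul, ← h1]
    rfl

theorem isFourierDensity_zero : IsFourierDensity 0 (fun _ => 0) :=
  ⟨locallyIntegrable_zero, fun φ => ⟨by simp, by
    simp only [TemperedDistribution.fourier_apply, mul_zero, integral_zero]; rfl⟩⟩

/-- The tempered distributions of class `Ḣˢ(ℝ³)`, as a vector space. -/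
def homSobolevSubmodule (s : ℝ) : Submodule ℂ 𝓢'(E3, ℂ) where
  carrier := {T | MemHomSobolev s T}
  zero_mem' := ⟨_, isFourierDensity_zero, by simp⟩
  add_mem' := by
    rintro T S ⟨g, hg, hg2⟩ ⟨h, hh, hh2⟩
    refine ⟨_, hg.add hh, ?_⟩
    simp only [mul_add]
    exact hg2.add hh2
  smul_mem' := by
    rintro c T ⟨g, hg, hg2⟩
    exact ⟨_, hg.smul c, by simpa [mul_left_comm] using hg2.const_mul c⟩

/-- The homogeneous Sobolev space `Ḣˢ(ℝ³)`. It carries the norm `‖ |ξ|ˢ û ‖_{L²}` (below), not the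
topology of tempered distributions. -/
def HomSobolev (s : ℝ) : Type := homSobolevSubmodule s

namespace HomSobolev

variable {s : ℝ}

instance : AddCommGroup (HomSobolev s) := inferInstanceAs (AddCommGroup (homSobolevSubmodule s))

instance : Module ℂ (HomSobolev s) := inferInstanceAs (Module ℂ (homSobolevSubmodule s))

/-- The underlying tempered distribution. -/
def toDistribution (T : HomSobolev s) : 𝓢'(E3, ℂ) := T.1

/-- The Fourier transform of an element of `Ḣˢ(ℝ³)`, as a function (unique almost everywhere). -/
def fourierFun (T : HomSobolev s) : E3 → ℂ := T.2.choose

theorem fourierFun_spec (T : HomSobolev s) : IsFourierDensity T.toDistribution T.fourierFun :=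
  T.2.choose_spec.1

theorem memLp_fourierFun (T : HomSobolev s) :
    MemLp (fun ξ => ((‖ξ‖ ^ s : ℝ) : ℂ) * T.fourierFun ξ) 2 volume :=
  T.2.choose_spec.2

/-- The map `T ↦ |ξ|ˢ T̂` from `Ḣˢ(ℝ³)` to `L²(ℝ³)`. -/
def toL2 : HomSobolev s →ₗ[ℂ] Lp ℂ 2 (volume : Measure E3) where
  toFun T := T.memLp_fourierFun.toLp _
  map_add' T S := by
    rw [← MemLp.toLp_add, MemLp.toLp_eq_toLp_iff]
    filter_upwards [(T + S).fourierFun_spec.ae_eq (T.fourierFun_spec.add S.fourierFun_spec)]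
      with ξ hξ
    simp [hξ, mul_add]
  map_smul' c T := by
    rw [RingHom.id_apply, ← MemLp.toLp_const_smul, MemLp.toLp_eq_toLp_iff]
    filter_upwards [(c • T).fourierFun_spec.ae_eq (T.fourierFun_spec.smul c)] with ξ hξ
    simp [hξ, mul_left_comm]

theorem toL2_injective : Function.Injective (toL2 (s := s)) := by
  rw [← LinearMap.ker_eq_bot, LinearMap.ker_eq_bot']
  intro T hT
  have h0 : (fun ξ => ((‖ξ‖ ^ s : ℝ) : ℂ) * T.fourierFun ξ) =ᵐ[volume] 0 :=
    (MemLp.toLp_eq_toLp_iff T.memLp_fourierFun MemLp.zero).1 (hT.trans (MemLp.toLp_zero _).symm)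
  have hne : ∀ᵐ ξ : E3 ∂volume, ξ ≠ 0 := by simp [ae_iff]
  have hg : T.fourierFun =ᵐ[volume] 0 := by
    filter_upwards [h0, hne] with ξ hξ hξ0
    have : (‖ξ‖ ^ s : ℝ) ≠ 0 := (Real.rpow_pos_of_pos (norm_pos_iff.2 hξ0) s).ne'
    simpa [this] using hξ
  have hF : 𝓕 T.toDistribution = 0 := by
    ext φ
    rw [(T.fourierFun_spec.2 φ).2]
    have : (fun ξ => φ ξ * T.fourierFun ξ) =ᵐ[volume] 0 := by
      filter_upwards [hg] with ξ hξ
      simp [hξ]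
    rw [integral_congr_ae this]
    simp
  have hz : T.toDistribution = 0 := by
    ext φ
    have h1 : (𝓕 T.toDistribution) (𝓕⁻ φ) = 0 := by rw [hF]; rfl
    rw [TemperedDistribution.fourier_apply, FourierTransform.fourier_fourierInv_eq] at h1
    exact h1
  exact Subtype.ext hz

/-- `‖T‖_{Ḣˢ} = ‖ |ξ|ˢ T̂ ‖_{L²}`. -/
instance : NormedAddCommGroup (HomSobolev s) :=
  NormedAddCommGroup.induced (HomSobolev s) (Lp ℂ 2 (volume : Measure E3)) toL2 toL2_injective

instance : NormedSpace ℂ (HomSobolev s) :=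
  NormedSpace.induced ℂ (HomSobolev s) (Lp ℂ 2 (volume : Measure E3)) toL2

end HomSobolev

/-! ### Exponents and space-time norms -/

/-- The critical regularity `s_p = 3/2 - 2/(p-1)`. -/
def sp (p : ℝ) : ℝ := 3 / 2 - 2 / (p - 1)

/-- The norm `‖G‖_{L^q L^r(I × ℝ³)}` of a function `G x t`. -/
def mixedNorm (q r : ℝ) (I : Set ℝ) (G : E3 → ℝ → ℝ) : ℝ≥0∞ :=
  (∫⁻ t in I, (∫⁻ x, ‖G x t‖ₑ ^ r) ^ (q / r)) ^ (1 / q)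

/-- The norm of `Z(I) = L^{2/(1+s_p)} L^{2/(2-s_p)}(I × ℝ³)`. -/
def ZNorm (p : ℝ) (I : Set ℝ) (G : E3 → ℝ → ℝ) : ℝ≥0∞ :=
  mixedNorm (2 / (1 + sp p)) (2 / (2 - sp p)) I G

/-! ### Solutions of the wave equation

Mathlib's Fourier transform is `∫ e^{-2πi⟨x,ξ⟩} f(x) dx`, so that `√(-Δ)` is the Fourier multiplier
with symbol `2π|ξ|`. -/

/-- The pairing of the free wave `S_{L,0}(t)(u₀,u₁) = cos(t√-Δ) u₀ + (sin(t√-Δ)/√-Δ) u₁`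
with a Schwartz function. -/
def freeWave {s : ℝ} (t : ℝ) (D : HomSobolev s × HomSobolev (s - 1)) (φ : 𝓢(E3, ℂ)) : ℂ :=
  ∫ ξ, (𝓕⁻ φ) ξ * ((Real.cos (t * (2 * Real.pi * ‖ξ‖)) : ℂ) * D.1.fourierFun ξ
    + ((Real.sin (t * (2 * Real.pi * ‖ξ‖)) / (2 * Real.pi * ‖ξ‖) : ℝ) : ℂ) * D.2.fourierFun ξ)

/-- The function `(sin(t√-Δ)/√-Δ) φ` for a Schwartz function `φ`. -/
def sinePropagator (t : ℝ) (φ : 𝓢(E3, ℂ)) : E3 → ℂ :=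
  𝓕⁻ (fun ξ : E3 =>
    ((Real.sin (t * (2 * Real.pi * ‖ξ‖)) / (2 * Real.pi * ‖ξ‖) : ℝ) : ℂ) * (𝓕 φ) ξ)

/-- `u(|x|,t)` is a radial solution, defined for all `t ∈ ℝ`, of `∂ₜ²u - Δu = F(|x|,t)`, with
`U t = (u(·,t), ∂ₜu(·,t)) ∈ Ḣˢ × Ḣˢ⁻¹`. The Duhamel formula is an identity of tempered
distributions; the operator `sin((t-τ)√-Δ)/√-Δ` is symmetric and is moved to the test function. -/
structure IsGlobalRadialSolution (s : ℝ) (F u : ℝ → ℝ → ℝ)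
    (U : ℝ → HomSobolev s × HomSobolev (s - 1)) : Prop where
  continuous : Continuous U
  locallyIntegrable : ∀ t, LocallyIntegrable (fun x : E3 => u ‖x‖ t)
  fst_eq : ∀ t (φ : 𝓢(E3, ℂ)), (U t).1.toDistribution φ = ∫ x : E3, (u ‖x‖ t : ℂ) * φ x
  snd_eq : ∀ t (φ : 𝓢(E3, ℂ)),
    HasDerivAt (fun τ => (U τ).1.toDistribution φ) ((U t).2.toDistribution φ) t
  duhamel : ∀ t (φ : 𝓢(E3, ℂ)), (U t).1.toDistribution φ = freeWave t (U 0) φ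
    + ∫ τ in (0 : ℝ)..t, ∫ x : E3, (F ‖x‖ τ : ℂ) * sinePropagator (t - τ) φ x

/-! ### Weak derivatives away from the origin -/

/-- `g` is the weak derivative of `f` on `(0,∞)`. -/
def IsWeakDeriv (f g : ℝ → ℝ) : Prop :=
  LocallyIntegrableOn f (Ioi 0) ∧ LocallyIntegrableOn g (Ioi 0) ∧
    ∀ ψ : ℝ → ℝ, ContDiff ℝ ∞ ψ → HasCompactSupport ψ → tsupport ψ ⊆ Ioi 0 →
      ∫ r in Ioi 0, f r * deriv ψ r = -∫ r in Ioi 0, g r * ψ r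

/-- `g(·,t)` is, for every `t`, the time derivative of `f(·,t)` in the sense of distributions
on `(0,∞)`. -/
def IsTimeDeriv (f g : ℝ → ℝ → ℝ) : Prop :=
  ∀ t, LocallyIntegrableOn (fun r => f r t) (Ioi 0) ∧ LocallyIntegrableOn (fun r => g r t) (Ioi 0) ∧
    ∀ ψ : ℝ → ℝ, ContDiff ℝ ∞ ψ → HasCompactSupport ψ → tsupport ψ ⊆ Ioi 0 →
      HasDerivAt (fun τ => ∫ r in Ioi 0, f r τ * ψ r) (∫ r in Ioi 0, g r t * ψ r) t

/-- `G` is the weak gradient of `f` on `ℝ³ ∖ {0}`. -/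
def IsWeakGradient (f : E3 → ℝ) (G : E3 → E3) : Prop :=
  LocallyIntegrableOn f {0}ᶜ ∧ LocallyIntegrableOn G {0}ᶜ ∧
    ∀ ψ : E3 → ℝ, ContDiff ℝ ∞ ψ → HasCompactSupport ψ → tsupport ψ ⊆ {0}ᶜ →
      ∀ e : E3, ∫ x, f x * fderiv ℝ ψ x e = -∫ x, inner ℝ (G x) e * ψ x

/-- The distribution `T` is the function `h` on `ℝ³ ∖ {0}`. -/
def EqFunAwayFromZero (T : 𝓢'(E3, ℂ)) (h : E3 → ℝ) : Prop :=
  LocallyIntegrableOn h {0}ᶜ ∧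
    ∀ φ : 𝓢(E3, ℂ), HasCompactSupport φ → tsupport φ ⊆ {0}ᶜ → T φ = ∫ x, (h x : ℂ) * φ x

/-- `t ↦ f t` belongs to `C(ℝ; L²(μ))`. -/
def ContinuousInL2 {α G : Type*} [MeasurableSpace α] [NormedAddCommGroup G] (μ : Measure α)
    (f : ℝ → α → G) : Prop :=
  (∀ t, MemLp (f t) 2 μ) ∧
    ∀ t₀, Tendsto (fun t => eLpNorm (fun a => f t a - f t₀ a) 2 μ) (𝓝 t₀) (𝓝 0)

/-- For functions `f t` on `ℝ³` with weak gradients `Df t`: the curve `t ↦ f t` belongs to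
`C(ℝ; Ḣ¹(Ω))`, where `Ḣ¹(Ω)` (`Ω` the exterior of a ball) is the space of all functions in `L⁶(Ω)`
with gradient in `L²(Ω)`, normed by the `L²(Ω)` norm of the gradient. -/
def ContinuousInHomH1 (Ω : Set E3) (f : ℝ → E3 → ℝ) (Df : ℝ → E3 → E3) : Prop :=
  (∀ t, MemLp (f t) 6 (volume.restrict Ω)) ∧ ContinuousInL2 (volume.restrict Ω) Df

end RadialWave

end

noncomputable section

namespace RadialWave

/-! ### The Fourier transform of functions in `L¹ ∩ L²` -/

/-! In dimension three `w = r u` solves the one-dimensional equation `w_tt - w_rr = r F` on the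
half-line. For `ε = ±1` the quantity `w_t - ε w_r` therefore changes along the characteristic `(r +
σ, t + ε σ)` only by `ε` times the integral of `r F` on it. If `w_t - ε w_r` disappears as `σ → ∞`,
then `w_t - ε w_r = -ε ∫₀^∞ (r + σ) F(r + σ, t + ε σ) dσ`. Adding and subtracting the two signs
expresses `w_r` and `w_t` by the two characteristic integrals (`charInt`), and the energy comparison
is the parallelogram identity, hence even an equality.

All of this is done weakly, as `u(t)` is only in `Ḣˢ`. The test functions are `ψ(|x|) / (4π|x|)`,
against which `u` pairs as `w` pairs with `ψ`. Moving the profile `ψ` outward by `T` acts on the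
Fourier side by cosines and sines of `2πT|ξ|` (`fourier_radialTest_translate`), because the
Laplacian of such a function has profile `ψ''`. This gives the transport law for the Duhamel formula
(`characteristic_identity`). The contribution from infinity vanishes by the Riemann–Lebesgue lemma
for each fixed pair of data (`oscillating_pairing`), and uniformly on the trajectory by
pre-compactness (`tendsto_pairing_escaping`). The limit is `characteristic_representation`.

With `β = 2/(p-1)` one has `1/2 < β < 1` and `s_p = 3/2 - β`. The bound on `F` gives `|charInt| ≤ C
r^{-β}`, whence the energy estimate, as `R · R^{-2β} = R^{-2(1-s_p)}`. Continuity in `L²` holds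
since a change of time equals a translation in `r` up to a small local term
(`abs_charInt_add_sub_le`).

For `∇u` one also needs the size of `w` itself. It equals `∫₀ʳ w_r` (`mul_ae_eq_radialPrimitive`): a
nonzero constant of integration would contribute a multiple of `1/|x|` to `u`, which pairing with
concentrating test functions excludes for `s_p > 1/2`. Thus `|u| ≤ C r^{-β}`, the gradient is `(w_r
- w/r)/r` in the radial direction, and the remaining claims follow from the pointwise bounds in
polar coordinates. -/

theorem continuous_fourierInv_of_integrable {f : E3 → ℂ} (hf : Integrable f) :
    Continuous (𝓕⁻ f : E3 → ℂ) := by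
  refine VectorFourier.fourierIntegral_continuous Real.continuous_fourierChar ?_ hf
  simp only [LinearMap.neg_apply, innerₗ_apply_apply]
  fun_prop

theorem norm_fourierInv_le_integral_norm (f : E3 → ℂ) (x : E3) : ‖𝓕⁻ f x‖ ≤ ∫ ξ, ‖f ξ‖ :=
  VectorFourier.norm_fourierIntegral_le_integral_norm _ _ _ _ _

theorem integral_fourierInv_mul_eq {f g : E3 → ℂ} (hf : Integrable f) (hg : Integrable g) :
    ∫ ξ, 𝓕⁻ f ξ * g ξ = ∫ x, f x * 𝓕⁻ g x := by
  have h := VectorFourier.integral_fourierIntegral_smul_eq_flip (e := Real.fourierChar)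
    (μ := (volume : Measure E3)) (ν := (volume : Measure E3)) (L := -innerₗ E3) (f := f) (g := g)
    Real.continuous_fourierChar
    (by simp only [LinearMap.neg_apply, innerₗ_apply_apply]; fun_prop) hf hg
  have hflip : (-innerₗ E3).flip = -innerₗ E3 := by
    ext x y
    simp [real_inner_comm]
  rw [hflip] at h
  exact h

/-- Plancherel's theorem for the Fourier integral of a function in `L¹ ∩ L²`. -/
theorem eLpNorm_two_fourierInv {f : E3 → ℂ} (hf : Integrable f) (hf2 : MemLp f 2 volume) :
    eLpNorm (𝓕⁻ f : E3 → ℂ) 2 volume = eLpNorm f 2 volume := by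
  set G : Lp ℂ 2 (volume : Measure E3) := 𝓕⁻ (hf2.toLp f) with hG
  -- The Fourier integral and the `L²` transform agree because each, paired with a test function,
  -- equals the pairing of `f` with the inverse transform of that test function.
  have key : (𝓕⁻ f : E3 → ℂ) =ᵐ[volume] G := by
    refine ae_eq_of_integral_contDiff_smul_eq
      (continuous_fourierInv_of_integrable hf).locallyIntegrable
      ((Lp.memLp G).locallyIntegrable (by norm_num)) fun ψ hψ hψc => ?_
    have hc : HasCompactSupport (fun x => (ψ x : ℂ)) :=
      hψc.comp_left (g := fun y : ℝ => (y : ℂ)) (by simp)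
    have hd : ContDiff ℝ ∞ (fun x => (ψ x : ℂ)) := Complex.ofRealCLM.contDiff.comp hψ
    set φ := hc.toSchwartzMap hd with hφ
    have h1 : (Lp.toTemperedDistribution G) φ = ∫ x, (𝓕⁻ φ) x * f x := by
      rw [hG, ← Lp.fourierInv_toTemperedDistribution_eq, TemperedDistribution.fourierInv_apply,
        Lp.toTemperedDistribution_apply]
      refine integral_congr_ae ?_
      filter_upwards [hf2.coeFn_toLp] with x hx
      rw [hx, smul_eq_mul]
    rw [Lp.toTemperedDistribution_apply, SchwartzMap.fourierInv_coe,
      integral_fourierInv_mul_eq φ.integrable hf] at h1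
    have h2 : ∀ x, φ x = (ψ x : ℂ) := fun x => rfl
    simp only [h2, smul_eq_mul] at h1
    simpa [Complex.real_smul] using h1.symm
  have hnorm : ‖G‖ = ‖hf2.toLp f‖ := by
    rw [← Lp.norm_fourier_eq G, hG, FourierTransform.fourier_fourierInv_eq]
  rw [eLpNorm_congr_ae key, ← Lp.enorm_def, ← eLpNorm_congr_ae hf2.coeFn_toLp, ← Lp.enorm_def,
    ← ofReal_norm, ← ofReal_norm, hnorm]

/-! ### Pairing with Fourier multipliers -/

/-- Hölder with the conjugate exponents `2/(2-s)` and `2/s`. Since `2/s > 2`, the `L^{2/s}` norm of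
`P` is interpolated between the sup norm and the `L²` norm. -/
theorem lintegral_enorm_mul_le {s : ℝ} (hs0 : 0 < s) (hs1 : s < 1) {f : E3 → ℝ} {P : E3 → ℂ}
    (hf : Measurable f) (hP : Measurable P) {B : ℝ≥0∞} (hB : ∀ x, ‖P x‖ₑ ≤ B)
    (hB2 : eLpNorm P 2 volume ≤ B) :
    ∫⁻ x, ‖f x‖ₑ * ‖P x‖ₑ ≤ (∫⁻ x, ‖f x‖ₑ ^ (2 / (2 - s))) ^ (1 / (2 / (2 - s))) * B := by
  have hpq : (2 / (2 - s)).HolderConjugate (2 / s) := by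
    rw [Real.holderConjugate_iff]
    constructor
    · rw [lt_div_iff₀] <;> linarith
    · field_simp; ring
  refine (ENNReal.lintegral_mul_le_Lp_mul_Lq volume hpq hf.enorm.aemeasurable
    hP.enorm.aemeasurable).trans ?_
  gcongr
  have h1 : ∫⁻ x, ‖P x‖ₑ ^ (2 / s) ≤ B ^ (2 / s) := by
    have h2 : ∀ x, ‖P x‖ₑ ^ (2 / s) ≤ B ^ (2 / s - 2) * ‖P x‖ₑ ^ (2 : ℝ) := by
      intro x
      have : (2 / s) = (2 / s - 2) + 2 := by ring
      conv_lhs => rw [this]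
      have h3 : 0 ≤ 2 / s - 2 := by
        have : 2 ≤ 2 / s := by rw [le_div_iff₀ hs0]; linarith
        linarith
      rw [ENNReal.rpow_add_of_nonneg _ _ h3 (by norm_num)]
      gcongr
      exact hB x
    have h3 : 0 ≤ 2 / s - 2 := by
      have : 2 ≤ 2 / s := by rw [le_div_iff₀ hs0]; linarith
      linarith
    calc ∫⁻ x, ‖P x‖ₑ ^ (2 / s) ≤ ∫⁻ x, B ^ (2 / s - 2) * ‖P x‖ₑ ^ (2 : ℝ) := lintegral_mono h2
      _ = B ^ (2 / s - 2) * ∫⁻ x, ‖P x‖ₑ ^ (2 : ℝ) :=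
        lintegral_const_mul _ (hP.enorm.pow_const _)
      _ ≤ B ^ (2 / s - 2) * B ^ (2 : ℝ) := by
        gcongr
        rw [eLpNorm_eq_lintegral_rpow_enorm_toReal (by norm_num) (by norm_num)] at hB2
        simp only [ENNReal.toReal_ofNat] at hB2
        have := ENNReal.rpow_le_rpow hB2 (z := 2) (by norm_num)
        rwa [← ENNReal.rpow_mul, one_div, inv_mul_cancel₀ (by norm_num), ENNReal.rpow_one] at this
      _ = B ^ (2 / s) := by
        rw [← ENNReal.rpow_add_of_nonneg _ _ h3 (by norm_num)]
        congr 1; ring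
  calc (∫⁻ x, ‖P x‖ₑ ^ (2 / s)) ^ (1 / (2 / s)) ≤ (B ^ (2 / s)) ^ (1 / (2 / s)) := by
        gcongr
    _ = B := by
        rw [← ENNReal.rpow_mul, mul_one_div_cancel (by positivity), ENNReal.rpow_one]

/-- The function `m(D) φ` for a symbol `m` and a Schwartz function `φ`. -/
def multiplier (m : E3 → ℂ) (φ : 𝓢(E3, ℂ)) : E3 → ℂ := 𝓕⁻ (fun ξ : E3 => m ξ * (𝓕 φ) ξ)

/-- A bound for the `L¹` and `L²` norms of `(1 + 2π|ξ|) φ̂`. -/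
def multiplierBound (φ : 𝓢(E3, ℂ)) : ℝ≥0∞ :=
  eLpNorm (fun ξ => (1 + 2 * Real.pi * ‖ξ‖) * ‖(𝓕 φ) ξ‖) 1 volume
    + eLpNorm (fun ξ => (1 + 2 * Real.pi * ‖ξ‖) * ‖(𝓕 φ) ξ‖) 2 volume

theorem multiplierBound_left (φ : 𝓢(E3, ℂ)) :
    eLpNorm (fun ξ => (1 + 2 * Real.pi * ‖ξ‖) * ‖(𝓕 φ) ξ‖) 1 volume ≤ multiplierBound φ :=
  le_self_add

theorem multiplierBound_right (φ : 𝓢(E3, ℂ)) :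
    eLpNorm (fun ξ => (1 + 2 * Real.pi * ‖ξ‖) * ‖(𝓕 φ) ξ‖) 2 volume ≤ multiplierBound φ :=
  le_add_self

/-- The Schwartz function `|ξ|² χ(ξ)`. -/
def normSqMul (χ : 𝓢(E3, ℂ)) : 𝓢(E3, ℂ) := SchwartzMap.smulLeftCLM ℂ (fun ξ : E3 => ‖ξ‖ ^ 2) χ

theorem normSqMul_apply (χ : 𝓢(E3, ℂ)) (ξ : E3) : normSqMul χ ξ = (‖ξ‖ ^ 2 : ℝ) * χ ξ := by
  rw [normSqMul, SchwartzMap.smulLeftCLM_apply_apply (by fun_prop), Complex.real_smul]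

/-- The weight is not smooth at the origin; `|ξ| ≤ 1 + |ξ|²` replaces it by a polynomial, which
preserves Schwartz functions. -/
theorem memLp_weight_mul (χ : 𝓢(E3, ℂ)) (p : ℝ≥0∞) [Fact (1 ≤ p)] :
    MemLp (fun ξ => (1 + 2 * Real.pi * ‖ξ‖) * ‖χ ξ‖) p volume := by
  have h1 : MemLp (fun ξ => ‖χ ξ‖) p volume := (χ.memLp p).norm
  have h2 : MemLp (fun ξ => ‖normSqMul χ ξ‖) p volume := ((normSqMul χ).memLp p).norm
  refine ((h1.add h2).const_mul (1 + 2 * Real.pi)).mono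
    (by have := χ.continuous; fun_prop) (Eventually.of_forall fun ξ => ?_)
  simp only [Pi.add_apply, normSqMul_apply, norm_mul, norm_norm, Complex.norm_real, norm_pow]
  rw [Real.norm_of_nonneg (by positivity), Real.norm_of_nonneg (by positivity),
    Real.norm_of_nonneg (by positivity)]
  have h3 : ‖ξ‖ ≤ 1 + ‖ξ‖ ^ 2 := by nlinarith [sq_nonneg (‖ξ‖ - 1)]
  have h4 : 1 + 2 * Real.pi * ‖ξ‖ ≤ (1 + 2 * Real.pi) * (1 + ‖ξ‖ ^ 2) := by
    nlinarith [Real.pi_pos, sq_nonneg ‖ξ‖]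
  calc _ ≤ ((1 + 2 * Real.pi) * (1 + ‖ξ‖ ^ 2)) * ‖χ ξ‖ := by gcongr
    _ = _ := by ring

theorem multiplierBound_lt_top (φ : 𝓢(E3, ℂ)) : multiplierBound φ < ⊤ :=
  ENNReal.add_lt_top.2 ⟨(memLp_weight_mul _ 1).2, (memLp_weight_mul _ 2).2⟩

theorem memLp_symbol_mul {m : E3 → ℂ} (hm : Measurable m) {c : ℝ}
    (hc : ∀ ξ, ‖m ξ‖ ≤ c * (1 + 2 * Real.pi * ‖ξ‖)) (χ : 𝓢(E3, ℂ)) (p : ℝ≥0∞) [Fact (1 ≤ p)] :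
    MemLp (fun ξ => m ξ * χ ξ) p volume := by
  refine ((memLp_weight_mul χ p).const_mul c).mono
    (hm.mul χ.continuous.measurable).aestronglyMeasurable (Eventually.of_forall fun ξ => ?_)
  rw [norm_mul, norm_mul, norm_mul, norm_norm, ← mul_assoc]
  gcongr
  refine (hc ξ).trans ?_
  rw [Real.norm_of_nonneg (r := 1 + 2 * Real.pi * ‖ξ‖) (by positivity)]
  gcongr
  exact le_abs_self c

theorem integrable_symbol_mul {m : E3 → ℂ} (hm : Measurable m) {c : ℝ}
    (hc : ∀ ξ, ‖m ξ‖ ≤ c * (1 + 2 * Real.pi * ‖ξ‖)) (χ : 𝓢(E3, ℂ)) :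
    Integrable (fun ξ => m ξ * χ ξ) := memLp_one_iff_integrable.1 (memLp_symbol_mul hm hc χ 1)

/-- The sup norm of `m(D) φ` is controlled by the `L¹` norm of `m φ̂`, its `L²` norm by Plancherel.
The symbol enters only through the constant `c`; applied to Taylor remainders of symbols, small `c`
yields differentiability in time. -/
theorem lintegral_enorm_mul_multiplier_le {s : ℝ} (hs0 : 0 < s) (hs1 : s < 1) {f : E3 → ℝ}
    (hf : Measurable f) {m : E3 → ℂ} (hm : Measurable m) {c : ℝ}
    (hc : ∀ ξ, ‖m ξ‖ ≤ c * (1 + 2 * Real.pi * ‖ξ‖)) (φ : 𝓢(E3, ℂ)) :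
    ∫⁻ x, ‖f x‖ₑ * ‖multiplier m φ x‖ₑ ≤
      (∫⁻ x, ‖f x‖ₑ ^ (2 / (2 - s))) ^ (1 / (2 / (2 - s)))
        * (ENNReal.ofReal c * multiplierBound φ) := by
  have hi := integrable_symbol_mul hm hc (𝓕 φ)
  have hle : ∀ p : ℝ≥0∞, eLpNorm (fun ξ => m ξ * (𝓕 φ) ξ) p volume ≤ ENNReal.ofReal c *
      eLpNorm (fun ξ => (1 + 2 * Real.pi * ‖ξ‖) * ‖(𝓕 φ) ξ‖) p volume := by
    intro p
    refine eLpNorm_le_mul_eLpNorm_of_ae_le_mul (Eventually.of_forall fun ξ => ?_) p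
    rw [norm_mul, norm_mul, norm_norm, Real.norm_of_nonneg (by positivity), ← mul_assoc]
    gcongr
    exact hc ξ
  have h1 : ∀ x, ‖multiplier m φ x‖ₑ ≤ ENNReal.ofReal c * multiplierBound φ := fun x => by
    have h : ‖multiplier m φ x‖ₑ ≤ eLpNorm (fun ξ => m ξ * (𝓕 φ) ξ) 1 volume := by
      rw [eLpNorm_one_eq_lintegral_enorm, ← ofReal_integral_norm_eq_lintegral_enorm hi,
        ← ofReal_norm]
      exact ENNReal.ofReal_le_ofReal (norm_fourierInv_le_integral_norm _ _)
    exact (h.trans (hle 1)).trans (mul_le_mul' le_rfl (multiplierBound_left φ))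
  have h2 : eLpNorm (multiplier m φ) 2 volume ≤ ENNReal.ofReal c * multiplierBound φ := by
    have h : eLpNorm (multiplier m φ) 2 volume = eLpNorm (fun ξ => m ξ * (𝓕 φ) ξ) 2 volume :=
      eLpNorm_two_fourierInv hi (memLp_symbol_mul hm hc (𝓕 φ) 2)
    exact (h.le.trans (hle 2)).trans (mul_le_mul' le_rfl (multiplierBound_right φ))
  have h3 : Measurable (multiplier m φ) := (continuous_fourierInv_of_integrable hi).measurable
  exact lintegral_enorm_mul_le hs0 hs1 hf h3 h1 h2

end RadialWave
end

noncomputable section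

namespace RadialWave

/-! ### The forcing term paired with multipliers -/

/-- A family of symbols `m σ`, continuous in `σ`, of order at most one. -/
structure IsSymbolFamily (m : ℝ → E3 → ℂ) : Prop where
  measurable : ∀ σ, Measurable (m σ)
  continuous : ∀ ξ, Continuous fun σ => m σ ξ
  bound : ∀ σ ξ, ‖m σ ξ‖ ≤ (1 + |σ|) * (1 + 2 * Real.pi * ‖ξ‖)

/-- The symbol of `cos(t√-Δ)`. -/
def cosSymbol (t : ℝ) (ξ : E3) : ℂ := (Real.cos (t * (2 * Real.pi * ‖ξ‖)) : ℂ)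

/-- The symbol of `sin(t√-Δ)/√-Δ`, with its continuous value at the origin. -/
def sineSymbol (t : ℝ) (ξ : E3) : ℂ := ((t * Real.sinc (t * (2 * Real.pi * ‖ξ‖)) : ℝ) : ℂ)

theorem mul_sinc_mul (t : ℝ) {k : ℝ} (hk : k ≠ 0) : t * Real.sinc (t * k) = Real.sin (t * k) / k := by
  rcases eq_or_ne t 0 with rfl | ht
  · simp
  · rw [Real.sinc_of_ne_zero (mul_ne_zero ht hk)]
    field_simp

theorem two_pi_norm_pos {ξ : E3} (hξ : ξ ≠ 0) : 0 < 2 * Real.pi * ‖ξ‖ := by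
  have := norm_pos_iff.2 hξ
  positivity

theorem sineSymbol_of_ne_zero (t : ℝ) {ξ : E3} (hξ : ξ ≠ 0) : sineSymbol t ξ =
    ((Real.sin (t * (2 * Real.pi * ‖ξ‖)) / (2 * Real.pi * ‖ξ‖) : ℝ) : ℂ) := by
  rw [sineSymbol, mul_sinc_mul t (two_pi_norm_pos hξ).ne']

theorem ae_ne_zero : ∀ᵐ ξ : E3 ∂volume, ξ ≠ 0 := by simp [ae_iff]

/-- The two symbols can differ only at the origin, a null set. -/
theorem sinePropagator_eq (t : ℝ) (φ : 𝓢(E3, ℂ)) :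
    sinePropagator t φ = multiplier (sineSymbol t) φ := by
  ext x
  refine Real.fourierInv_congr_ae ?_ x
  filter_upwards [ae_ne_zero] with ξ hξ
  rw [sineSymbol_of_ne_zero t hξ]

theorem norm_sineSymbol_le (t : ℝ) (ξ : E3) : ‖sineSymbol t ξ‖ ≤ |t| := by
  rw [sineSymbol, Complex.norm_real, Real.norm_eq_abs, abs_mul]
  exact mul_le_of_le_one_right (abs_nonneg t) (Real.abs_sinc_le_one _)

theorem norm_cosSymbol_le (t : ℝ) (ξ : E3) : ‖cosSymbol t ξ‖ ≤ 1 := by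
  rw [cosSymbol, Complex.norm_real]
  exact Real.abs_cos_le_one _

theorem isSymbolFamily_sine : IsSymbolFamily sineSymbol where
  measurable σ := by
    unfold sineSymbol
    have := Real.continuous_sinc.measurable
    fun_prop
  continuous ξ := by
    unfold sineSymbol
    have := Real.continuous_sinc
    fun_prop
  bound σ ξ := by
    refine (norm_sineSymbol_le σ ξ).trans ?_
    have h0 : 0 ≤ 2 * Real.pi * ‖ξ‖ := by positivity
    nlinarith [abs_nonneg σ]

theorem isSymbolFamily_cos : IsSymbolFamily cosSymbol where
  measurable σ := by unfold cosSymbol; fun_prop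
  continuous ξ := by unfold cosSymbol; fun_prop
  bound σ ξ := by
    refine (norm_cosSymbol_le σ ξ).trans ?_
    have h0 : 0 ≤ 2 * Real.pi * ‖ξ‖ := by positivity
    nlinarith [abs_nonneg σ]

/-- The quadratic rate is weaker than the cubic one near `0`, but it holds globally and is all that
a first-order expansion needs. -/
theorem abs_sin_sub_self_le (y : ℝ) : |Real.sin y - y| ≤ 2 * y ^ 2 := by
  wlog hy : 0 ≤ y with H
  · have := H (-y) (by linarith)
    rwa [Real.sin_neg, neg_sq, ← neg_sub', abs_neg] at this
  rcases le_or_gt y 1 with h1 | h1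
  · rcases hy.eq_or_lt with rfl | h0
    · simp
    have h2 := Real.sin_gt_sub_cube h0
    have h3 := Real.sin_lt h0
    rw [abs_le]
    constructor <;> nlinarith [mul_nonneg (sq_nonneg y) (sub_nonneg.2 h1)]
  · have := Real.neg_one_le_sin y
    have := Real.sin_le_one y
    rw [abs_le]
    constructor <;> nlinarith

theorem abs_sin_add_sub_le (x y : ℝ) :
    |Real.sin (x + y) - Real.sin x - y * Real.cos x| ≤ 3 * y ^ 2 := by
  have h1 : Real.sin (x + y) - Real.sin x - y * Real.cos x =
      Real.sin x * (Real.cos y - 1) + Real.cos x * (Real.sin y - y) := by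
    rw [Real.sin_add]; ring
  have h2 : |Real.cos y - 1| ≤ y ^ 2 := by
    rw [abs_le]
    constructor <;> nlinarith [Real.one_sub_sq_div_two_le_cos (x := y), Real.cos_le_one y, sq_nonneg y]
  rw [h1]
  calc _ ≤ |Real.sin x| * |Real.cos y - 1| + |Real.cos x| * |Real.sin y - y| := by
        rw [← abs_mul, ← abs_mul]; exact abs_add_le _ _
    _ ≤ 1 * y ^ 2 + 1 * (2 * y ^ 2) := by
        gcongr
        exacts [Real.abs_sin_le_one x, Real.abs_cos_le_one x, abs_sin_sub_self_le y]
    _ = _ := by ring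

/-- Taylor's formula in the angle gives the remainder `3 (δk)²`; the division by `k` leaves `3 δ²
k`. The remainder is thus uniform in `σ` and of order one in the frequency, as the multiplier bounds
require. -/
theorem norm_sineSymbol_add_sub_le (σ δ : ℝ) (ξ : E3) :
    ‖sineSymbol (σ + δ) ξ - sineSymbol σ ξ - δ * cosSymbol σ ξ‖
      ≤ (3 * δ ^ 2) * (1 + 2 * Real.pi * ‖ξ‖) := by
  have h0 : 0 ≤ 2 * Real.pi * ‖ξ‖ := by positivity
  simp only [sineSymbol, cosSymbol]
  set k := 2 * Real.pi * ‖ξ‖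
  rw [← Complex.ofReal_mul, ← Complex.ofReal_sub, ← Complex.ofReal_sub, Complex.norm_real,
    Real.norm_eq_abs]
  rcases h0.eq_or_lt with hk | hk
  · rw [← hk]
    simp
    positivity
  · have h1 : Real.sin ((σ + δ) * k) / k - Real.sin (σ * k) / k - δ * Real.cos (σ * k)
        = (Real.sin (σ * k + δ * k) - Real.sin (σ * k) - (δ * k) * Real.cos (σ * k)) / k := by
      rw [add_mul]; field_simp
    rw [mul_sinc_mul _ hk.ne', mul_sinc_mul _ hk.ne', h1, abs_div, abs_of_pos hk, div_le_iff₀ hk]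
    refine (abs_sin_add_sub_le _ _).trans ?_
    nlinarith [sq_nonneg δ, mul_nonneg (sq_nonneg δ) hk.le]

/-- Joint continuity makes the force pairing with a time-dependent symbol measurable in time.
Dominated convergence applies because the symbols are bounded locally uniformly in `σ`. -/
theorem continuous_multiplier {m : ℝ → E3 → ℂ} (hm : IsSymbolFamily m) (φ : 𝓢(E3, ℂ)) :
    Continuous fun q : ℝ × E3 => multiplier (m q.1) φ q.2 := by
  refine continuous_iff_continuousAt.2 fun q₀ => ?_
  simp only [multiplier, Real.fourierInv_eq']
  have hw := memLp_one_iff_integrable.1 (memLp_weight_mul (𝓕 φ) 1)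
  refine continuousAt_of_dominated (bound := fun ξ =>
    (2 + |q₀.1|) * ((1 + 2 * Real.pi * ‖ξ‖) * ‖(𝓕 φ) ξ‖)) (Eventually.of_forall fun q => ?_) ?_
    (hw.const_mul _) (Eventually.of_forall fun ξ => ?_)
  · refine Measurable.aestronglyMeasurable ?_
    have := hm.measurable q.1
    have := (𝓕 φ).continuous.measurable
    fun_prop
  · have : ∀ᶠ q : ℝ × E3 in 𝓝 q₀, |q.1| < 1 + |q₀.1| :=
      (continuous_fst.abs.tendsto q₀).eventually (gt_mem_nhds (by simp))
    filter_upwards [this] with q hq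
    refine Eventually.of_forall fun ξ => ?_
    rw [norm_smul, norm_mul, Complex.norm_exp_ofReal_mul_I, one_mul, ← mul_assoc]
    gcongr
    refine (hm.bound _ _).trans (mul_le_mul_of_nonneg_right ?_ (by positivity))
    linarith
  · have := hm.continuous ξ
    fun_prop

theorem multiplier_linear {m₁ m₂ : E3 → ℂ} (hm₁ : Measurable m₁) (hm₂ : Measurable m₂) {c₁ c₂ : ℝ}
    (h₁ : ∀ ξ, ‖m₁ ξ‖ ≤ c₁ * (1 + 2 * Real.pi * ‖ξ‖))
    (h₂ : ∀ ξ, ‖m₂ ξ‖ ≤ c₂ * (1 + 2 * Real.pi * ‖ξ‖)) (a : ℂ) (φ : 𝓢(E3, ℂ)) (x : E3) :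
    multiplier (fun ξ => m₁ ξ - a * m₂ ξ) φ x = multiplier m₁ φ x - a * multiplier m₂ φ x := by
  have key : ∀ {m : E3 → ℂ} {c : ℝ}, Measurable m → (∀ ξ, ‖m ξ‖ ≤ c * (1 + 2 * Real.pi * ‖ξ‖)) →
      Integrable fun v => Complex.exp (↑(2 * Real.pi * inner ℝ v x) * Complex.I) • (m v * (𝓕 φ) v) := by
    intro m c hm hc
    refine (integrable_symbol_mul hm hc (𝓕 φ)).bdd_mul (c := 1) ?_ ?_
    · exact Continuous.aestronglyMeasurable (by fun_prop)
    · exact Eventually.of_forall fun v => by rw [Complex.norm_exp_ofReal_mul_I]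
  simp only [multiplier, Real.fourierInv_eq']
  rw [← integral_const_mul, ← integral_sub (key hm₁ h₁) ((key hm₂ h₂).const_mul a)]
  congr 1
  ext v
  simp only [smul_eq_mul]
  ring

/-- The norm of `F(|x|,τ)` in `L^{2/(2-s)}_x`. -/
def sliceNorm (s : ℝ) (F : ℝ → ℝ → ℝ) (τ : ℝ) : ℝ≥0∞ :=
  (∫⁻ x : E3, ‖F ‖x‖ τ‖ₑ ^ (2 / (2 - s))) ^ (1 / (2 / (2 - s)))

/-- The pairing of `F(|x|,τ)` with `m(D) φ`. -/
def forcePairing (F : ℝ → ℝ → ℝ) (m : E3 → ℂ) (φ : 𝓢(E3, ℂ)) (τ : ℝ) : ℂ :=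
  ∫ x : E3, (F ‖x‖ τ : ℂ) * multiplier m φ x

section Force

variable {s : ℝ} {F : ℝ → ℝ → ℝ}

theorem measurable_slice (hF : Measurable (Function.uncurry F)) (τ : ℝ) :
    Measurable fun x : E3 => F ‖x‖ τ :=
  hF.comp (measurable_norm.prodMk measurable_const)

theorem measurable_sliceNorm (hF : Measurable (Function.uncurry F)) : Measurable (sliceNorm s F) := by
  refine Measurable.pow_const (Measurable.lintegral_prod_left' (f := fun q : E3 × ℝ =>
    ‖F ‖q.1‖ q.2‖ₑ ^ (2 / (2 - s))) (Measurable.pow_const (Measurable.enorm ?_) _)) _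
  exact hF.comp ((measurable_norm.comp measurable_fst).prodMk measurable_snd)

/-- On a bounded interval `y ≤ 1 + y ^ q` with `q = 2/(1+s) ≥ 1` turns `L^q` integrability in time
into `L¹` integrability, the only consequence of the `Z` norm that is used. -/
theorem lintegral_sliceNorm_lt_top (hs0 : 0 < s) (hs1 : s < 1) {a b : ℝ}
    (hZ : mixedNorm (2 / (1 + s)) (2 / (2 - s)) (Icc a b) (fun x t => F ‖x‖ t) < ⊤) :
    ∫⁻ τ in Icc a b, sliceNorm s F τ < ⊤ := by
  have hq : 1 ≤ 2 / (1 + s) := by rw [le_div_iff₀] <;> linarith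
  have h1 : ∫⁻ τ in Icc a b, sliceNorm s F τ ^ (2 / (1 + s)) < ⊤ := by
    rw [mixedNorm] at hZ
    have := (ENNReal.rpow_lt_top_iff_of_pos (by positivity)).1 hZ
    refine lt_of_eq_of_lt (lintegral_congr fun τ => ?_) this
    rw [sliceNorm, ← ENNReal.rpow_mul]
    congr 1
    ring
  have h2 : ∀ y : ℝ≥0∞, y ≤ 1 + y ^ (2 / (1 + s)) := fun y => by
    rcases le_total y 1 with h | h
    · exact h.trans le_self_add
    · exact (ENNReal.le_rpow_self_of_one_le h hq).trans le_add_self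
  calc ∫⁻ τ in Icc a b, sliceNorm s F τ
      ≤ ∫⁻ τ in Icc a b, (1 + sliceNorm s F τ ^ (2 / (1 + s))) := lintegral_mono fun τ => h2 _
    _ = (∫⁻ _ in Icc a b, 1) + ∫⁻ τ in Icc a b, sliceNorm s F τ ^ (2 / (1 + s)) :=
        lintegral_add_left measurable_const _
    _ < ⊤ := ENNReal.add_lt_top.2 ⟨by simp, h1⟩

theorem ae_sliceNorm_lt_top (hF : Measurable (Function.uncurry F))
    (hK : ∀ a b : ℝ, ∫⁻ τ in Icc a b, sliceNorm s F τ < ⊤) : ∀ᵐ τ : ℝ, sliceNorm s F τ < ⊤ := by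
  have h : ∀ n : ℕ, ∀ᵐ τ : ℝ, τ ∈ Icc (-n : ℝ) n → sliceNorm s F τ < ⊤ := fun n =>
    (ae_restrict_iff' measurableSet_Icc).1
      (ae_lt_top (measurable_sliceNorm hF) (hK (-n) n).ne)
  filter_upwards [ae_all_iff.2 h] with τ hτ
  obtain ⟨n, hn⟩ := exists_nat_ge |τ|
  exact hτ n (abs_le.1 hn)

theorem intervalIntegrable_sliceNorm (hF : Measurable (Function.uncurry F))
    (hK : ∀ a b : ℝ, ∫⁻ τ in Icc a b, sliceNorm s F τ < ⊤) (a b : ℝ) :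
    IntervalIntegrable (fun τ => (sliceNorm s F τ).toReal) volume a b := by
  rw [intervalIntegrable_iff']
  exact integrable_toReal_of_lintegral_ne_top (measurable_sliceNorm hF).aemeasurable (hK _ _).ne

theorem integrable_mul_multiplier (hs0 : 0 < s) (hs1 : s < 1)
    (hF : Measurable (Function.uncurry F)) {m : E3 → ℂ} (hm : Measurable m) {c : ℝ}
    (hc : ∀ ξ, ‖m ξ‖ ≤ c * (1 + 2 * Real.pi * ‖ξ‖)) (φ : 𝓢(E3, ℂ)) {τ : ℝ}
    (hτ : sliceNorm s F τ < ⊤) :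
    Integrable fun x : E3 => (F ‖x‖ τ : ℂ) * multiplier m φ x := by
  have hmeas : Measurable (multiplier m φ) :=
    (continuous_fourierInv_of_integrable (integrable_symbol_mul hm hc (𝓕 φ))).measurable
  have hFm := measurable_slice hF τ
  refine ⟨by fun_prop, ?_⟩
  have := lintegral_enorm_mul_multiplier_le hs0 hs1 hFm hm hc φ
  rw [HasFiniteIntegral]
  refine lt_of_le_of_lt (le_of_eq ?_) (this.trans_lt (ENNReal.mul_lt_top hτ
    (ENNReal.mul_lt_top ENNReal.ofReal_lt_top (multiplierBound_lt_top φ))))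
  refine lintegral_congr fun x => ?_
  rw [enorm_mul]
  congr 1
  rw [← ofReal_norm, ← ofReal_norm, Complex.norm_real]

theorem norm_forcePairing_le (hs0 : 0 < s) (hs1 : s < 1)
    (hF : Measurable (Function.uncurry F)) {m : E3 → ℂ} (hm : Measurable m) {c : ℝ}
    (hc : ∀ ξ, ‖m ξ‖ ≤ c * (1 + 2 * Real.pi * ‖ξ‖)) (φ : 𝓢(E3, ℂ)) {τ : ℝ}
    (hτ : sliceNorm s F τ < ⊤) :
    ‖forcePairing F m φ τ‖ ≤ c * ((multiplierBound φ).toReal * (sliceNorm s F τ).toReal) := by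
  have hc0 : 0 ≤ c := by simpa using (norm_nonneg _).trans (hc 0)
  have hFm := measurable_slice hF τ
  have h1 := lintegral_enorm_mul_multiplier_le hs0 hs1 hFm hm hc φ
  have h2 : ‖forcePairing F m φ τ‖ₑ ≤
      sliceNorm s F τ * (ENNReal.ofReal c * multiplierBound φ) := by
    refine (enorm_integral_le_lintegral_enorm _).trans (le_trans (le_of_eq ?_) h1)
    refine lintegral_congr fun x => ?_
    rw [enorm_mul]
    congr 1
    rw [← ofReal_norm, ← ofReal_norm, Complex.norm_real]
  have hne : sliceNorm s F τ * (ENNReal.ofReal c * multiplierBound φ) ≠ ⊤ :=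
    (ENNReal.mul_lt_top hτ
      (ENNReal.mul_lt_top ENNReal.ofReal_lt_top (multiplierBound_lt_top φ))).ne
  have h3 := ENNReal.toReal_mono hne h2
  rw [toReal_enorm, ENNReal.toReal_mul, ENNReal.toReal_mul, ENNReal.toReal_ofReal hc0] at h3
  linarith

theorem stronglyMeasurable_forcePairing (hF : Measurable (Function.uncurry F))
    {m : ℝ → E3 → ℂ} (hm : IsSymbolFamily m) (φ : 𝓢(E3, ℂ)) {κ : ℝ → ℝ} (hκ : Continuous κ) :
    StronglyMeasurable fun τ => forcePairing F (m (κ τ)) φ τ := by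
  refine StronglyMeasurable.integral_prod_right' (f := fun q : ℝ × E3 =>
    (F ‖q.2‖ q.1 : ℂ) * multiplier (m (κ q.1)) φ q.2) (Measurable.stronglyMeasurable ?_)
  refine Measurable.mul (Complex.measurable_ofReal.comp
    (hF.comp ((measurable_norm.comp measurable_snd).prodMk measurable_fst))) ?_
  exact ((continuous_multiplier hm φ).comp
    ((hκ.comp continuous_fst).prodMk continuous_snd)).measurable

theorem intervalIntegrable_forcePairing (hs0 : 0 < s) (hs1 : s < 1)
    (hF : Measurable (Function.uncurry F))
    (hK : ∀ a b : ℝ, ∫⁻ τ in Icc a b, sliceNorm s F τ < ⊤)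
    {m : ℝ → E3 → ℂ} (hm : IsSymbolFamily m) (φ : 𝓢(E3, ℂ)) {κ : ℝ → ℝ} (hκ : Continuous κ)
    (a b : ℝ) : IntervalIntegrable (fun τ => forcePairing F (m (κ τ)) φ τ) volume a b := by
  have h1 : IntervalIntegrable (fun τ => (1 + |κ τ|) *
      ((multiplierBound φ).toReal * (sliceNorm s F τ).toReal)) volume a b :=
    ((intervalIntegrable_sliceNorm hF hK a b).const_mul _).continuousOn_mul
      (by fun_prop)
  refine h1.mono_fun (stronglyMeasurable_forcePairing hF hm φ hκ).aestronglyMeasurable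
    (ae_restrict_of_ae ?_)
  filter_upwards [ae_sliceNorm_lt_top hF hK] with τ hτ
  refine (norm_forcePairing_le hs0 hs1 hF (hm.measurable _) (hm.bound (κ τ)) φ hτ).trans ?_
  exact le_abs_self _

/-- The Duhamel term is differentiable in time. -/
theorem hasDerivAt_duhamel (hs0 : 0 < s) (hs1 : s < 1)
    (hF : Measurable (Function.uncurry F))
    (hK : ∀ a b : ℝ, ∫⁻ τ in Icc a b, sliceNorm s F τ < ⊤) (φ : 𝓢(E3, ℂ)) (t : ℝ) :
    HasDerivAt (fun t => ∫ τ in (0 : ℝ)..t, forcePairing F (sineSymbol (t - τ)) φ τ)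
      (∫ τ in (0 : ℝ)..t, forcePairing F (cosSymbol (t - τ)) φ τ) t := by
  set B := (multiplierBound φ).toReal with hB
  set K : ℝ → ℝ := fun τ => (sliceNorm s F τ).toReal with hKdef
  have hKi := intervalIntegrable_sliceNorm hF hK
  have hB0 : 0 ≤ B := ENNReal.toReal_nonneg
  have hS : ∀ t a b, IntervalIntegrable (fun τ => forcePairing F (sineSymbol (t - τ)) φ τ)
      volume a b := fun t a b =>
    intervalIntegrable_forcePairing hs0 hs1 hF hK isSymbolFamily_sine φ
      (κ := fun τ => t - τ) (by fun_prop) a b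
  have hC : ∀ t a b, IntervalIntegrable (fun τ => forcePairing F (cosSymbol (t - τ)) φ τ)
      volume a b := fun t a b =>
    intervalIntegrable_forcePairing hs0 hs1 hF hK isSymbolFamily_cos φ
      (κ := fun τ => t - τ) (by fun_prop) a b
  -- the two error terms
  have hquad : ∀ δ : ℝ, ‖∫ τ in (0 : ℝ)..t, (forcePairing F (sineSymbol (t + δ - τ)) φ τ
      - forcePairing F (sineSymbol (t - τ)) φ τ - δ * forcePairing F (cosSymbol (t - τ)) φ τ)‖
      ≤ |∫ τ in (0 : ℝ)..t, 3 * δ ^ 2 * (B * K τ)| := by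
    intro δ
    refine intervalIntegral.norm_integral_le_abs_of_norm_le (ae_restrict_of_ae ?_)
      (((hKi 0 t).const_mul _).const_mul _)
    filter_upwards [ae_sliceNorm_lt_top hF hK] with τ hτ
    have e1 := integrable_mul_multiplier hs0 hs1 hF (isSymbolFamily_sine.measurable (t + δ - τ))
      (isSymbolFamily_sine.bound _) φ hτ
    have e2 := integrable_mul_multiplier hs0 hs1 hF (isSymbolFamily_sine.measurable (t - τ))
      (isSymbolFamily_sine.bound _) φ hτ
    have e3 := integrable_mul_multiplier hs0 hs1 hF (isSymbolFamily_cos.measurable (t - τ))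
      (isSymbolFamily_cos.bound _) φ hτ
    have hm1 : Measurable fun ξ => sineSymbol (t + δ - τ) ξ - 1 * sineSymbol (t - τ) ξ :=
      (isSymbolFamily_sine.measurable (t + δ - τ)).sub
        ((isSymbolFamily_sine.measurable (t - τ)).const_mul 1)
    have hb1 : ∀ ξ, ‖sineSymbol (t + δ - τ) ξ - 1 * sineSymbol (t - τ) ξ‖ ≤
        ((1 + |t + δ - τ|) + (1 + |t - τ|)) * (1 + 2 * Real.pi * ‖ξ‖) := fun ξ => by
      rw [one_mul, add_mul]
      exact (norm_sub_le _ _).trans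
        (add_le_add (isSymbolFamily_sine.bound _ _) (isSymbolFamily_sine.bound _ _))
    have hm2 := hm1.sub ((isSymbolFamily_cos.measurable (t - τ)).const_mul (δ : ℂ))
    -- Collecting the three pairings into one multiplier lets the bound for the Taylor remainder of
    -- the symbol act before any norm is taken.
    have hlin : forcePairing F (sineSymbol (t + δ - τ)) φ τ
        - forcePairing F (sineSymbol (t - τ)) φ τ - δ * forcePairing F (cosSymbol (t - τ)) φ τ
        = forcePairing F (fun ξ => (sineSymbol (t + δ - τ) ξ - 1 * sineSymbol (t - τ) ξ)
          - δ * cosSymbol (t - τ) ξ) φ τ := by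
      rw [forcePairing, forcePairing, forcePairing, forcePairing, ← integral_sub e1 e2,
        ← integral_const_mul]
      refine (integral_sub (e1.sub e2) (e3.const_mul _)).symm.trans ?_
      refine integral_congr_ae (Eventually.of_forall fun x => ?_)
      simp only [Pi.sub_apply]
      rw [multiplier_linear hm1 (isSymbolFamily_cos.measurable (t - τ)) hb1
        (isSymbolFamily_cos.bound _), multiplier_linear (isSymbolFamily_sine.measurable _)
        (isSymbolFamily_sine.measurable _) (isSymbolFamily_sine.bound _)
        (isSymbolFamily_sine.bound _)]
      ring
    rw [hlin]
    refine norm_forcePairing_le hs0 hs1 hF hm2 (fun ξ => ?_) φ hτ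
    have := norm_sineSymbol_add_sub_le (t - τ) δ ξ
    rwa [show t - τ + δ = t + δ - τ by ring, ← one_mul (sineSymbol (t - τ) ξ)] at this
  -- On the added time interval the lag is at most `|δ|`, so the sine symbol is itself `O(δ)`. With
  -- the shrinking domain of integration this gives `o(δ)`: the upper limit contributes nothing to
  -- the derivative.
  have hlast : ∀ δ : ℝ, ‖∫ τ in t..(t + δ), forcePairing F (sineSymbol (t + δ - τ)) φ τ‖
      ≤ |∫ τ in t..(t + δ), |δ| * (B * K τ)| := by
    intro δ
    refine intervalIntegral.norm_integral_le_abs_of_norm_le ?_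
      (((hKi t (t + δ)).const_mul _).const_mul _)
    filter_upwards [ae_restrict_of_ae (ae_sliceNorm_lt_top hF hK),
      ae_restrict_mem measurableSet_uIoc] with τ hτ hmem
    have hle : |t + δ - τ| ≤ |δ| := by
      rcases le_total 0 δ with hδ | hδ
      · rw [uIoc_of_le (by linarith)] at hmem
        rw [abs_of_nonneg hδ, abs_of_nonneg] <;> linarith [hmem.1, hmem.2]
      · rw [uIoc_of_ge (by linarith)] at hmem
        rw [abs_of_nonpos hδ, abs_of_nonpos] <;> linarith [hmem.1, hmem.2]
    refine norm_forcePairing_le hs0 hs1 hF (isSymbolFamily_sine.measurable _) (fun ξ => ?_) φ hτ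
    refine ((norm_sineSymbol_le _ ξ).trans hle).trans ?_
    have h0 : 0 ≤ 2 * Real.pi * ‖ξ‖ := by positivity
    nlinarith [abs_nonneg δ]
  rw [hasDerivAt_iff_isLittleO_nhds_zero]
  have hprim : Tendsto (fun δ => ∫ τ in t..(t + δ), B * K τ) (𝓝 0) (𝓝 0) := by
    have hc : Continuous fun b => ∫ τ in t..b, B * K τ :=
      intervalIntegral.continuous_primitive (fun a b => (hKi a b).const_mul B) t
    have h := (hc.comp (continuous_const_add t)).tendsto 0
    simp only [Function.comp_def, add_zero, intervalIntegral.integral_same] at h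
    exact h
  rw [Asymptotics.isLittleO_iff]
  intro ε hε
  set J := |∫ τ in (0 : ℝ)..t, B * K τ|
  have h1 : ∀ᶠ δ : ℝ in 𝓝 0, |∫ τ in t..(t + δ), B * K τ| < ε / 2 := by
    exact hprim.abs.eventually (gt_mem_nhds (by rw [abs_zero]; positivity))
  have h2 : ∀ᶠ δ : ℝ in 𝓝 0, 3 * |δ| * J < ε / 2 := by
    have hc : Continuous fun δ : ℝ => 3 * |δ| * J := by fun_prop
    exact (hc.tendsto 0).eventually (gt_mem_nhds (by simpa using hε))
  filter_upwards [h1, h2] with δ hδ1 hδ2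
  have hsplit : (∫ τ in (0 : ℝ)..(t + δ), forcePairing F (sineSymbol (t + δ - τ)) φ τ)
      - (∫ τ in (0 : ℝ)..t, forcePairing F (sineSymbol (t - τ)) φ τ)
      - δ • (∫ τ in (0 : ℝ)..t, forcePairing F (cosSymbol (t - τ)) φ τ)
      = (∫ τ in (0 : ℝ)..t, (forcePairing F (sineSymbol (t + δ - τ)) φ τ
      - forcePairing F (sineSymbol (t - τ)) φ τ - δ * forcePairing F (cosSymbol (t - τ)) φ τ))
      + ∫ τ in t..(t + δ), forcePairing F (sineSymbol (t + δ - τ)) φ τ := by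
    rw [intervalIntegral.integral_sub ((hS _ _ _).sub (hS _ _ _)) ((hC _ _ _).const_mul _),
      intervalIntegral.integral_sub (hS _ _ _) (hS _ _ _), intervalIntegral.integral_const_mul,
      ← intervalIntegral.integral_add_adjacent_intervals (hS (t + δ) 0 t) (hS (t + δ) t (t + δ)),
      Complex.real_smul]
    ring
  rw [hsplit]
  refine (norm_add_le _ _).trans ((add_le_add (hquad δ) (hlast δ)).trans ?_)
  rw [intervalIntegral.integral_const_mul (3 * δ ^ 2), intervalIntegral.integral_const_mul |δ|,
    abs_mul (3 * δ ^ 2), abs_mul |δ|, abs_abs, abs_of_nonneg (by positivity : 0 ≤ 3 * δ ^ 2),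
    Real.norm_eq_abs, ← sq_abs δ]
  have := abs_nonneg δ
  nlinarith

end Force

end RadialWave
end

noncomputable section

namespace RadialWave

/-! ### Radial test functions -/

/-- Complex-valued test functions on the half-line `(0,∞)`. -/
structure IsHalfLineTest (ψ : ℝ → ℂ) : Prop where
  contDiff : ContDiff ℝ ∞ ψ
  hasCompactSupport : HasCompactSupport ψ
  tsupport_subset : tsupport ψ ⊆ Ioi 0

namespace IsHalfLineTest

variable {ψ : ℝ → ℂ}

theorem deriv (h : IsHalfLineTest ψ) : IsHalfLineTest (deriv ψ) where
  contDiff := (contDiff_infty_iff_deriv.1 h.contDiff).2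
  hasCompactSupport := h.hasCompactSupport.deriv
  tsupport_subset := (tsupport_deriv_subset (𝕜 := ℝ)).trans h.tsupport_subset

theorem translate (h : IsHalfLineTest ψ) {T : ℝ} (hT : 0 ≤ T) :
    IsHalfLineTest fun r => ψ (r - T) where
  contDiff := h.contDiff.comp (contDiff_id.sub contDiff_const)
  hasCompactSupport := h.hasCompactSupport.comp_homeomorph (Homeomorph.subRight T)
  tsupport_subset := by
    have : tsupport (fun r => ψ (r - T)) = (Homeomorph.subRight T) ⁻¹' tsupport ψ :=
      tsupport_comp_eq_preimage ψ (Homeomorph.subRight T)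
    rw [this]
    intro r hr
    have := h.tsupport_subset hr
    simp only [Homeomorph.coe_subRight, mem_Ioi, sub_pos] at this
    exact hT.trans_lt this

theorem exists_bounds (h : IsHalfLineTest ψ) :
    ∃ a b : ℝ, 0 < a ∧ a < b ∧ ∀ r, ψ r ≠ 0 → r ∈ Icc a b := by
  obtain ⟨b, hb⟩ := h.hasCompactSupport.isCompact.bddAbove
  rcases (tsupport ψ).eq_empty_or_nonempty with he | hne
  · refine ⟨1, 2, one_pos, by norm_num, fun r hr => ?_⟩
    have := subset_tsupport ψ hr
    simp [he] at this
  · obtain ⟨a, ha, hmin⟩ := h.hasCompactSupport.isCompact.exists_isLeast hne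
    refine ⟨a, b + 1, h.tsupport_subset ha, by linarith [hb ha], fun r hr => ?_⟩
    have := subset_tsupport ψ hr
    exact ⟨hmin this, by linarith [hb this]⟩

theorem eq_zero_of_nonpos (h : IsHalfLineTest ψ) {r : ℝ} (hr : r ≤ 0) : ψ r = 0 := by
  by_contra hne
  exact absurd (h.tsupport_subset (subset_tsupport ψ hne)) (by simpa using hr)

end IsHalfLineTest

/-- The radial function `ψ(|x|) / (4π|x|)`. -/
def radialFun (ψ : ℝ → ℂ) (x : E3) : ℂ := ψ ‖x‖ / (4 * Real.pi * ‖x‖ : ℝ)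

section Radial

variable {ψ : ℝ → ℂ}

theorem radialFun_eventuallyEq_zero (h : IsHalfLineTest ψ) : radialFun ψ =ᶠ[𝓝 0] 0 := by
  obtain ⟨a, b, ha, -, hab⟩ := h.exists_bounds
  filter_upwards [Metric.ball_mem_nhds (0 : E3) ha] with x hx
  have : ψ ‖x‖ = 0 := by
    by_contra hne
    have := (hab _ hne).1
    simp at hx
    linarith
  simp [radialFun, this]

theorem contDiff_radialFun (h : IsHalfLineTest ψ) : ContDiff ℝ ∞ (radialFun ψ) := by
  refine contDiff_iff_contDiffAt.2 fun x => ?_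
  rcases eq_or_ne x 0 with rfl | hx
  · exact contDiffAt_const.congr_of_eventuallyEq (radialFun_eventuallyEq_zero h)
  · have h1 : ContDiffAt ℝ ∞ (fun x : E3 => ‖x‖) x := contDiffAt_norm ℝ hx
    have h2 : ContDiffAt ℝ ∞ (fun x : E3 => ψ ‖x‖) x := h.contDiff.contDiffAt.comp x h1
    have h3 : ContDiffAt ℝ ∞ (fun x : E3 => ((4 * Real.pi * ‖x‖ : ℝ) : ℂ)) x :=
      Complex.ofRealCLM.contDiff.contDiffAt.comp x (contDiffAt_const.mul h1)
    have h4 : ((4 * Real.pi * ‖x‖ : ℝ) : ℂ) ≠ 0 := by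
      have := norm_pos_iff.2 hx
      exact_mod_cast (by positivity : 4 * Real.pi * ‖x‖ ≠ 0)
    exact (h2.mul (h3.inv h4)).congr_of_eventuallyEq
      (Eventually.of_forall fun y => by simp only [radialFun, div_eq_mul_inv]; rfl)

theorem hasCompactSupport_radialFun (h : IsHalfLineTest ψ) :
    HasCompactSupport (radialFun ψ) := by
  obtain ⟨a, b, ha, -, hab⟩ := h.exists_bounds
  refine HasCompactSupport.intro (isCompact_closedBall (0 : E3) b) fun x hx => ?_
  have : ψ ‖x‖ = 0 := by
    by_contra hne
    exact hx (by simpa using (hab _ hne).2)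
  simp [radialFun, this]

/-- The radial function `ψ(|x|) / (4π|x|)` as a Schwartz function. -/
def radialTest (ψ : ℝ → ℂ) (h : IsHalfLineTest ψ) : 𝓢(E3, ℂ) :=
  (hasCompactSupport_radialFun h).toSchwartzMap (contDiff_radialFun h)

theorem radialTest_apply (h : IsHalfLineTest ψ) (x : E3) : radialTest ψ h x = radialFun ψ x := rfl

end Radial

open Laplacian in
theorem fourier_laplacian (φ : 𝓢(E3, ℂ)) (ξ : E3) :
    (𝓕 (Δ φ)) ξ = -((2 * Real.pi * ‖ξ‖ : ℝ) : ℂ) ^ 2 * (𝓕 φ) ξ := by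
  rw [SchwartzMap.laplacian_eq_fourierMultiplierCLM, SchwartzMap.fourierMultiplierCLM_apply,
    FourierTransform.fourier_smul, FourierTransform.fourier_fourierInv_eq, _root_.smul_apply,
    SchwartzMap.smulLeftCLM_apply_apply (by fun_prop), Complex.real_smul, Complex.real_smul]
  push_cast
  ring

theorem hasFDerivAt_norm_of_ne_zero {x : E3} (hx : x ≠ 0) :
    HasFDerivAt (fun y : E3 => ‖y‖) (‖x‖⁻¹ • innerSL ℝ x) x := by
  have hpos := norm_pos_iff.2 hx
  have h := ((hasStrictFDerivAt_norm_sq x).hasFDerivAt).sqrt (pow_ne_zero 2 hpos.ne')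
  simp only [Real.sqrt_sq (norm_nonneg _)] at h
  refine h.congr_fderiv ?_
  ext m
  simp
  field_simp

theorem hasFDerivAt_comp_norm {f : ℝ → ℂ} {f' : ℂ} {x : E3} (hx : x ≠ 0)
    (hf : HasDerivAt f f' ‖x‖) :
    HasFDerivAt (fun y : E3 => f ‖y‖) ((‖x‖⁻¹ • innerSL ℝ x).smulRight f') x := by
  refine (hf.hasFDerivAt.comp x (hasFDerivAt_norm_of_ne_zero hx)).congr_fderiv ?_
  ext m
  simp
  ring

theorem hasDerivAt_div_ofReal_pow {f : ℝ → ℂ} {f' : ℂ} {r : ℝ} (hr : r ≠ 0) (n : ℕ)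
    (hf : HasDerivAt f f' r) :
    HasDerivAt (fun r : ℝ => f r / (r : ℂ) ^ n) ((f' * r - n * f r) / (r : ℂ) ^ (n + 1)) r := by
  have hr' : (r : ℂ) ≠ 0 := by exact_mod_cast hr
  have h1 : HasDerivAt (fun r : ℝ => (r : ℂ)) 1 r := by
    simpa using (hasDerivAt_id r).ofReal_comp
  have h2 : HasDerivAt (fun r : ℝ => (r : ℂ) ^ n) (n * (r : ℂ) ^ (n - 1)) r := by
    simpa using h1.fun_pow n
  refine (hf.fun_div h2 (pow_ne_zero n hr')).congr_deriv ?_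
  rcases n with _ | n
  · simp
    field_simp
  · simp only [Nat.add_sub_cancel]
    field_simp
    ring

-- For radial `f` in dimension three `r Δf = (r f)''`, and the profile is `ψ = 4π r f`. This
-- identity reduces the radial wave equation to the half-line.
open Laplacian LineDeriv in
theorem laplacian_radialTest {ψ : ℝ → ℂ} (h : IsHalfLineTest ψ) :
    Δ (radialTest ψ h) = radialTest (deriv (deriv ψ)) h.deriv.deriv := by
  ext x
  rcases eq_or_ne x 0 with rfl | hx
  · have h0 : Δ (radialFun ψ) 0 = Δ (fun _ : E3 => (0 : ℂ)) 0 :=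
      (InnerProductSpace.laplacian_congr_nhds (radialFun_eventuallyEq_zero h)).eq_of_nhds
    rw [SchwartzMap.laplacian_apply, radialTest_apply]
    refine h0.trans ?_
    simp [radialFun]
  set f : ℝ → ℂ := fun r => ψ r / (r : ℂ) ^ 1 with hf
  set g : ℝ → ℂ := fun r => (deriv ψ r * r - ψ r) / (r : ℂ) ^ 3 with hg
  have hdψ : ∀ r, HasDerivAt ψ (deriv ψ r) r := fun r =>
    (h.contDiff.differentiable (by simp)).differentiableAt.hasDerivAt
  have hddψ : ∀ r, HasDerivAt (deriv ψ) (deriv (deriv ψ) r) r := fun r =>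
    (h.deriv.contDiff.differentiable (by simp)).differentiableAt.hasDerivAt
  have hfd : ∀ y : E3, y ≠ 0 → ∀ m : E3,
      fderiv ℝ (radialTest ψ h) y m = (4 * Real.pi : ℂ)⁻¹ * (g ‖y‖ * (inner ℝ y m : ℝ)) := by
    intro y hy m
    have hny : ‖y‖ ≠ 0 := norm_ne_zero_iff.2 hy
    have h1 := (hasFDerivAt_comp_norm hy (hasDerivAt_div_ofReal_pow hny 1 (hdψ ‖y‖))).const_mul
      (4 * Real.pi : ℂ)⁻¹
    have h2 : (radialTest ψ h : E3 → ℂ) = fun y => (4 * Real.pi : ℂ)⁻¹ * (ψ ‖y‖ / (‖y‖ : ℂ) ^ 1) := by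
      ext z
      simp only [radialTest_apply, radialFun, pow_one]
      push_cast
      rw [div_mul_eq_div_div, div_right_comm, div_eq_mul_inv, div_eq_mul_inv]
      ring
    rw [h2, h1.fderiv]
    have hny' : (‖y‖ : ℂ) ≠ 0 := by exact_mod_cast hny
    simp [g]
    field_simp
  -- With `f = ψ/r` and `g = f'/r`, the second derivative along `m` is, up to the factor `1/(4π)`,
  -- `(g'/r) ⟨x,m⟩² + g |m|²`. Summed over an orthonormal basis it becomes `r g' + 3 g = ψ''/r`.
  have hsnd : ∀ m : E3, (∂_{m} (∂_{m} (radialTest ψ h))) x = (4 * Real.pi : ℂ)⁻¹ *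
      ((deriv (deriv ψ) ‖x‖ * ‖x‖ ^ 2 - 3 * (deriv ψ ‖x‖ * ‖x‖ - ψ ‖x‖)) / (‖x‖ : ℂ) ^ 5
        * ((inner ℝ x m : ℝ) : ℂ) ^ 2 + g ‖x‖ * (‖m‖ ^ 2 : ℝ)) := by
    intro m
    have hnx : ‖x‖ ≠ 0 := norm_ne_zero_iff.2 hx
    have hnx' : (‖x‖ : ℂ) ≠ 0 := by exact_mod_cast hnx
    have h0 : ((∂_{m} (radialTest ψ h) : 𝓢(E3, ℂ)) : E3 → ℂ) =ᶠ[𝓝 x]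
        fun y => (4 * Real.pi : ℂ)⁻¹ * (g ‖y‖ * (inner ℝ y m : ℝ)) := by
      filter_upwards [isOpen_ne.mem_nhds hx] with y hy
      rw [SchwartzMap.lineDerivOp_apply_eq_fderiv, hfd y hy]
    have hr1 : HasDerivAt (fun r : ℝ => deriv ψ r * r - ψ r) (deriv (deriv ψ) ‖x‖ * ‖x‖) ‖x‖ := by
      have h1 : HasDerivAt (fun r : ℝ => (r : ℂ)) 1 ‖x‖ := by
        simpa using (hasDerivAt_id ‖x‖).ofReal_comp
      refine (((hddψ ‖x‖).fun_mul h1).fun_sub (hdψ ‖x‖)).congr_deriv ?_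
      ring
    have h1 := hasFDerivAt_comp_norm hx (hasDerivAt_div_ofReal_pow hnx 3 hr1)
    have h2 : HasFDerivAt (fun y : E3 => ((inner ℝ y m : ℝ) : ℂ))
        (Complex.ofRealCLM.comp (innerSL ℝ m)) x := by
      have := (Complex.ofRealCLM.comp (innerSL ℝ m)).hasFDerivAt (x := x)
      refine this.congr_of_eventuallyEq (Eventually.of_forall fun y => ?_)
      simp [real_inner_comm]
    have h3 := (h1.fun_mul h2).const_mul (4 * Real.pi : ℂ)⁻¹
    rw [SchwartzMap.lineDerivOp_apply_eq_fderiv, h0.fderiv_eq, h3.fderiv]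
    simp [g]
    field_simp
    ring
  rw [SchwartzMap.laplacian_eq_sum (EuclideanSpace.basisFun (Fin 3) ℝ), _root_.sum_apply]
  simp only [hsnd]
  rw [← Finset.mul_sum, Finset.sum_add_distrib, ← Finset.mul_sum]
  have hsum : ∑ i, ((inner ℝ x (EuclideanSpace.basisFun (Fin 3) ℝ i) : ℝ) : ℂ) ^ 2 = (‖x‖ : ℂ) ^ 2 := by
    have := (EuclideanSpace.basisFun (Fin 3) ℝ).sum_sq_inner_left x
    exact_mod_cast congrArg (fun r : ℝ => (r : ℂ)) this
  have hnx' : (‖x‖ : ℂ) ≠ 0 := by exact_mod_cast norm_ne_zero_iff.2 hx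
  rw [hsum]
  simp [radialTest_apply, radialFun, g]
  field_simp
  ring

theorem fourier_radialTest {ψ : ℝ → ℂ} (h : IsHalfLineTest ψ) (ξ : E3) :
    (𝓕 (radialTest ψ h)) ξ =
      ∫ x : E3, Complex.exp (↑(-2 * Real.pi * inner ℝ x ξ) * Complex.I) • radialFun ψ x := by
  rw [SchwartzMap.fourier_coe, Real.fourier_eq']
  rfl

/-- The Fourier integral of `ψ(|x| - σ) / (4π|x|)`. -/
def translateFourier (ψ : ℝ → ℂ) (ξ : E3) (σ : ℝ) : ℂ :=
  ∫ x : E3, Complex.exp (↑(-2 * Real.pi * inner ℝ x ξ) * Complex.I) •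
    radialFun (fun r => ψ (r - σ)) x

/-- Differentiation under the integral. For `|σ - σ₀| < a/2` and `σ₀ ≥ 0` the translated profile of
`ψ'` still lives on `|x| ≥ a/2`, so `1/|x|` stays bounded even when `σ₀ = 0` and `σ` is slightly
negative. -/
theorem hasDerivAt_translateFourier {ψ : ℝ → ℂ} (h : IsHalfLineTest ψ) (ξ : E3) {σ₀ : ℝ}
    (hσ₀ : 0 ≤ σ₀) :
    HasDerivAt (translateFourier ψ ξ) (-translateFourier (deriv ψ) ξ σ₀) σ₀ := by
  obtain ⟨a, b, ha, -, hab⟩ := h.deriv.exists_bounds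
  obtain ⟨M, hM⟩ := h.deriv.contDiff.continuous.bounded_above_of_compact_support
    h.deriv.hasCompactSupport
  have hM0 : 0 ≤ M := (norm_nonneg _).trans (hM 0)
  have hdψ : ∀ r, HasDerivAt ψ (deriv ψ r) r := fun r =>
    (h.contDiff.differentiable (by simp)).differentiableAt.hasDerivAt
  have hmeas : ∀ (χ : ℝ → ℂ), Continuous χ → ∀ σ, AEStronglyMeasurable (fun x : E3 =>
      Complex.exp (↑(-2 * Real.pi * inner ℝ x ξ) * Complex.I) •
        radialFun (fun r => χ (r - σ)) x) volume := by
    intro χ hχ σ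
    refine Measurable.aestronglyMeasurable ?_
    unfold radialFun
    have := hχ.measurable
    fun_prop
  have key := hasDerivAt_integral_of_dominated_loc_of_deriv_le (μ := (volume : Measure E3))
    (F := fun σ x => Complex.exp (↑(-2 * Real.pi * inner ℝ x ξ) * Complex.I) •
      radialFun (fun r => ψ (r - σ)) x)
    (F' := fun σ x => Complex.exp (↑(-2 * Real.pi * inner ℝ x ξ) * Complex.I) •
      -radialFun (fun r => deriv ψ (r - σ)) x)
    (x₀ := σ₀) (s := Metric.ball σ₀ (a / 2))
    (bound := (Metric.closedBall (0 : E3) (b + σ₀ + a)).indicator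
      fun _ => M / (4 * Real.pi * (a / 2)))
    (Metric.ball_mem_nhds _ (by positivity)) (Eventually.of_forall fun σ => ?_) ?_ ?_ ?_ ?_ ?_
  · have := key.2
    simp only [smul_neg, integral_neg] at this
    exact this
  · exact hmeas ψ h.contDiff.continuous σ
  · have hi : Integrable (radialFun fun r => ψ (r - σ₀)) :=
      (radialTest _ (h.translate hσ₀)).integrable
    refine hi.bdd_mul (c := 1) ?_ ?_
    · exact Continuous.aestronglyMeasurable (by fun_prop)
    · exact Eventually.of_forall fun v => by rw [Complex.norm_exp_ofReal_mul_I]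
  · simp only [smul_neg]
    exact (hmeas _ h.deriv.contDiff.continuous σ₀).neg
  · refine Eventually.of_forall fun x σ hσ => ?_
    rw [norm_smul, Complex.norm_exp_ofReal_mul_I, one_mul, norm_neg, radialFun]
    rw [Metric.mem_ball, Real.dist_eq, abs_lt] at hσ
    by_cases h0 : deriv ψ (‖x‖ - σ) = 0
    · rw [h0, zero_div, norm_zero]
      exact indicator_nonneg (fun _ _ => by positivity) _
    · have hb := hab _ h0
      rw [indicator_of_mem (by simpa using (by linarith [hb.2, hσ.2] : ‖x‖ ≤ b + σ₀ + a)),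
        norm_div, Complex.norm_real, Real.norm_of_nonneg (by positivity)]
      gcongr
      · exact hM _
      · linarith [hb.1, hσ.1]
  · exact (integrable_indicator_iff measurableSet_closedBall).2 (integrableOn_const
      (measure_closedBall_lt_top).ne)
  · refine Eventually.of_forall fun x σ _ => ?_
    have h1 : HasDerivAt (fun σ => ψ (‖x‖ - σ)) (-deriv ψ (‖x‖ - σ)) σ :=
      ((hdψ (‖x‖ - σ)).scomp σ ((hasDerivAt_id σ).const_sub ‖x‖)).congr_deriv (by simp)
    have h2 := (h1.div_const ((4 * Real.pi * ‖x‖ : ℝ) : ℂ)).const_smul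
      (Complex.exp (↑(-2 * Real.pi * inner ℝ x ξ) * Complex.I))
    rw [neg_div] at h2
    exact h2

/-- Translating the profile of a radial test function acts on its Fourier transform by the
one-dimensional wave propagator. -/
theorem fourier_radialTest_translate {ψ : ℝ → ℂ} (h : IsHalfLineTest ψ) {T : ℝ} (hT : 0 ≤ T)
    {ξ : E3} (hξ : ξ ≠ 0) :
    (𝓕 (radialTest _ (h.translate hT))) ξ = cosSymbol T ξ * (𝓕 (radialTest ψ h)) ξ
      - sineSymbol T ξ * (𝓕 (radialTest _ h.deriv)) ξ := by
  have hk := two_pi_norm_pos hξ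
  rw [sineSymbol_of_ne_zero T hξ, cosSymbol]
  set k := 2 * Real.pi * ‖ξ‖ with hkdef
  set y := translateFourier ψ ξ with hy
  set y' := translateFourier (deriv ψ) ξ with hy'
  have hk' : (k : ℂ) ≠ 0 := by exact_mod_cast hk.ne'
  have e0 : ∀ (χ : ℝ → ℂ) (hχ : IsHalfLineTest χ) {σ : ℝ} (hσ : 0 ≤ σ),
      translateFourier χ ξ σ = (𝓕 (radialTest _ (hχ.translate hσ))) ξ :=
    fun χ hχ σ hσ => (fourier_radialTest (hχ.translate hσ) ξ).symm
  have e1 : ∀ (χ : ℝ → ℂ) (hχ : IsHalfLineTest χ),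
      translateFourier χ ξ 0 = (𝓕 (radialTest _ hχ)) ξ := fun χ hχ => by
    rw [fourier_radialTest, translateFourier]
    simp only [sub_zero]
  -- As a function of the translation `σ`, the Fourier transform at fixed `ξ` solves `y'' = -k² y`,
  -- because two derivatives of the profile amount to the Laplacian. Here `y'` denotes the transform
  -- of the profile `ψ'`, that is, minus the derivative of `y`.
  have hode : ∀ σ, 0 ≤ σ → translateFourier (deriv (deriv ψ)) ξ σ = -(k : ℂ) ^ 2 * y σ := by
    intro σ hσ
    have hd : deriv (deriv fun r => ψ (r - σ)) = fun r => deriv (deriv ψ) (r - σ) := by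
      have h1 : ∀ χ : ℝ → ℂ, deriv (fun r => χ (r - σ)) = fun r => deriv χ (r - σ) := fun χ => by
        ext r; exact deriv_comp_sub_const _ _ _
      rw [h1, h1]
    have h2 := fourier_laplacian (radialTest _ (h.translate hσ)) ξ
    rw [laplacian_radialTest] at h2
    rw [e0 _ h.deriv.deriv hσ, hy, e0 _ h hσ, hkdef, ← h2, fourier_radialTest, fourier_radialTest, hd]
  have hdy : ∀ σ, 0 ≤ σ → HasDerivAt y (-y' σ) σ := fun σ hσ => hasDerivAt_translateFourier h ξ hσ
  have hdy' : ∀ σ, 0 ≤ σ → HasDerivAt y' ((k : ℂ) ^ 2 * y σ) σ := fun σ hσ => by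
    have := hasDerivAt_translateFourier h.deriv ξ hσ
    rw [hode σ hσ] at this
    simpa using this
  have hcos : ∀ σ : ℝ, HasDerivAt (fun σ : ℝ => (Real.cos (σ * k) : ℂ))
      (-(k * Real.sin (σ * k) : ℝ)) σ := fun σ => by
    have := ((hasDerivAt_mul_const k).cos (x := σ)).ofReal_comp
    refine this.congr_deriv ?_
    push_cast; ring
  have hsin : ∀ σ : ℝ, HasDerivAt (fun σ : ℝ => (Real.sin (σ * k) : ℂ))
      ((k * Real.cos (σ * k) : ℝ)) σ := fun σ => by
    have := ((hasDerivAt_mul_const k).sin (x := σ)).ofReal_comp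
    refine this.congr_deriv ?_
    push_cast; ring
  have hconst : ∀ f : ℝ → ℂ, (∀ σ, 0 ≤ σ → HasDerivAt f 0 σ) → f T = f 0 := by
    intro f hf
    refine constant_of_derivWithin_zero (a := 0) (b := T)
      (fun σ hσ => (hf σ hσ.1).differentiableAt.differentiableWithinAt)
      (fun σ hσ => ?_) T ⟨hT, le_rfl⟩
    exact (hf σ hσ.1).hasDerivWithinAt.derivWithin
      (uniqueDiffOn_Icc (hσ.1.trans_lt hσ.2) σ ⟨hσ.1, hσ.2.le⟩)
  -- `hA` and `hB` are the two first integrals of the oscillator: the vector formed by `k y` and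
  -- `y'` is rotated back by the angle `σ k`. Solving them for `y T` gives the claim.
  have hA := hconst (fun σ => (Real.cos (σ * k) : ℂ) * y σ + (Real.sin (σ * k) : ℂ) / k * y' σ)
    fun σ hσ => by
      refine (((hcos σ).fun_mul (hdy σ hσ)).fun_add
        (((hsin σ).div_const (k : ℂ)).fun_mul (hdy' σ hσ))).congr_deriv ?_
      push_cast
      field_simp
      ring
  have hB := hconst (fun σ => k * (Real.sin (σ * k) : ℂ) * y σ - (Real.cos (σ * k) : ℂ) * y' σ)
    fun σ hσ => by
      refine ((((hsin σ).const_mul (k : ℂ)).fun_mul (hdy σ hσ)).fun_sub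
        ((hcos σ).fun_mul (hdy' σ hσ))).congr_deriv ?_
      push_cast
      ring
  simp only [zero_mul, Real.cos_zero, Real.sin_zero, Complex.ofReal_one, Complex.ofReal_zero,
    zero_div, one_mul, add_zero, mul_zero, zero_sub] at hA hB
  rw [← e0 ψ h hT, ← e1 ψ h, ← e1 _ h.deriv, ← hy, ← hy', ← hA]
  have hB' : y' 0 = -(k * (Real.sin (T * k) : ℂ) * y T - (Real.cos (T * k) : ℂ) * y' T) := by
    rw [hB, neg_neg]
  rw [hB']
  have hcs : (Real.cos (T * k) : ℂ) ^ 2 + (Real.sin (T * k) : ℂ) ^ 2 = 1 := by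
    exact_mod_cast Real.cos_sq_add_sin_sq (T * k)
  push_cast at hcs ⊢
  field_simp
  linear_combination (-(k : ℂ) * y T) * hcs

end RadialWave
end

noncomputable section

namespace RadialWave

/-! ### Polar coordinates -/

/-- The surface measure of the unit sphere of `ℝ³`. -/
abbrev sphereMeasure : Measure (Metric.sphere (0 : E3) 1) := (volume : Measure E3).toSphere

theorem finrank_E3_sub_one : Module.finrank ℝ E3 - 1 = 2 := by simp

theorem integral_volumeIoiPow (f : ℝ → ℂ) :
    ∫ r : Ioi (0 : ℝ), f r ∂(Measure.volumeIoiPow 2) = ∫ r in Ioi (0 : ℝ), (r ^ 2 : ℝ) * f r := by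
  simp only [Measure.volumeIoiPow, ENNReal.ofReal]
  rw [integral_withDensity_eq_integral_smul (by fun_prop),
    integral_subtype_comap measurableSet_Ioi fun a : ℝ => Real.toNNReal (a ^ 2) • f a]
  refine setIntegral_congr_fun measurableSet_Ioi fun r hr => ?_
  simp only [NNReal.smul_def, Real.coe_toNNReal _ (sq_nonneg r), Complex.real_smul]

theorem integrable_polar {f : E3 → ℂ} (hf : Integrable f) :
    Integrable (fun q : Metric.sphere (0 : E3) 1 × Ioi (0 : ℝ) => f ((q.2 : ℝ) • (q.1 : E3)))
      (sphereMeasure.prod (Measure.volumeIoiPow 2)) := by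
  have hmp := (volume : Measure E3).measurePreserving_homeomorphUnitSphereProd
  rw [finrank_E3_sub_one] at hmp
  rw [← hmp.integrable_comp_emb (Homeomorph.measurableEmbedding _)]
  have h1 : IntegrableOn f {0}ᶜ := hf.integrableOn
  rw [integrableOn_iff_comap_subtypeVal (measurableSet_singleton _).compl] at h1
  refine h1.congr (Eventually.of_forall fun x => ?_)
  have hx : ‖(x : E3)‖ ≠ 0 := norm_ne_zero_iff.2 x.2
  simp [smul_smul, hx]

theorem integral_polar (f : E3 → ℂ) :
    ∫ x, f x = ∫ q : Metric.sphere (0 : E3) 1 × Ioi (0 : ℝ), f ((q.2 : ℝ) • (q.1 : E3))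
      ∂(sphereMeasure.prod (Measure.volumeIoiPow 2)) := by
  have hmp := (volume : Measure E3).measurePreserving_homeomorphUnitSphereProd
  rw [finrank_E3_sub_one] at hmp
  rw [← hmp.integral_comp (Homeomorph.measurableEmbedding _)]
  have h1 : ∫ x, f x = ∫ x : ({(0)}ᶜ : Set E3), f x ∂(volume.comap Subtype.val) := by
    rw [integral_subtype_comap (measurableSet_singleton _).compl f, restrict_compl_singleton]
  rw [h1]
  refine integral_congr_ae (Eventually.of_forall fun x => ?_)
  have hx : ‖(x : E3)‖ ≠ 0 := norm_ne_zero_iff.2 x.2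
  simp [smul_smul, hx]

/-! ### The Riemann–Lebesgue lemma for radial phases -/

/-- The phase depends on `|ξ|` only. On each ray the one-dimensional Riemann–Lebesgue lemma applies
to `r² H(rθ)`, and dominated convergence integrates over the sphere. The filter is general so as to
cover both `T → ∞` and `T → -∞`. -/
theorem tendsto_integral_exp_norm_mul {H : E3 → ℂ} (hH : Integrable H) {l : Filter ℝ}
    [l.IsCountablyGenerated] (hl : l ≤ cocompact ℝ) :
    Tendsto (fun T : ℝ => ∫ ξ : E3, Complex.exp (↑(-2 * Real.pi * (‖ξ‖ * T)) * Complex.I) * H ξ)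
      l (𝓝 0) := by
  have hi : ∀ T : ℝ, Integrable fun ξ : E3 =>
      Complex.exp (↑(-2 * Real.pi * (‖ξ‖ * T)) * Complex.I) * H ξ := fun T => by
    refine hH.bdd_mul (c := 1) ?_ ?_
    · exact Continuous.aestronglyMeasurable (by fun_prop)
    · exact Eventually.of_forall fun v => by rw [Complex.norm_exp_ofReal_mul_I]
  have hrepr : ∀ T : ℝ, ∫ ξ : E3, Complex.exp (↑(-2 * Real.pi * (‖ξ‖ * T)) * Complex.I) * H ξ =
      ∫ θ, (∫ r : Ioi (0 : ℝ), Complex.exp (↑(-2 * Real.pi * (r * T)) * Complex.I)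
        * H ((r : ℝ) • (θ : E3)) ∂(Measure.volumeIoiPow 2)) ∂sphereMeasure := by
    intro T
    rw [integral_polar, integral_prod _ (integrable_polar (hi T))]
    congr 1
    ext θ
    congr 1
    ext r
    have : ‖(r : ℝ) • (θ : E3)‖ = r := by
      rw [norm_smul, Real.norm_of_nonneg r.2.le]; simp
    rw [this]
  simp only [hrepr]
  rw [show (0 : ℂ) = ∫ _, 0 ∂sphereMeasure by simp]
  have hpi := integrable_polar hH
  refine tendsto_integral_filter_of_dominated_convergence
    (fun θ => ∫ r : Ioi (0 : ℝ), ‖H ((r : ℝ) • (θ : E3))‖ ∂(Measure.volumeIoiPow 2))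
    (Eventually.of_forall fun T => ?_) (Eventually.of_forall fun T => ?_)
    hpi.norm.integral_prod_left ?_
  · have h1 := (integrable_polar (hi T)).integral_prod_left.aestronglyMeasurable
    refine h1.congr (Eventually.of_forall fun θ =>
      integral_congr_ae (Eventually.of_forall fun r => ?_))
    have : ‖(r : ℝ) • (θ : E3)‖ = r := by
      rw [norm_smul, Real.norm_of_nonneg r.2.le]; simp
    simp only [this]
  · refine Eventually.of_forall fun θ => (norm_integral_le_integral_norm _).trans (le_of_eq ?_)
    congr 1
    ext r
    rw [norm_mul, Complex.norm_exp_ofReal_mul_I, one_mul]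
  -- No direction need be discarded: the one-dimensional lemma asks for no integrability, since the
  -- integral of a non-integrable function is `0` by convention.
  · refine Eventually.of_forall fun θ => ?_
    have h1 := (Real.tendsto_integral_exp_smul_cocompact
      (fun r : ℝ => (Ioi (0 : ℝ)).indicator (fun r => ((r ^ 2 : ℝ) : ℂ) * H (r • (θ : E3))) r)).mono_left hl
    refine h1.congr fun T => ?_
    rw [integral_volumeIoiPow (fun r => Complex.exp (↑(-2 * Real.pi * (r * T)) * Complex.I)
        * H (r • (θ : E3))), ← integral_indicator measurableSet_Ioi]
    congr 1
    ext r
    by_cases hr : r ∈ Ioi (0 : ℝ)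
    · simp only [indicator_of_mem hr, Circle.smul_def, Real.fourierChar_apply, smul_eq_mul]
      rw [show -2 * Real.pi * (r * T) = 2 * Real.pi * -(r * T) by ring]
      ring
    · simp only [indicator_of_notMem hr, smul_zero]

theorem tendsto_integral_cos_sin_mul {H : E3 → ℂ} (hH : Integrable H) :
    Tendsto (fun T : ℝ => ∫ ξ : E3, (Real.cos (T * (2 * Real.pi * ‖ξ‖)) : ℂ) * H ξ) atTop (𝓝 0) ∧
    Tendsto (fun T : ℝ => ∫ ξ : E3, (Real.sin (T * (2 * Real.pi * ‖ξ‖)) : ℂ) * H ξ)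
      atTop (𝓝 0) := by
  have hi : ∀ T : ℝ, Integrable fun ξ : E3 =>
      Complex.exp (↑(-2 * Real.pi * (‖ξ‖ * T)) * Complex.I) * H ξ := fun T => by
    refine hH.bdd_mul (c := 1) ?_ ?_
    · exact Continuous.aestronglyMeasurable (by fun_prop)
    · exact Eventually.of_forall fun v => by rw [Complex.norm_exp_ofReal_mul_I]
  have h1 := tendsto_integral_exp_norm_mul hH (l := atTop) atTop_le_cocompact
  have h2 := (tendsto_integral_exp_norm_mul hH (l := atBot) atBot_le_cocompact).comp
    tendsto_neg_atTop_atBot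
  have e1 : ∀ (T : ℝ) (ξ : E3), Complex.exp (↑(-2 * Real.pi * (‖ξ‖ * T)) * Complex.I) =
      Complex.cos ↑(T * (2 * Real.pi * ‖ξ‖)) - Complex.sin ↑(T * (2 * Real.pi * ‖ξ‖)) * Complex.I := by
    intro T ξ
    rw [show ((-2 * Real.pi * (‖ξ‖ * T) : ℝ) : ℂ) = -((T * (2 * Real.pi * ‖ξ‖) : ℝ) : ℂ) by
      push_cast; ring, Complex.exp_mul_I, Complex.cos_neg, Complex.sin_neg]
    ring
  have e2 : ∀ (T : ℝ) (ξ : E3), Complex.exp (↑(-2 * Real.pi * (‖ξ‖ * -T)) * Complex.I) =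
      Complex.cos ↑(T * (2 * Real.pi * ‖ξ‖)) + Complex.sin ↑(T * (2 * Real.pi * ‖ξ‖)) * Complex.I := by
    intro T ξ
    rw [show ((-2 * Real.pi * (‖ξ‖ * -T) : ℝ) : ℂ) = ((T * (2 * Real.pi * ‖ξ‖) : ℝ) : ℂ) by
      push_cast; ring, Complex.exp_mul_I]
  constructor
  · have h3 := (h1.add h2).const_mul (1 / 2 : ℂ)
    rw [add_zero, mul_zero] at h3
    refine h3.congr fun T => ?_
    rw [Function.comp_apply, ← integral_add (hi T) (hi (-T)), ← integral_const_mul]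
    congr 1
    ext ξ
    rw [e1, e2, Complex.ofReal_cos]
    ring
  · have h3 := (h1.sub h2).const_mul (Complex.I / 2 : ℂ)
    rw [sub_zero, mul_zero] at h3
    refine h3.congr fun T => ?_
    rw [Function.comp_apply, ← integral_sub (hi T) (hi (-T)), ← integral_const_mul]
    congr 1
    ext ξ
    rw [e1, e2, Complex.ofReal_sin]
    linear_combination (-Complex.sin ↑(T * (2 * Real.pi * ‖ξ‖)) * H ξ) * Complex.I_mul_I

end RadialWave
end

noncomputable section

namespace RadialWave

/-! ### Pairing homogeneous Sobolev distributions with radial test functions -/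

/-- Near the origin the worst power is `|ξ|⁻¹`, square integrable in dimension three; at infinity
`|ξ|^a ≤ |ξ|` is absorbed by the decay of `χ`. The range of `a` contains the powers `-s` and `1 - s`
needed for duality. -/
theorem memLp_rpow_mul {a : ℝ} (ha : -1 ≤ a) (ha' : a ≤ 1) (χ : 𝓢(E3, ℂ)) :
    MemLp (fun ξ => ((‖ξ‖ ^ a : ℝ) : ℂ) * χ ξ) 2 volume := by
  obtain ⟨M, hM⟩ : ∃ M, ∀ ξ, ‖χ ξ‖ ≤ M := ⟨_, fun ξ => χ.norm_le_seminorm ℝ ξ⟩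
  have hM0 : 0 ≤ M := (norm_nonneg _).trans (hM 0)
  have h1 : MemLp ((Metric.ball (0 : E3) 1).indicator fun ξ => M * ‖ξ‖⁻¹) 2 volume := by
    rw [memLp_indicator_iff_restrict measurableSet_ball]
    refine MemLp.const_mul ?_ M
    have hm : Measurable fun ξ : E3 => ‖ξ‖⁻¹ := by fun_prop
    rw [memLp_two_iff_integrable_sq hm.aestronglyMeasurable]
    have := (integrableOn_fun_norm_addHaar (volume : Measure E3) (f := fun r : ℝ => r⁻¹ ^ 2)
      (r := 1)).2
    refine this ?_
    rw [finrank_E3_sub_one]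
    refine IntegrableOn.congr_fun (f := fun _ => (1 : ℝ)) (integrableOn_const (by simp))
      (fun r hr => ?_) measurableSet_Ioo
    have : r ≠ 0 := hr.1.ne'
    simp only [smul_eq_mul]
    field_simp
  refine (h1.add (memLp_weight_mul χ 2)).mono ?_ (Eventually.of_forall fun ξ => ?_)
  · have := χ.continuous.measurable
    exact Measurable.aestronglyMeasurable (by fun_prop)
  rw [norm_mul, Complex.norm_real, Pi.add_apply]
  have hnn : 0 ≤ (Metric.ball (0 : E3) 1).indicator (fun ξ => M * ‖ξ‖⁻¹) ξ :=
    indicator_nonneg (fun _ _ => by positivity) _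
  rw [Real.norm_of_nonneg (r := ‖ξ‖ ^ a) (by positivity), Real.norm_of_nonneg (by positivity)]
  rcases lt_or_ge ‖ξ‖ 1 with hlt | hge
  · rw [indicator_of_mem (by simpa using hlt)]
    rcases (norm_nonneg ξ).eq_or_lt with h0 | h0
    · rw [← h0]
      have : (0 : ℝ) ^ a ≤ 1 := Real.zero_rpow_le_one a
      simp only [inv_zero, mul_zero, zero_add, add_zero]
      gcongr
    · have h2 : ‖ξ‖ ^ a ≤ ‖ξ‖⁻¹ := by
        rw [← Real.rpow_neg_one]
        exact Real.rpow_le_rpow_of_exponent_ge h0 hlt.le ha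
      calc ‖ξ‖ ^ a * ‖χ ξ‖ ≤ ‖ξ‖⁻¹ * M := by gcongr; exact hM ξ
        _ ≤ _ := by rw [mul_comm]; exact le_add_of_nonneg_right (by positivity)
  · have h2 : ‖ξ‖ ^ a ≤ ‖ξ‖ := by
      conv_rhs => rw [← Real.rpow_one ‖ξ‖]
      exact Real.rpow_le_rpow_of_exponent_le hge ha'
    have h3 : ‖ξ‖ ≤ 1 + 2 * Real.pi * ‖ξ‖ := by nlinarith [Real.pi_gt_three]
    calc ‖ξ‖ ^ a * ‖χ ξ‖ ≤ (1 + 2 * Real.pi * ‖ξ‖) * ‖χ ξ‖ := by gcongr; linarith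
      _ ≤ _ := le_add_of_nonneg_left hnn

theorem lintegral_enorm_mul_le_eLpNorm_two {f g : E3 → ℂ} (hf : AEStronglyMeasurable f volume)
    (hg : AEStronglyMeasurable g volume) :
    ∫⁻ ξ, ‖f ξ * g ξ‖ₑ ≤ eLpNorm f 2 volume * eLpNorm g 2 volume := by
  have h := eLpNorm_smul_le_mul_eLpNorm (p := 2) (q := 2) (r := 1) hg hf
  rwa [eLpNorm_one_eq_lintegral_enorm] at h

namespace HomSobolev

variable {s : ℝ}

theorem toDistribution_apply (D : HomSobolev s) (φ : 𝓢(E3, ℂ)) :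
    D.toDistribution φ = ∫ ξ, (𝓕⁻ φ) ξ * D.fourierFun ξ := by
  rw [← (D.fourierFun_spec.2 (𝓕⁻ φ)).2, TemperedDistribution.fourier_apply,
    FourierTransform.fourier_fourierInv_eq]

theorem enorm_eq (D : HomSobolev s) :
    ‖D‖ₑ = eLpNorm (fun ξ => ((‖ξ‖ ^ s : ℝ) : ℂ) * D.fourierFun ξ) 2 volume := by
  rw [← eLpNorm_congr_ae D.memLp_fourierFun.coeFn_toLp, ← Lp.enorm_def]
  rfl

theorem mul_fourierFun_ae_eq (D : HomSobolev s) (q : E3 → ℂ) :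
    (fun ξ => q ξ * D.fourierFun ξ) =ᵐ[volume] fun ξ => (((‖ξ‖ ^ (-s) : ℝ) : ℂ) * q ξ) *
      (((‖ξ‖ ^ s : ℝ) : ℂ) * D.fourierFun ξ) := by
  filter_upwards [ae_ne_zero] with ξ hξ
  have h1 : ((‖ξ‖ ^ (-s) : ℝ) : ℂ) * ((‖ξ‖ ^ s : ℝ) : ℂ) = 1 := by
    rw [← Complex.ofReal_mul, ← Real.rpow_add (norm_pos_iff.2 hξ), neg_add_cancel, Real.rpow_zero,
      Complex.ofReal_one]
  linear_combination (-(q ξ * D.fourierFun ξ)) * h1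

theorem integrable_mul_fourierFun (D : HomSobolev s) {q : E3 → ℂ}
    (hq : MemLp (fun ξ => ((‖ξ‖ ^ (-s) : ℝ) : ℂ) * q ξ) 2 volume) :
    Integrable fun ξ => q ξ * D.fourierFun ξ :=
  (hq.integrable_mul D.memLp_fourierFun).congr (D.mul_fourierFun_ae_eq q).symm

/-- Cauchy–Schwarz duality between `Ḣ⁻ˢ` and `Ḣˢ`. The factor `m` stands for an oscillating phase,
so that the bound is uniform in the translation. -/
theorem norm_integral_mul_fourierFun_le (D : HomSobolev s) {q m : E3 → ℂ}
    (hq : MemLp (fun ξ => ((‖ξ‖ ^ (-s) : ℝ) : ℂ) * q ξ) 2 volume) (hm : ∀ ξ, ‖m ξ‖ ≤ 1) :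
    ‖∫ ξ, m ξ * (q ξ * D.fourierFun ξ)‖ ≤
      (eLpNorm (fun ξ => ((‖ξ‖ ^ (-s) : ℝ) : ℂ) * q ξ) 2 volume).toReal * ‖D‖ := by
  have h1 : ‖∫ ξ, m ξ * (q ξ * D.fourierFun ξ)‖ₑ ≤
      eLpNorm (fun ξ => ((‖ξ‖ ^ (-s) : ℝ) : ℂ) * q ξ) 2 volume * ‖D‖ₑ := by
    calc ‖∫ ξ, m ξ * (q ξ * D.fourierFun ξ)‖ₑ ≤ ∫⁻ ξ, ‖m ξ * (q ξ * D.fourierFun ξ)‖ₑ :=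
          enorm_integral_le_lintegral_enorm _
      _ ≤ ∫⁻ ξ, ‖q ξ * D.fourierFun ξ‖ₑ := by
          refine lintegral_mono fun ξ => ?_
          rw [enorm_mul (m ξ)]
          refine mul_le_of_le_one_left (by positivity) ?_
          rw [← ofReal_norm]
          exact ENNReal.ofReal_le_one.2 (hm ξ)
      _ = ∫⁻ ξ, ‖(((‖ξ‖ ^ (-s) : ℝ) : ℂ) * q ξ) *
            (((‖ξ‖ ^ s : ℝ) : ℂ) * D.fourierFun ξ)‖ₑ := by
          refine lintegral_congr_ae ?_
          filter_upwards [D.mul_fourierFun_ae_eq q] with ξ hξ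
          rw [hξ]
      _ ≤ eLpNorm (fun ξ => ((‖ξ‖ ^ (-s) : ℝ) : ℂ) * q ξ) 2 volume * ‖D‖ₑ := by
          rw [enorm_eq]
          exact lintegral_enorm_mul_le_eLpNorm_two hq.1 D.memLp_fourierFun.1
  have h2 := ENNReal.toReal_mono (ENNReal.mul_ne_top hq.2.ne enorm_ne_top) h1
  rwa [toReal_enorm, ENNReal.toReal_mul, toReal_enorm] at h2

/-- A family of test functions whose Fourier transforms oscillate like `cos(2πT|ξ|)` and
`sin(2πT|ξ|)` with square integrable amplitudes: the pairings with distributions in `Ḣˢ` are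
uniformly bounded and tend to zero. -/
theorem oscillating_pairing {χ : ℕ → 𝓢(E3, ℂ)} {qa qb : E3 → ℂ}
    (ha : MemLp (fun ξ => ((‖ξ‖ ^ (-s) : ℝ) : ℂ) * qa ξ) 2 volume)
    (hb : MemLp (fun ξ => ((‖ξ‖ ^ (-s) : ℝ) : ℂ) * qb ξ) 2 volume)
    (hχ : ∀ (n : ℕ) (ξ : E3), ξ ≠ 0 → (𝓕⁻ (χ n)) ξ =
      (Real.cos (n * (2 * Real.pi * ‖ξ‖)) : ℂ) * qa ξ
        + (Real.sin (n * (2 * Real.pi * ‖ξ‖)) : ℂ) * qb ξ) :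
    (∃ C : ℝ, ∀ (n : ℕ) (D : HomSobolev s), ‖D.toDistribution (χ n)‖ ≤ C * ‖D‖) ∧
      ∀ D : HomSobolev s, Tendsto (fun n => D.toDistribution (χ n)) atTop (𝓝 0) := by
  have hrepr : ∀ (n : ℕ) (D : HomSobolev s), D.toDistribution (χ n) =
      (∫ ξ, (Real.cos (n * (2 * Real.pi * ‖ξ‖)) : ℂ) * (qa ξ * D.fourierFun ξ))
        + ∫ ξ, (Real.sin (n * (2 * Real.pi * ‖ξ‖)) : ℂ) * (qb ξ * D.fourierFun ξ) := by
    intro n D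
    have h1 : Integrable fun ξ : E3 =>
        (Real.cos (n * (2 * Real.pi * ‖ξ‖)) : ℂ) * (qa ξ * D.fourierFun ξ) :=
      (D.integrable_mul_fourierFun ha).bdd_mul (c := 1)
        (Continuous.aestronglyMeasurable (by fun_prop))
        (Eventually.of_forall fun ξ => by
          rw [Complex.norm_real]; exact Real.abs_cos_le_one _)
    have h2 : Integrable fun ξ : E3 =>
        (Real.sin (n * (2 * Real.pi * ‖ξ‖)) : ℂ) * (qb ξ * D.fourierFun ξ) :=
      (D.integrable_mul_fourierFun hb).bdd_mul (c := 1)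
        (Continuous.aestronglyMeasurable (by fun_prop))
        (Eventually.of_forall fun ξ => by
          rw [Complex.norm_real]; exact Real.abs_sin_le_one _)
    rw [toDistribution_apply, ← integral_add h1 h2]
    refine integral_congr_ae ?_
    filter_upwards [ae_ne_zero] with ξ hξ
    rw [hχ n ξ hξ]
    ring
  refine ⟨⟨(eLpNorm (fun ξ => ((‖ξ‖ ^ (-s) : ℝ) : ℂ) * qa ξ) 2 volume).toReal
    + (eLpNorm (fun ξ => ((‖ξ‖ ^ (-s) : ℝ) : ℂ) * qb ξ) 2 volume).toReal, fun n D => ?_⟩,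
    fun D => ?_⟩
  · rw [hrepr]
    refine (norm_add_le _ _).trans ((add_le_add
      (D.norm_integral_mul_fourierFun_le ha fun ξ => ?_)
      (D.norm_integral_mul_fourierFun_le hb fun ξ => ?_)).trans_eq (add_mul _ _ _).symm)
    · rw [Complex.norm_real]; exact Real.abs_cos_le_one _
    · rw [Complex.norm_real]; exact Real.abs_sin_le_one _
  · simp only [hrepr]
    have h1 := (tendsto_integral_cos_sin_mul (D.integrable_mul_fourierFun ha)).1.comp
      tendsto_natCast_atTop_atTop
    have h2 := (tendsto_integral_cos_sin_mul (D.integrable_mul_fourierFun hb)).2.comp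
      tendsto_natCast_atTop_atTop
    simpa using h1.add h2

end HomSobolev

theorem fourierInv_apply_eq_neg (χ : 𝓢(E3, ℂ)) (ξ : E3) : (𝓕⁻ χ) ξ = (𝓕 χ) (-ξ) := by
  rw [SchwartzMap.fourierInv_coe, SchwartzMap.fourier_coe, Real.fourierInv_eq_fourier_neg]

section Translate

variable {ψ : ℝ → ℂ} (h : IsHalfLineTest ψ)

theorem fourierInv_radialTest_translate {T : ℝ} (hT : 0 ≤ T)
    {ξ : E3} (hξ : ξ ≠ 0) :
    (𝓕⁻ (radialTest _ (h.translate hT))) ξ = cosSymbol T ξ * (𝓕⁻ (radialTest ψ h)) ξ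
      - sineSymbol T ξ * (𝓕⁻ (radialTest _ h.deriv)) ξ := by
  simp only [fourierInv_apply_eq_neg]
  rw [fourier_radialTest_translate h hT (neg_ne_zero.2 hξ)]
  simp only [cosSymbol, sineSymbol, norm_neg]

theorem fourier_radialTest_deriv_deriv (ξ : E3) :
    (𝓕 (radialTest _ h.deriv.deriv)) ξ =
      -((2 * Real.pi * ‖ξ‖ : ℝ) : ℂ) ^ 2 * (𝓕 (radialTest ψ h)) ξ := by
  rw [← laplacian_radialTest h, fourier_laplacian]

theorem fourierInv_radialTest_deriv_translate {T : ℝ} (hT : 0 ≤ T)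
    {ξ : E3} (hξ : ξ ≠ 0) :
    (𝓕⁻ (radialTest _ (h.deriv.translate hT))) ξ =
      cosSymbol T ξ * (𝓕⁻ (radialTest _ h.deriv)) ξ
      + sineSymbol T ξ * (((2 * Real.pi * ‖ξ‖ : ℝ) : ℂ) ^ 2 * (𝓕⁻ (radialTest ψ h)) ξ) := by
  rw [fourierInv_radialTest_translate h.deriv hT hξ, fourierInv_apply_eq_neg
    (radialTest _ h.deriv.deriv), fourier_radialTest_deriv_deriv h, fourierInv_apply_eq_neg
    (radialTest ψ h), norm_neg]
  ring

/-- The sine amplitude carries a factor `1/|ξ|`, but duality with `Ḣˢ⁻¹` supplies the weight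
`|ξ|^{1-s}`. What remains is `|ξ|^{-s}`, harmless near the origin. -/
theorem pairing_translate {s : ℝ} (hs0 : 0 < s) (hs1 : s < 1) :
    (∃ C : ℝ, ∀ (n : ℕ) (D : HomSobolev (s - 1)),
      ‖D.toDistribution (radialTest _ (h.translate n.cast_nonneg))‖ ≤ C * ‖D‖) ∧
      ∀ D : HomSobolev (s - 1), Tendsto (fun n : ℕ =>
        D.toDistribution (radialTest _ (h.translate n.cast_nonneg))) atTop (𝓝 0) := by
  refine HomSobolev.oscillating_pairing (qa := fun ξ => (𝓕⁻ (radialTest ψ h)) ξ)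
    (qb := fun ξ => -(((2 * Real.pi * ‖ξ‖ : ℝ) : ℂ))⁻¹ * (𝓕⁻ (radialTest _ h.deriv)) ξ) ?_ ?_
    fun n ξ hξ => ?_
  · exact memLp_rpow_mul (by linarith) (by linarith) _
  · have h1 := (memLp_rpow_mul (a := -s) (by linarith) (by linarith)
      (𝓕⁻ (radialTest _ h.deriv))).const_mul (-(2 * Real.pi : ℂ)⁻¹)
    refine h1.ae_eq ?_
    filter_upwards [ae_ne_zero] with ξ hξ
    have hpos := norm_pos_iff.2 hξ
    have h2 : ‖ξ‖ ^ (-(s - 1)) = ‖ξ‖ ^ (-s) * ‖ξ‖ := by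
      rw [show -(s - 1) = -s + 1 by ring, Real.rpow_add hpos, Real.rpow_one]
    have h3 : (‖ξ‖ : ℂ) ≠ 0 := by exact_mod_cast hpos.ne'
    rw [h2]
    push_cast
    field_simp
  · rw [fourierInv_radialTest_translate h n.cast_nonneg hξ, sineSymbol_of_ne_zero _ hξ, cosSymbol]
    push_cast
    ring

/-- For the differentiated profile the sine amplitude gains a factor `|ξ|`, since `ψ''` corresponds
to the Laplacian. The weight is now `|ξ|^{-s}`, so the powers are the same two as for the velocity
with the roles exchanged. -/
theorem pairing_deriv_translate {s : ℝ} (hs0 : 0 < s) (hs1 : s < 1) :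
    (∃ C : ℝ, ∀ (n : ℕ) (D : HomSobolev s),
      ‖D.toDistribution (radialTest _ (h.deriv.translate n.cast_nonneg))‖ ≤ C * ‖D‖) ∧
      ∀ D : HomSobolev s, Tendsto (fun n : ℕ =>
        D.toDistribution (radialTest _ (h.deriv.translate n.cast_nonneg))) atTop (𝓝 0) := by
  refine HomSobolev.oscillating_pairing (qa := fun ξ => (𝓕⁻ (radialTest _ h.deriv)) ξ)
    (qb := fun ξ => ((2 * Real.pi * ‖ξ‖ : ℝ) : ℂ) * (𝓕⁻ (radialTest ψ h)) ξ) ?_ ?_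
    fun n ξ hξ => ?_
  · exact memLp_rpow_mul (by linarith) (by linarith) _
  · have h1 := (memLp_rpow_mul (a := 1 - s) (by linarith) (by linarith)
      (𝓕⁻ (radialTest ψ h))).const_mul (2 * Real.pi : ℂ)
    refine h1.ae_eq ?_
    filter_upwards [ae_ne_zero] with ξ hξ
    have hpos := norm_pos_iff.2 hξ
    rw [show 1 - s = -s + 1 by ring, Real.rpow_add hpos, Real.rpow_one]
    push_cast
    ring
  · have hk : ((2 * Real.pi * ‖ξ‖ : ℝ) : ℂ) ≠ 0 := by exact_mod_cast (two_pi_norm_pos hξ).ne'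
    rw [fourierInv_radialTest_deriv_translate h n.cast_nonneg hξ, sineSymbol_of_ne_zero _ hξ,
      cosSymbol, Complex.ofReal_div]
    field_simp

end Translate

/-- A uniformly bounded sequence of linear functionals which tends to zero pointwise tends to zero
along every sequence in a relatively compact set. -/
theorem tendsto_apply_of_totallyBounded {V : Type*} [NormedAddCommGroup V] {L : ℕ → V → ℂ}
    {C : ℝ} (hsub : ∀ n x y, L n x - L n y = L n (x - y)) (hC : ∀ n x, ‖L n x‖ ≤ C * ‖x‖)
    (hL : ∀ x, Tendsto (fun n => L n x) atTop (𝓝 0)) {K : Set V} (hK : TotallyBounded K)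
    {v : ℕ → V} (hv : ∀ n, v n ∈ K) : Tendsto (fun n => L n (v n)) atTop (𝓝 0) := by
  rw [Metric.tendsto_atTop]
  intro ε hε
  -- A finite `η`-net turns pointwise into uniform convergence, and the uniform bound controls the
  -- distance to the net. The summand `1` keeps the denominator positive when `C = 0`.
  set η := ε / (2 * (|C| + 1)) with hη
  have hη0 : 0 < η := by positivity
  obtain ⟨t, ht, hcov⟩ := Metric.totallyBounded_iff.1 hK η hη0
  have hev : ∀ᶠ n in atTop, ∀ x ∈ t, ‖L n x‖ < ε / 2 := by
    rw [ht.eventually_all]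
    intro x _
    have := (hL x).norm
    rw [norm_zero] at this
    exact this.eventually (gt_mem_nhds (by positivity))
  obtain ⟨N, hN⟩ := eventually_atTop.1 hev
  refine ⟨N, fun n hn => ?_⟩
  obtain ⟨x, hx, hxv⟩ := mem_iUnion₂.1 (hcov (hv n))
  rw [dist_zero_right]
  rw [Metric.mem_ball, dist_eq_norm] at hxv
  have h1 : L n (v n) = L n (v n - x) + L n x := by rw [← hsub]; ring
  have h2 : ‖L n (v n - x)‖ ≤ ε / 2 := by
    calc ‖L n (v n - x)‖ ≤ C * ‖v n - x‖ := hC _ _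
      _ ≤ (|C| + 1) * η := by
          gcongr
          exact (le_abs_self C).trans (by linarith)
      _ = ε / 2 := by rw [hη]; field_simp
  rw [h1]
  linarith [norm_add_le (L n (v n - x)) (L n x), hN n hn x hx]

/-- Along a relatively compact trajectory the outgoing and incoming pairings with escaping radial
test functions tend to zero. -/
theorem tendsto_pairing_escaping {s : ℝ} (hs0 : 0 < s) (hs1 : s < 1)
    {U : ℝ → HomSobolev s × HomSobolev (s - 1)} (hcompact : IsCompact (closure (range U)))
    {ψ : ℝ → ℂ} (h : IsHalfLineTest ψ) (ε : ℂ) (τ : ℕ → ℝ) :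
    Tendsto (fun n : ℕ => (U (τ n)).2.toDistribution (radialTest _ (h.translate n.cast_nonneg))
      + ε * (U (τ n)).1.toDistribution (radialTest _ (h.deriv.translate n.cast_nonneg)))
      atTop (𝓝 0) := by
  obtain ⟨⟨C₂, hC₂⟩, hl₂⟩ := pairing_translate h hs0 hs1
  obtain ⟨⟨C₁, hC₁⟩, hl₁⟩ := pairing_deriv_translate h hs0 hs1
  refine tendsto_apply_of_totallyBounded (K := range U) (v := fun n => U (τ n))
    (C := |C₂| + ‖ε‖ * |C₁|)
    (L := fun n D => D.2.toDistribution (radialTest _ (h.translate n.cast_nonneg))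
      + ε * D.1.toDistribution (radialTest _ (h.deriv.translate n.cast_nonneg)))
    (fun n x y => ?_) (fun n x => ?_) (fun x => ?_)
    (hcompact.totallyBounded.subset subset_closure) (fun n => mem_range_self _)
  · have e1 : (x - y).1.toDistribution = x.1.toDistribution - y.1.toDistribution := rfl
    have e2 : (x - y).2.toDistribution = x.2.toDistribution - y.2.toDistribution := rfl
    have e3 : ∀ (S T : 𝓢'(E3, ℂ)) (φ : 𝓢(E3, ℂ)), (S - T) φ = S φ - T φ := fun _ _ _ => rfl
    simp only [e1, e2, e3]
    ring
  · refine (norm_add_le _ _).trans ?_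
    rw [norm_mul, add_mul, mul_assoc]
    gcongr
    · exact (hC₂ n x.2).trans (mul_le_mul (le_abs_self _) (norm_snd_le x) (norm_nonneg _)
        (abs_nonneg _))
    · exact (hC₁ n x.1).trans (mul_le_mul (le_abs_self _) (norm_fst_le x) (norm_nonneg _)
        (abs_nonneg _))
  · simpa using (hl₂ x.2).add ((hl₁ x.1).const_mul ε)

end RadialWave
end

noncomputable section

namespace RadialWave

/-! ### The velocity of a solution -/

/-- The pairing of the time derivative of a free wave with a Schwartz function. -/
def freeWaveDeriv {s : ℝ} (t : ℝ) (D : HomSobolev s × HomSobolev (s - 1)) (φ : 𝓢(E3, ℂ)) : ℂ :=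
  ∫ ξ, (𝓕⁻ φ) ξ * (-((2 * Real.pi * ‖ξ‖ * Real.sin (t * (2 * Real.pi * ‖ξ‖)) : ℝ) : ℂ)
    * D.1.fourierFun ξ + (Real.cos (t * (2 * Real.pi * ‖ξ‖)) : ℂ) * D.2.fourierFun ξ)

/-- Differentiating a free wave in time costs one factor `|ξ|`. It is dominated by `1 + |ξ|²`, and
`|ξ|² χ` is again a Schwartz function, against which the density is integrable by definition. -/
theorem HomSobolev.integrable_weight_mul_fourierFun {s : ℝ} (D : HomSobolev s) (χ : 𝓢(E3, ℂ)) :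
    Integrable fun ξ => ((1 + 2 * Real.pi * ‖ξ‖) * ‖χ ξ‖) * ‖D.fourierFun ξ‖ := by
  have h1 := (D.fourierFun_spec.2 χ).1.norm
  have h2 := (D.fourierFun_spec.2 (normSqMul χ)).1.norm
  have hm : AEStronglyMeasurable D.fourierFun volume := D.fourierFun_spec.1.aestronglyMeasurable
  refine ((h1.add h2).const_mul (1 + 2 * Real.pi)).mono' ?_ (Eventually.of_forall fun ξ => ?_)
  · have := χ.continuous
    exact (Continuous.aestronglyMeasurable (by fun_prop)).mul hm.norm
  · have h3 : ‖ξ‖ ≤ 1 + ‖ξ‖ ^ 2 := by nlinarith [sq_nonneg (‖ξ‖ - 1)]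
    have h4 : 1 + 2 * Real.pi * ‖ξ‖ ≤ (1 + 2 * Real.pi) * (1 + ‖ξ‖ ^ 2) := by
      nlinarith [Real.pi_pos, sq_nonneg ‖ξ‖]
    rw [Real.norm_of_nonneg (by positivity)]
    simp only [Pi.add_apply, normSqMul_apply, norm_mul, Complex.norm_real, norm_pow, norm_norm]
    calc _ ≤ (((1 + 2 * Real.pi) * (1 + ‖ξ‖ ^ 2)) * ‖χ ξ‖) * ‖D.fourierFun ξ‖ := by gcongr
      _ = _ := by ring

theorem norm_sin_div_le (t k : ℝ) (hk : 0 ≤ k) : ‖Real.sin (t * k) / k‖ ≤ |t| := by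
  rw [norm_div, Real.norm_eq_abs, Real.norm_eq_abs, abs_of_nonneg hk]
  refine div_le_of_le_mul₀ hk (abs_nonneg _) ?_
  calc |Real.sin (t * k)| ≤ |t * k| := Real.abs_sin_le_abs
    _ = _ := by rw [abs_mul, abs_of_nonneg hk]

theorem integrable_freeWave {s : ℝ} (t : ℝ) (D : HomSobolev s × HomSobolev (s - 1))
    (φ : 𝓢(E3, ℂ)) : Integrable fun ξ => (𝓕⁻ φ) ξ *
      ((Real.cos (t * (2 * Real.pi * ‖ξ‖)) : ℂ) * D.1.fourierFun ξ
        + ((Real.sin (t * (2 * Real.pi * ‖ξ‖)) / (2 * Real.pi * ‖ξ‖) : ℝ) : ℂ)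
          * D.2.fourierFun ξ) := by
  have h1 := (D.1.fourierFun_spec.2 (𝓕⁻ φ)).1.bdd_mul (c := 1)
    (f := fun ξ : E3 => (Real.cos (t * (2 * Real.pi * ‖ξ‖)) : ℂ))
    (Continuous.aestronglyMeasurable (by fun_prop))
    (Eventually.of_forall fun ξ => by rw [Complex.norm_real]; exact Real.abs_cos_le_one _)
  have h2 := (D.2.fourierFun_spec.2 (𝓕⁻ φ)).1.bdd_mul (c := |t|)
    (f := fun ξ : E3 => ((Real.sin (t * (2 * Real.pi * ‖ξ‖)) / (2 * Real.pi * ‖ξ‖) : ℝ) : ℂ))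
    (Measurable.aestronglyMeasurable (by fun_prop))
    (Eventually.of_forall fun ξ => by
      rw [Complex.norm_real]; exact norm_sin_div_le _ _ (by positivity))
  refine (h1.add h2).congr (Eventually.of_forall fun ξ => ?_)
  simp only [Pi.add_apply]
  ring

theorem norm_freeWaveDeriv_integrand_le {s : ℝ} (t : ℝ) (D : HomSobolev s × HomSobolev (s - 1))
    (χ : 𝓢(E3, ℂ)) (ξ : E3) :
    ‖χ ξ * (-((2 * Real.pi * ‖ξ‖ * Real.sin (t * (2 * Real.pi * ‖ξ‖)) : ℝ) : ℂ)
      * D.1.fourierFun ξ + (Real.cos (t * (2 * Real.pi * ‖ξ‖)) : ℂ) * D.2.fourierFun ξ)‖ ≤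
      ((1 + 2 * Real.pi * ‖ξ‖) * ‖χ ξ‖) * ‖D.1.fourierFun ξ‖
        + ((1 + 2 * Real.pi * ‖ξ‖) * ‖χ ξ‖) * ‖D.2.fourierFun ξ‖ := by
  have hk : 0 ≤ 2 * Real.pi * ‖ξ‖ := by positivity
  have h1 : ‖-((2 * Real.pi * ‖ξ‖ * Real.sin (t * (2 * Real.pi * ‖ξ‖)) : ℝ) : ℂ)‖
      ≤ 1 + 2 * Real.pi * ‖ξ‖ := by
    rw [norm_neg, Complex.norm_real, norm_mul, Real.norm_of_nonneg hk, Real.norm_eq_abs]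
    nlinarith [Real.abs_sin_le_one (t * (2 * Real.pi * ‖ξ‖))]
  have h2 : ‖(Real.cos (t * (2 * Real.pi * ‖ξ‖)) : ℂ)‖ ≤ 1 + 2 * Real.pi * ‖ξ‖ := by
    rw [Complex.norm_real, Real.norm_eq_abs]
    linarith [Real.abs_cos_le_one (t * (2 * Real.pi * ‖ξ‖))]
  rw [norm_mul]
  calc _ ≤ ‖χ ξ‖ * ((1 + 2 * Real.pi * ‖ξ‖) * ‖D.1.fourierFun ξ‖
        + (1 + 2 * Real.pi * ‖ξ‖) * ‖D.2.fourierFun ξ‖) := by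
        gcongr
        refine (norm_add_le _ _).trans ?_
        rw [norm_mul, norm_mul]
        gcongr
    _ = _ := by ring

theorem aestronglyMeasurable_freeWaveDeriv {s : ℝ} (t : ℝ) (D : HomSobolev s × HomSobolev (s - 1))
    (χ : 𝓢(E3, ℂ)) : AEStronglyMeasurable (fun ξ => χ ξ *
      (-((2 * Real.pi * ‖ξ‖ * Real.sin (t * (2 * Real.pi * ‖ξ‖)) : ℝ) : ℂ)
      * D.1.fourierFun ξ + (Real.cos (t * (2 * Real.pi * ‖ξ‖)) : ℂ) * D.2.fourierFun ξ)) volume := by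
  have h1 : AEStronglyMeasurable D.1.fourierFun volume := D.1.fourierFun_spec.1.aestronglyMeasurable
  have h2 : AEStronglyMeasurable D.2.fourierFun volume := D.2.fourierFun_spec.1.aestronglyMeasurable
  have h3 := χ.continuous
  refine (h3.aestronglyMeasurable).mul (AEStronglyMeasurable.add
    (AEStronglyMeasurable.mul (Continuous.aestronglyMeasurable ?_) h1)
    (AEStronglyMeasurable.mul (Continuous.aestronglyMeasurable ?_) h2))
  · fun_prop
  · fun_prop

theorem integrable_freeWaveDeriv {s : ℝ} (t : ℝ) (D : HomSobolev s × HomSobolev (s - 1))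
    (χ : 𝓢(E3, ℂ)) : Integrable fun ξ => χ ξ *
      (-((2 * Real.pi * ‖ξ‖ * Real.sin (t * (2 * Real.pi * ‖ξ‖)) : ℝ) : ℂ)
      * D.1.fourierFun ξ + (Real.cos (t * (2 * Real.pi * ‖ξ‖)) : ℂ) * D.2.fourierFun ξ) :=
  ((D.1.integrable_weight_mul_fourierFun χ).add (D.2.integrable_weight_mul_fourierFun χ)).mono'
    (aestronglyMeasurable_freeWaveDeriv t D χ)
    (Eventually.of_forall fun ξ => norm_freeWaveDeriv_integrand_le t D χ ξ)

theorem hasDerivAt_freeWave {s : ℝ} (D : HomSobolev s × HomSobolev (s - 1)) (φ : 𝓢(E3, ℂ))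
    (t : ℝ) : HasDerivAt (fun t => freeWave t D φ) (freeWaveDeriv t D φ) t := by
  refine (hasDerivAt_integral_of_dominated_loc_of_deriv_le (μ := (volume : Measure E3))
    (x₀ := t) (s := univ)
    (bound := fun ξ => ((1 + 2 * Real.pi * ‖ξ‖) * ‖(𝓕⁻ φ) ξ‖) * ‖D.1.fourierFun ξ‖
        + ((1 + 2 * Real.pi * ‖ξ‖) * ‖(𝓕⁻ φ) ξ‖) * ‖D.2.fourierFun ξ‖)
    univ_mem (Eventually.of_forall fun t => (integrable_freeWave t D φ).aestronglyMeasurable)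
    (integrable_freeWave t D φ) (aestronglyMeasurable_freeWaveDeriv t D _)
    (Eventually.of_forall fun ξ t _ => norm_freeWaveDeriv_integrand_le t D _ ξ)
    ((D.1.integrable_weight_mul_fourierFun _).add (D.2.integrable_weight_mul_fourierFun _)) ?_).2
  filter_upwards [ae_ne_zero] with ξ hξ t _
  have hk := two_pi_norm_pos hξ
  set k := 2 * Real.pi * ‖ξ‖
  have hk' : (k : ℂ) ≠ 0 := by exact_mod_cast hk.ne'
  have hcos : HasDerivAt (fun t : ℝ => (Real.cos (t * k) : ℂ)) (-(k * Real.sin (t * k) : ℝ)) t := by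
    refine (((hasDerivAt_mul_const k).cos (x := t)).ofReal_comp).congr_deriv ?_
    push_cast; ring
  have hsin : HasDerivAt (fun t : ℝ => ((Real.sin (t * k) / k : ℝ) : ℂ)) (Real.cos (t * k)) t := by
    refine ((((hasDerivAt_mul_const k).sin (x := t)).div_const k).ofReal_comp).congr_deriv ?_
    push_cast; field_simp
  exact ((hcos.mul_const _).fun_add (hsin.mul_const _)).const_mul _

theorem IsGlobalRadialSolution.fst_apply {s : ℝ} {F u : ℝ → ℝ → ℝ}
    {U : ℝ → HomSobolev s × HomSobolev (s - 1)} (hsol : IsGlobalRadialSolution s F u U)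
    (t : ℝ) (φ : 𝓢(E3, ℂ)) :
    (U t).1.toDistribution φ = freeWave t (U 0) φ
      + ∫ τ in (0 : ℝ)..t, forcePairing F (sineSymbol (t - τ)) φ τ := by
  rw [hsol.duhamel t φ]
  simp only [sinePropagator_eq, forcePairing]

/-- Duhamel's formula is assumed for `u` only. The velocity is the time derivative of the pairing
with `u`, so differentiating both terms and uniqueness of derivatives give its formula. -/
theorem IsGlobalRadialSolution.snd_apply {s : ℝ} (hs0 : 0 < s) (hs1 : s < 1) {F u : ℝ → ℝ → ℝ}
    {U : ℝ → HomSobolev s × HomSobolev (s - 1)} (hsol : IsGlobalRadialSolution s F u U)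
    (hF : Measurable (Function.uncurry F))
    (hK : ∀ a b : ℝ, ∫⁻ τ in Icc a b, sliceNorm s F τ < ⊤) (t : ℝ) (φ : 𝓢(E3, ℂ)) :
    (U t).2.toDistribution φ = freeWaveDeriv t (U 0) φ
      + ∫ τ in (0 : ℝ)..t, forcePairing F (cosSymbol (t - τ)) φ τ := by
  have h1 := (hasDerivAt_freeWave (U 0) φ t).fun_add (hasDerivAt_duhamel hs0 hs1 hF hK φ t)
  refine (hsol.snd_eq t φ).unique (h1.congr_of_eventuallyEq (Eventually.of_forall fun t => ?_))
  exact hsol.fst_apply t φ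

/-! ### Propagation along characteristics -/

section Characteristic

variable {ψ : ℝ → ℂ} (h : IsHalfLineTest ψ)

theorem fourier_radialTest_deriv_translate {T : ℝ} (hT : 0 ≤ T) {ξ : E3} (hξ : ξ ≠ 0) :
    (𝓕 (radialTest _ (h.deriv.translate hT))) ξ =
      cosSymbol T ξ * (𝓕 (radialTest _ h.deriv)) ξ
      + sineSymbol T ξ * (((2 * Real.pi * ‖ξ‖ : ℝ) : ℂ) ^ 2 * (𝓕 (radialTest ψ h)) ξ) := by
  rw [fourier_radialTest_translate h.deriv hT hξ, fourier_radialTest_deriv_deriv h]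
  ring

/-- The combination tests `w_t - ε w_r`, which for free waves is constant in the direction `(r, t) =
(1, ε)`. On the Fourier side this is the addition theorem for the angle `(t₀ + ε T) k` together with
`cos² + sin² = 1`. -/
theorem freeWave_characteristic {s : ℝ} (D : HomSobolev s × HomSobolev (s - 1)) {ε : ℝ}
    (hε : ε = 1 ∨ ε = -1) (t₀ : ℝ) {T : ℝ} (hT : 0 ≤ T) :
    freeWaveDeriv (t₀ + ε * T) D (radialTest _ (h.translate hT))
      + ε * freeWave (t₀ + ε * T) D (radialTest _ (h.deriv.translate hT))
      = freeWaveDeriv t₀ D (radialTest ψ h) + ε * freeWave t₀ D (radialTest _ h.deriv) := by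
  rw [freeWaveDeriv, freeWaveDeriv, freeWave, freeWave, ← integral_const_mul, ← integral_const_mul,
    ← integral_add (integrable_freeWaveDeriv _ _ _) ((integrable_freeWave _ _ _).const_mul _),
    ← integral_add (integrable_freeWaveDeriv _ _ _) ((integrable_freeWave _ _ _).const_mul _)]
  refine integral_congr_ae ?_
  filter_upwards [ae_ne_zero] with ξ hξ
  rw [fourierInv_radialTest_translate h hT hξ, fourierInv_radialTest_deriv_translate h hT hξ,
    sineSymbol_of_ne_zero _ hξ, cosSymbol]
  have hk := two_pi_norm_pos hξ
  set k := 2 * Real.pi * ‖ξ‖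
  have hk' : (k : ℂ) ≠ 0 := by exact_mod_cast hk.ne'
  set q₀ := (𝓕⁻ (radialTest ψ h)) ξ
  set q₁ := (𝓕⁻ (radialTest _ h.deriv)) ξ
  have hcs : (Real.cos (T * k) : ℂ) ^ 2 + (Real.sin (T * k) : ℂ) ^ 2 = 1 := by
    exact_mod_cast Real.cos_sq_add_sin_sq (T * k)
  have hs : (Real.sin ((t₀ + ε * T) * k) : ℂ) = Real.sin (t₀ * k) * Real.cos (T * k)
      + ε * (Real.cos (t₀ * k) * Real.sin (T * k)) := by
    rcases hε with rfl | rfl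
    · rw [one_mul, add_mul, Real.sin_add]; push_cast; ring
    · rw [neg_one_mul, ← sub_eq_add_neg, sub_mul, Real.sin_sub]; push_cast; ring
  have hc : (Real.cos ((t₀ + ε * T) * k) : ℂ) = Real.cos (t₀ * k) * Real.cos (T * k)
      - ε * (Real.sin (t₀ * k) * Real.sin (T * k)) := by
    rcases hε with rfl | rfl
    · rw [one_mul, add_mul, Real.cos_add]; push_cast; ring
    · rw [neg_one_mul, ← sub_eq_add_neg, sub_mul, Real.cos_sub]; push_cast; ring
  have hε2 : (ε : ℂ) ^ 2 = 1 := by rcases hε with rfl | rfl <;> simp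
  rw [Complex.ofReal_mul k, Complex.ofReal_mul k, Complex.ofReal_div, Complex.ofReal_div,
    Complex.ofReal_div, hs, hc]
  set c := (Real.cos (T * k) : ℂ)
  set σ := (Real.sin (T * k) : ℂ)
  set c₀ := (Real.cos (t₀ * k) : ℂ)
  set σ₀ := (Real.sin (t₀ * k) : ℂ)
  set e := (ε : ℂ)
  set K := (k : ℂ)
  set g₁ := D.1.fourierFun ξ
  set g₂ := D.2.fourierFun ξ
  field_simp
  rcases hε with hε | hε
  · have he : e = 1 := by simp [e, hε]
    rw [he]
    linear_combination (K * (-(K * σ₀ * q₀ * g₁) + c₀ * q₁ * g₁ + c₀ * q₀ * g₂)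
      + σ₀ * q₁ * g₂) * hcs
  · have he : e = -1 := by simp [e, hε]
    rw [he]
    linear_combination (K * (-(K * σ₀ * q₀ * g₁) - c₀ * q₁ * g₁ + c₀ * q₀ * g₂)
      - σ₀ * q₁ * g₂) * hcs

theorem multiplier_add_mul_multiplier {m₁ m₂ : E3 → ℂ} (hm₁ : Measurable m₁)
    (hm₂ : Measurable m₂) {c₁ c₂ : ℝ} (h₁ : ∀ ξ, ‖m₁ ξ‖ ≤ c₁ * (1 + 2 * Real.pi * ‖ξ‖))
    (h₂ : ∀ ξ, ‖m₂ ξ‖ ≤ c₂ * (1 + 2 * Real.pi * ‖ξ‖)) (a : ℂ) (φ₁ φ₂ : 𝓢(E3, ℂ)) (x : E3) :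
    multiplier m₁ φ₁ x + a * multiplier m₂ φ₂ x =
      𝓕⁻ (fun ξ => m₁ ξ * (𝓕 φ₁) ξ + a * (m₂ ξ * (𝓕 φ₂) ξ)) x := by
  have key : ∀ {m : E3 → ℂ} {c : ℝ} (φ : 𝓢(E3, ℂ)), Measurable m →
      (∀ ξ, ‖m ξ‖ ≤ c * (1 + 2 * Real.pi * ‖ξ‖)) → Integrable fun v =>
        Complex.exp (↑(2 * Real.pi * inner ℝ v x) * Complex.I) • (m v * (𝓕 φ) v) := by
    intro m c φ hm hc
    refine (integrable_symbol_mul hm hc (𝓕 φ)).bdd_mul (c := 1) ?_ ?_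
    · exact Continuous.aestronglyMeasurable (by fun_prop)
    · exact Eventually.of_forall fun v => by rw [Complex.norm_exp_ofReal_mul_I]
  simp only [multiplier, Real.fourierInv_eq']
  rw [← integral_const_mul, ← integral_add (key φ₁ hm₁ h₁) ((key φ₂ hm₂ h₂).const_mul a)]
  congr 1
  ext v
  simp only [smul_eq_mul]
  ring

/-- The same transport law, now for the test functions, on which the propagators act in the Duhamel
term. -/
theorem multiplier_characteristic {ε : ℝ} (hε : ε = 1 ∨ ε = -1) (κ : ℝ) {T : ℝ} (hT : 0 ≤ T)
    (x : E3) :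
    multiplier (cosSymbol (κ + ε * T)) (radialTest _ (h.translate hT)) x
      + ε * multiplier (sineSymbol (κ + ε * T)) (radialTest _ (h.deriv.translate hT)) x
      = multiplier (cosSymbol κ) (radialTest ψ h) x
        + ε * multiplier (sineSymbol κ) (radialTest _ h.deriv) x := by
  have hc := isSymbolFamily_cos
  have hs := isSymbolFamily_sine
  rw [multiplier_add_mul_multiplier (hc.measurable _) (hs.measurable _) (hc.bound _) (hs.bound _),
    multiplier_add_mul_multiplier (hc.measurable _) (hs.measurable _) (hc.bound _) (hs.bound _)]
  refine Real.fourierInv_congr_ae ?_ x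
  filter_upwards [ae_ne_zero] with ξ hξ
  rw [fourier_radialTest_translate h hT hξ, fourier_radialTest_deriv_translate h hT hξ,
    sineSymbol_of_ne_zero _ hξ, sineSymbol_of_ne_zero _ hξ, sineSymbol_of_ne_zero _ hξ,
    cosSymbol, cosSymbol, cosSymbol]
  have hk := two_pi_norm_pos hξ
  set k := 2 * Real.pi * ‖ξ‖
  have hk' : (k : ℂ) ≠ 0 := by exact_mod_cast hk.ne'
  set q₀ := (𝓕 (radialTest ψ h)) ξ
  set q₁ := (𝓕 (radialTest _ h.deriv)) ξ
  have hcs : (Real.cos (T * k) : ℂ) ^ 2 + (Real.sin (T * k) : ℂ) ^ 2 = 1 := by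
    exact_mod_cast Real.cos_sq_add_sin_sq (T * k)
  rw [Complex.ofReal_div, Complex.ofReal_div, Complex.ofReal_div]
  rcases hε with rfl | rfl
  · rw [one_mul, add_mul, Real.sin_add, Real.cos_add]
    push_cast at hcs ⊢
    rw [mul_comm (T : ℂ)] at hcs
    field_simp
    linear_combination (Complex.cos (κ * k) * q₀ * k + Complex.sin (κ * k) * q₁) * hcs
  · rw [neg_one_mul, ← sub_eq_add_neg, sub_mul, Real.sin_sub, Real.cos_sub]
    push_cast at hcs ⊢
    rw [mul_comm (T : ℂ)] at hcs
    field_simp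
    linear_combination (Complex.cos (κ * k) * q₀ * k - Complex.sin (κ * k) * q₁) * hcs

theorem multiplier_cos_zero (φ : 𝓢(E3, ℂ)) (x : E3) : multiplier (cosSymbol 0) φ x = φ x := by
  have h1 : multiplier (cosSymbol 0) φ = 𝓕⁻ ((𝓕 φ : 𝓢(E3, ℂ)) : E3 → ℂ) := by
    unfold multiplier
    congr 1
    ext ξ
    simp [cosSymbol]
  rw [h1, ← SchwartzMap.fourierInv_coe, FourierTransform.fourierInv_fourier_eq]

theorem multiplier_sine_zero (φ : 𝓢(E3, ℂ)) (x : E3) : multiplier (sineSymbol 0) φ x = 0 := by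
  simp [multiplier, sineSymbol, Real.fourierInv_eq']

/-- The forcing along a characteristic, tested against `ψ`. -/
def characteristicForce (F : ℝ → ℝ → ℝ) (ε t₀ : ℝ) (τ : ℝ) : ℂ :=
  forcePairing F (cosSymbol (t₀ - τ)) (radialTest ψ h) τ
    + ε * forcePairing F (sineSymbol (t₀ - τ)) (radialTest _ h.deriv) τ

section

variable {s ε : ℝ} {F : ℝ → ℝ → ℝ}

/-- The Duhamel integrand does not depend on `T` once the two pairings are combined: the final time
enters only through the limit of integration. -/
theorem forcePairing_characteristic (hs0 : 0 < s) (hs1 : s < 1)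
    (hF : Measurable (Function.uncurry F)) (hε : ε = 1 ∨ ε = -1) (t₀ : ℝ) {T : ℝ} (hT : 0 ≤ T)
    {τ : ℝ} (hτ : sliceNorm s F τ < ⊤) :
    forcePairing F (cosSymbol (t₀ + ε * T - τ)) (radialTest _ (h.translate hT)) τ
      + ε * forcePairing F (sineSymbol (t₀ + ε * T - τ)) (radialTest _ (h.deriv.translate hT)) τ
      = characteristicForce h F ε t₀ τ := by
  have hc := isSymbolFamily_cos
  have hs := isSymbolFamily_sine
  have ic : ∀ κ φ, Integrable fun x : E3 => (F ‖x‖ τ : ℂ) * multiplier (cosSymbol κ) φ x :=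
    fun κ φ => integrable_mul_multiplier hs0 hs1 hF (hc.measurable _) (hc.bound κ) φ hτ
  have is : ∀ κ φ, Integrable fun x : E3 => (F ‖x‖ τ : ℂ) * multiplier (sineSymbol κ) φ x :=
    fun κ φ => integrable_mul_multiplier hs0 hs1 hF (hs.measurable _) (hs.bound κ) φ hτ
  simp only [characteristicForce, forcePairing]
  rw [← integral_const_mul, ← integral_const_mul, ← integral_add (ic _ _) ((is _ _).const_mul _),
    ← integral_add (ic _ _) ((is _ _).const_mul _)]
  refine integral_congr_ae (Eventually.of_forall fun x => ?_)
  have key := multiplier_characteristic h hε (t₀ - τ) hT x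
  rw [show t₀ - τ + ε * T = t₀ + ε * T - τ by ring] at key
  linear_combination (F ‖x‖ τ : ℂ) * key

/-- Since the integrand is independent of `T`, one may take `T` with `t₀ + ε T = τ`. The time lag is
then zero, the cosine symbol is `1` and the sine symbol `0`, and the force meets the translated test
function directly. -/
theorem characteristicForce_eq (hs0 : 0 < s) (hs1 : s < 1)
    (hF : Measurable (Function.uncurry F)) (hε : ε = 1 ∨ ε = -1) (t₀ : ℝ) {T : ℝ} (hT : 0 ≤ T)
    (hτ : sliceNorm s F (t₀ + ε * T) < ⊤) :
    characteristicForce h F ε t₀ (t₀ + ε * T) =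
      ∫ x : E3, (F ‖x‖ (t₀ + ε * T) : ℂ) * radialFun (fun r => ψ (r - T)) x := by
  rw [← forcePairing_characteristic h hs0 hs1 hF hε t₀ hT hτ, sub_self, forcePairing,
    forcePairing]
  simp only [multiplier_cos_zero, multiplier_sine_zero, radialTest_apply, mul_zero, integral_zero,
    add_zero]

/-- Weak form of the transport equation for `w_t - ε w_r`. The free parts cancel and the two Duhamel
integrals, both starting at time `0` and with the same integrand, differ by the piece between `t₀`
and `t₀ + ε T`. -/
theorem characteristic_identity (hs0 : 0 < s) (hs1 : s < 1)
    (hF : Measurable (Function.uncurry F)) (hε : ε = 1 ∨ ε = -1) (t₀ : ℝ) {T : ℝ} (hT : 0 ≤ T)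
    {u : ℝ → ℝ → ℝ}
    {U : ℝ → HomSobolev s × HomSobolev (s - 1)} (hsol : IsGlobalRadialSolution s F u U)
    (hK : ∀ a b : ℝ, ∫⁻ τ in Icc a b, sliceNorm s F τ < ⊤) :
    ((U (t₀ + ε * T)).2.toDistribution (radialTest _ (h.translate hT))
      + ε * (U (t₀ + ε * T)).1.toDistribution (radialTest _ (h.deriv.translate hT)))
      = ((U t₀).2.toDistribution (radialTest ψ h)
        + ε * (U t₀).1.toDistribution (radialTest _ h.deriv))
        + ∫ τ in t₀..(t₀ + ε * T), characteristicForce h F ε t₀ τ := by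
  have iC : ∀ t φ a b, IntervalIntegrable (fun τ => forcePairing F (cosSymbol (t - τ)) φ τ)
      volume a b := fun t φ a b =>
    intervalIntegrable_forcePairing hs0 hs1 hF hK isSymbolFamily_cos φ
      (κ := fun τ => t - τ) (by fun_prop) a b
  have iS : ∀ t φ a b, IntervalIntegrable (fun τ => forcePairing F (sineSymbol (t - τ)) φ τ)
      volume a b := fun t φ a b =>
    intervalIntegrable_forcePairing hs0 hs1 hF hK isSymbolFamily_sine φ
      (κ := fun τ => t - τ) (by fun_prop) a b
  have iE : ∀ a b, IntervalIntegrable (characteristicForce h F ε t₀) volume a b := fun a b =>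
    (iC _ _ a b).add ((iS _ _ a b).const_mul _)
  have e1 : (∫ τ in (0 : ℝ)..(t₀ + ε * T),
      forcePairing F (cosSymbol (t₀ + ε * T - τ)) (radialTest _ (h.translate hT)) τ)
      + ε * ∫ τ in (0 : ℝ)..(t₀ + ε * T),
        forcePairing F (sineSymbol (t₀ + ε * T - τ)) (radialTest _ (h.deriv.translate hT)) τ
      = ∫ τ in (0 : ℝ)..(t₀ + ε * T), characteristicForce h F ε t₀ τ := by
    rw [← intervalIntegral.integral_const_mul,
      ← intervalIntegral.integral_add (iC _ _ _ _) ((iS _ _ _ _).const_mul _)]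
    refine intervalIntegral.integral_congr_ae ?_
    filter_upwards [ae_sliceNorm_lt_top hF hK] with τ hτ _
    exact forcePairing_characteristic h hs0 hs1 hF hε t₀ hT hτ
  have e2 : (∫ τ in (0 : ℝ)..t₀, forcePairing F (cosSymbol (t₀ - τ)) (radialTest ψ h) τ)
      + ε * ∫ τ in (0 : ℝ)..t₀, forcePairing F (sineSymbol (t₀ - τ)) (radialTest _ h.deriv) τ
      = ∫ τ in (0 : ℝ)..t₀, characteristicForce h F ε t₀ τ := by
    rw [← intervalIntegral.integral_const_mul,
      ← intervalIntegral.integral_add (iC _ _ _ _) ((iS _ _ _ _).const_mul _)]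
    rfl
  have e3 := freeWave_characteristic h (U 0) hε t₀ hT
  have e4 := intervalIntegral.integral_add_adjacent_intervals (iE 0 t₀) (iE t₀ (t₀ + ε * T))
  rw [hsol.snd_apply hs0 hs1 hF hK, hsol.snd_apply hs0 hs1 hF hK, hsol.fst_apply, hsol.fst_apply]
  linear_combination e1 - e2 + e3 - e4

end

end Characteristic

end RadialWave
end

noncomputable section

namespace RadialWave

/-! ### Integrals along characteristics -/

theorem volume_real_unitBall : (volume : Measure E3).real (Metric.ball 0 1) = Real.pi * 4 / 3 := by
  rw [measureReal_def, EuclideanSpace.volume_ball_fin_three]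
  simp
  positivity

/-- The area `4πr²` of the sphere against the denominator `4πr` leaves one factor `r`: this is why
the radial test functions are normalised as they are. -/
theorem integral_mul_radialFun (g : ℝ → ℝ) (χ : ℝ → ℂ) :
    ∫ x : E3, (g ‖x‖ : ℂ) * radialFun χ x = ∫ r in Ioi (0 : ℝ), ((r * g r : ℝ) : ℂ) * χ r := by
  have h1 := integral_fun_norm_addHaar (volume : Measure E3)
    (fun r : ℝ => (g r : ℂ) * (χ r / (4 * Real.pi * r : ℝ)))
  rw [finrank_E3_sub_one, volume_real_unitBall, finrank_euclideanSpace_fin] at h1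
  refine h1.trans ?_
  rw [nsmul_eq_mul, ← integral_smul, ← integral_const_mul]
  refine setIntegral_congr_fun measurableSet_Ioi fun r hr => ?_
  have hr' : (r : ℂ) ≠ 0 := by exact_mod_cast (ne_of_gt hr)
  have hpi : (Real.pi : ℂ) ≠ 0 := by exact_mod_cast Real.pi_ne_zero
  simp only [Complex.real_smul]
  push_cast
  field_simp

/-- The integral of `r F` along the characteristic through `(r, t)` in the direction `ε`. -/
def charInt (F : ℝ → ℝ → ℝ) (ε t r : ℝ) : ℝ := ∫ σ in Ioi (0 : ℝ), (r + σ) * F (r + σ) (t + ε * σ)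

section CharInt

variable {F : ℝ → ℝ → ℝ} {C₀ β : ℝ}

theorem abs_mul_le_rpow (hbound : ∀ r > 0, ∀ t, |F r t| ≤ C₀ * r ^ (-(2 + β))) {r : ℝ} (hr : 0 < r)
    (t : ℝ) : |r * F r t| ≤ C₀ * r ^ (-(1 + β)) := by
  rw [abs_mul, abs_of_pos hr]
  calc r * |F r t| ≤ r * (C₀ * r ^ (-(2 + β))) := by gcongr; exact hbound r hr t
    _ = C₀ * (r ^ (1 : ℝ) * r ^ (-(2 + β))) := by rw [Real.rpow_one]; ring
    _ = C₀ * r ^ (-(1 + β)) := by rw [← Real.rpow_add hr]; congr 2; ring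

theorem nonneg_of_bound (hbound : ∀ r > 0, ∀ t, |F r t| ≤ C₀ * r ^ (-(2 + β))) : 0 ≤ C₀ := by
  have := hbound 1 one_pos 0
  rw [Real.one_rpow, mul_one] at this
  exact (abs_nonneg _).trans this

theorem measurable_char (hF : Measurable (Function.uncurry F)) (ε t : ℝ) :
    Measurable fun q : ℝ × ℝ => (q.1 + q.2) * F (q.1 + q.2) (t + ε * q.2) := by
  refine (measurable_fst.add measurable_snd).mul (hF.comp (Measurable.prodMk ?_ ?_)) <;> fun_prop

theorem integrableOn_add_rpow (hβ : 0 < β) {r : ℝ} (hr : 0 < r) :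
    IntegrableOn (fun σ => (r + σ) ^ (-(1 + β))) (Ioi 0) := by
  have := integrableOn_add_rpow_Ioi_of_lt (a := -(1 + β)) (c := 0) (m := r) (by linarith) (by linarith)
  simpa only [add_comm r] using this

theorem integral_add_rpow (hβ : 0 < β) {r : ℝ} (hr : 0 < r) :
    ∫ σ in Ioi 0, (r + σ) ^ (-(1 + β)) = r ^ (-β) / β := by
  have h1 : ∫ σ in Ioi (0 : ℝ), (r + σ) ^ (-(1 + β)) = ∫ x in Ioi r, x ^ (-(1 + β)) := by
    have := (measurePreserving_add_left volume r).setIntegral_preimage_emb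
      (measurableEmbedding_addLeft r) (fun x : ℝ => x ^ (-(1 + β))) (Ioi r)
    simpa using this
  rw [h1, integral_Ioi_rpow_of_lt (by linarith) hr]
  rw [show -(1 + β) + 1 = -β by ring, neg_div_neg_eq]

theorem abs_charInt_le (hβ : 0 < β)
    (hbound : ∀ r > 0, ∀ t, |F r t| ≤ C₀ * r ^ (-(2 + β))) (ε t : ℝ) {r : ℝ} (hr : 0 < r) :
    |charInt F ε t r| ≤ C₀ / β * r ^ (-β) := by
  have h1 : ‖charInt F ε t r‖ ≤ ∫ σ in Ioi 0, C₀ * (r + σ) ^ (-(1 + β)) := by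
    refine norm_integral_le_of_norm_le ((integrableOn_add_rpow hβ hr).const_mul C₀) ?_
    filter_upwards [ae_restrict_mem measurableSet_Ioi] with σ hσ
    exact abs_mul_le_rpow hbound (add_pos hr hσ) _
  rw [integral_const_mul, integral_add_rpow hβ hr] at h1
  rw [← Real.norm_eq_abs]
  refine h1.trans_eq (by ring)

theorem measurable_charInt (hF : Measurable (Function.uncurry F)) (ε t : ℝ) :
    Measurable (charInt F ε t) :=
  ((measurable_char hF ε t).stronglyMeasurable.integral_prod_right').measurable

/-- Hypothesis for Fubini: on the support of `ψ` one has `r ≥ a > 0`, so the product `C₀ (a +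
σ)^{-(1+β)} |ψ(r)|` dominates. -/
theorem integrable_char_mul (hF : Measurable (Function.uncurry F)) (hβ : 0 < β)
    (hbound : ∀ r > 0, ∀ t, |F r t| ≤ C₀ * r ^ (-(2 + β))) (ε t : ℝ) {ψ : ℝ → ℂ}
    (h : IsHalfLineTest ψ) :
    Integrable (fun q : ℝ × ℝ => (((q.2 + q.1) * F (q.2 + q.1) (t + ε * q.1) : ℝ) : ℂ) * ψ q.2)
      ((volume.restrict (Ioi 0)).prod (volume.restrict (Ioi 0))) := by
  obtain ⟨a, b, ha, -, hab⟩ := h.exists_bounds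
  have hC := nonneg_of_bound hbound
  have hψi : IntegrableOn (fun r => ‖ψ r‖) (Ioi 0) :=
    (h.contDiff.continuous.integrable_of_hasCompactSupport h.hasCompactSupport).norm.integrableOn
  have hdom := ((integrableOn_add_rpow hβ ha).const_mul C₀).mul_prod hψi
  refine Integrable.mono' hdom ?_ ?_
  · have h1 := ((measurable_char hF ε t).comp measurable_swap)
    have h2 := h.contDiff.continuous.measurable
    exact ((Complex.measurable_ofReal.comp h1).mul (h2.comp measurable_snd)).aestronglyMeasurable
  · rw [Measure.prod_restrict]
    filter_upwards [ae_restrict_mem (measurableSet_Ioi.prod measurableSet_Ioi)] with q hq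
    obtain ⟨h1, h2⟩ := hq
    simp only [mem_Ioi] at h1 h2
    rw [norm_mul, Complex.norm_real]
    rcases eq_or_ne (ψ q.2) 0 with h0 | h0
    · simp [h0]
    · gcongr
      refine (abs_mul_le_rpow hbound (add_pos h2 h1) _).trans ?_
      gcongr ?_ * ?_
      exact Real.rpow_le_rpow_of_nonpos (by positivity) (by linarith [(hab _ h0).1]) (by linarith)

theorem integral_translate_eq {g : ℝ → ℝ} {ψ : ℝ → ℂ} (h : IsHalfLineTest ψ) {σ : ℝ} (hσ : 0 ≤ σ) :
    ∫ r in Ioi (0 : ℝ), ((r * g r : ℝ) : ℂ) * ψ (r - σ) =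
      ∫ r in Ioi (0 : ℝ), (((r + σ) * g (r + σ) : ℝ) : ℂ) * ψ r := by
  have h1 : ∀ χ : ℝ → ℂ, IsHalfLineTest χ → ∀ f : ℝ → ℂ,
      ∫ r in Ioi (0 : ℝ), f r * χ r = ∫ r, f r * χ r := fun χ hχ f => by
    refine setIntegral_eq_integral_of_forall_compl_eq_zero fun r hr => ?_
    rw [hχ.eq_zero_of_nonpos (by simpa using hr), mul_zero]
  rw [h1 _ (h.translate hσ) fun r => ((r * g r : ℝ) : ℂ),
    h1 ψ h fun r => (((r + σ) * g (r + σ) : ℝ) : ℂ),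
    ← integral_add_right_eq_self _ σ]
  simp

end CharInt

/-- The representation of the outgoing and incoming derivatives of `w = r u` by integrals along
characteristics. -/
theorem characteristic_representation {s : ℝ} (hs0 : 0 < s) (hs1 : s < 1) {F u : ℝ → ℝ → ℝ}
    {U : ℝ → HomSobolev s × HomSobolev (s - 1)} (hF : Measurable (Function.uncurry F))
    (hsol : IsGlobalRadialSolution s F u U) (hcompact : IsCompact (closure (range U)))
    (hK : ∀ a b : ℝ, ∫⁻ τ in Icc a b, sliceNorm s F τ < ⊤) {C₀ β : ℝ} (hβ : 0 < β)
    (hbound : ∀ r > 0, ∀ t, |F r t| ≤ C₀ * r ^ (-(2 + β))) {ε : ℝ} (hε : ε = 1 ∨ ε = -1) (t₀ : ℝ)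
    {ψ : ℝ → ℂ} (h : IsHalfLineTest ψ) :
    (U t₀).2.toDistribution (radialTest ψ h) + ε * (U t₀).1.toDistribution (radialTest _ h.deriv)
      = -ε * ∫ r in Ioi (0 : ℝ), (charInt F ε t₀ r : ℂ) * ψ r := by
  have hε0 : ε ≠ 0 := by rcases hε with rfl | rfl <;> norm_num
  have hεε : ε * ε = 1 := by rcases hε with rfl | rfl <;> norm_num
  have hint := integrable_char_mul hF hβ hbound ε t₀ h
  set I : ℝ → ℂ := fun σ => ∫ r in Ioi (0 : ℝ),
    (((r + σ) * F (r + σ) (t₀ + ε * σ) : ℝ) : ℂ) * ψ r with hI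
  have hIi : IntegrableOn I (Ioi 0) := hint.integral_prod_left
  -- For `ε = ±1` the map `σ ↦ t₀ + ε σ` is an isometry of the line, hence almost every time on the
  -- characteristic is admissible.
  have hae : ∀ᵐ σ : ℝ, sliceNorm s F (t₀ + ε * σ) < ⊤ := by
    have hq : Measure.QuasiMeasurePreserving (fun σ : ℝ => t₀ + ε * σ) volume volume := by
      rcases hε with rfl | rfl
      · simpa using (measurePreserving_add_left volume t₀).quasiMeasurePreserving
      · have := ((measurePreserving_add_left volume t₀).comp
          (Measure.measurePreserving_neg (volume : Measure ℝ))).quasiMeasurePreserving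
        simpa [Function.comp_def] using this
    exact hq.ae (ae_sliceNorm_lt_top hF hK)
  have hforce : ∀ T : ℝ, 0 ≤ T → ∫ τ in t₀..(t₀ + ε * T), characteristicForce h F ε t₀ τ
      = ε * ∫ σ in (0 : ℝ)..T, I σ := by
    intro T hT
    have h1 := intervalIntegral.integral_comp_add_mul (a := 0) (b := T)
      (characteristicForce h F ε t₀) hε0 t₀
    rw [mul_zero, add_zero] at h1
    have h2 : ∫ σ in (0 : ℝ)..T, characteristicForce h F ε t₀ (t₀ + ε * σ)
        = ∫ σ in (0 : ℝ)..T, I σ := by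
      refine intervalIntegral.integral_congr_ae ?_
      filter_upwards [hae] with σ hσ hmem
      rw [uIoc_of_le hT] at hmem
      rw [characteristicForce_eq h hs0 hs1 hF hε t₀ hmem.1.le hσ,
        integral_mul_radialFun (fun r => F r (t₀ + ε * σ)),
        integral_translate_eq (g := fun r => F r (t₀ + ε * σ)) h hmem.1.le]
    rw [← h2, h1, Complex.real_smul, ← mul_assoc, ← Complex.ofReal_mul, mul_inv_cancel₀ hε0,
      Complex.ofReal_one, one_mul]
  -- As `T = n → ∞` the left side of the transport identity vanishes by compactness of the
  -- trajectory, so the data at `t₀` are minus the force collected along the whole characteristic.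
  have hlim := tendsto_pairing_escaping hs0 hs1 hcompact h ε (fun n => t₀ + ε * n)
  have hid : ∀ n : ℕ, _ := fun n : ℕ =>
    characteristic_identity h hs0 hs1 hF hε t₀ (T := n) n.cast_nonneg hsol hK
  simp only [hid, hforce _ (Nat.cast_nonneg _)] at hlim
  have hlim2 := (intervalIntegral_tendsto_integral_Ioi 0 hIi
    (tendsto_natCast_atTop_atTop (R := ℝ))).const_mul (ε : ℂ) |>.const_add
      ((U t₀).2.toDistribution (radialTest ψ h) + ε * (U t₀).1.toDistribution (radialTest _ h.deriv))
  have huniq := tendsto_nhds_unique hlim2 hlim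
  have hswap : ∫ σ in Ioi (0 : ℝ), I σ = ∫ r in Ioi (0 : ℝ), (charInt F ε t₀ r : ℂ) * ψ r := by
    rw [hI, integral_integral_swap hint]
    refine integral_congr_ae (Eventually.of_forall fun r => ?_)
    simp only
    rw [integral_mul_const, charInt]
    congr 1
    exact integral_ofReal
  rw [hswap] at huniq
  linear_combination huniq

end RadialWave
end

noncomputable section

namespace RadialWave


/-! ### Continuity of the characteristic integrals in `L²` -/

theorem ContinuousInL2.add {α G : Type*} [MeasurableSpace α] [NormedAddCommGroup G] {μ : Measure α}
    {f g : ℝ → α → G} (hf : ContinuousInL2 μ f) (hg : ContinuousInL2 μ g) :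
    ContinuousInL2 μ fun t a => f t a + g t a := by
  refine ⟨fun t => (hf.1 t).add (hg.1 t), fun t₀ => ?_⟩
  have h := (hf.2 t₀).add (hg.2 t₀)
  rw [add_zero] at h
  refine tendsto_of_tendsto_of_tendsto_of_le_of_le tendsto_const_nhds h (fun _ => zero_le)
    fun t => ?_
  have := eLpNorm_add_le ((hf.1 t).sub (hf.1 t₀)).1 ((hg.1 t).sub (hg.1 t₀)).1 one_le_two
  refine le_trans (le_of_eq ?_) this
  congr 1
  ext a
  simp only [Pi.add_apply, Pi.sub_apply]
  abel

theorem ContinuousInL2.const_smul {α G : Type*} [MeasurableSpace α] [NormedAddCommGroup G]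
    [NormedSpace ℝ G] {μ : Measure α} {f : ℝ → α → G} (hf : ContinuousInL2 μ f) (c : ℝ) :
    ContinuousInL2 μ fun t a => c • f t a := by
  refine ⟨fun t => (hf.1 t).const_smul c, fun t₀ => ?_⟩
  have h : Tendsto (fun t => ‖c‖ₑ * eLpNorm (fun a => f t a - f t₀ a) 2 μ) (𝓝 t₀) (𝓝 0) := by
    simpa using ENNReal.Tendsto.const_mul (hf.2 t₀) (Or.inr enorm_ne_top)
  refine h.congr fun t => ?_
  rw [← eLpNorm_const_smul]
  congr 1
  ext a
  simp [smul_sub]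

/-- Translations act continuously on `L²(ℝ)`. -/
theorem tendsto_eLpNorm_translate_sub {f : ℝ → ℝ} (hf : MemLp f 2 volume) :
    Tendsto (fun h : ℝ => eLpNorm (fun r => f (h + r) - f r) 2 volume) (𝓝 0) (𝓝 0) := by
  have : Fact ((2 : ℝ≥0∞) ≠ ⊤) := ⟨by simp⟩
  have hc : Continuous fun h : ℝ => (DomAddAct.mk h : ℝᵈᵃᵃ) +ᵥ hf.toLp f :=
    (continuous_vadd (M := ℝᵈᵃᵃ) (X := Lp ℝ 2 (volume : Measure ℝ))).comp
      ((DomAddAct.continuous_mk).prodMk continuous_const)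
  have h0 := (tendsto_iff_edist_tendsto_0.1 (hc.tendsto 0))
  refine h0.congr fun h => ?_
  rw [DomAddAct.mk_vadd_toLp, DomAddAct.mk_vadd_toLp, Lp.edist_toLp_toLp]
  congr 1
  ext r
  simp

section CharInt

variable {F : ℝ → ℝ → ℝ} {C₀ β : ℝ}

/-- Used with `a = -β`, where the condition on `a` reads `β > 1/2`, that is, `p < 5`. -/
theorem memLp_rpow_Ici {a R : ℝ} (ha : a < -(1 / 2)) (hR : 0 < R) :
    MemLp (fun r : ℝ => r ^ a) 2 (volume.restrict (Ici R)) := by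
  rw [memLp_two_iff_integrable_sq (by fun_prop)]
  have h : IntegrableOn (fun r : ℝ => r ^ (2 * a)) (Ici R) :=
    (integrableOn_Ici_iff_integrableOn_Ioi (by simp)).2 (integrableOn_Ioi_rpow_of_lt (by linarith) hR)
  refine h.congr_fun (fun r hr => ?_) measurableSet_Ici
  have : 0 < r := hR.trans_le hr
  simp only
  rw [two_mul, Real.rpow_add this, sq]

theorem memLp_Ici_of_le_rpow {f : ℝ → ℝ} (hf : Measurable f) {K : ℝ} (hβ : 1 / 2 < β)
    (hle : ∀ r > 0, |f r| ≤ K * r ^ (-β)) {R : ℝ} (hR : 0 < R) :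
    MemLp f 2 (volume.restrict (Ici R)) := by
  refine ((memLp_rpow_Ici (a := -β) (by linarith) hR).const_mul K).mono' hf.aestronglyMeasurable ?_
  filter_upwards [ae_restrict_mem measurableSet_Ici] with r hr
  exact hle r (hR.trans_le hr)

theorem memLp_charInt (hF : Measurable (Function.uncurry F)) (hβ : 1 / 2 < β)
    (hbound : ∀ r > 0, ∀ t, |F r t| ≤ C₀ * r ^ (-(2 + β))) (ε t : ℝ) {R : ℝ} (hR : 0 < R) :
    MemLp (charInt F ε t) 2 (volume.restrict (Ici R)) :=
  memLp_Ici_of_le_rpow (measurable_charInt hF ε t) hβ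
    (fun _ hr => abs_charInt_le (by linarith) hbound ε t hr) hR

theorem integrableOn_char_Ioi (hF : Measurable (Function.uncurry F)) (hβ : 0 < β)
    (hbound : ∀ r > 0, ∀ t, |F r t| ≤ C₀ * r ^ (-(2 + β))) (ε t : ℝ) {r c : ℝ} (hr : 0 < r + c) :
    IntegrableOn (fun σ => (r + σ) * F (r + σ) (t + ε * σ)) (Ioi c) := by
  have h1 : IntegrableOn (fun σ => (r + σ) ^ (-(1 + β))) (Ioi c) := by
    have := integrableOn_add_rpow_Ioi_of_lt (a := -(1 + β)) (c := c) (m := r)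
      (by linarith) (by linarith)
    simpa only [add_comm r] using this
  refine (h1.const_mul C₀).mono'
    ((measurable_char hF ε t).comp (measurable_const.prodMk measurable_id)).aestronglyMeasurable ?_
  filter_upwards [ae_restrict_mem measurableSet_Ioi] with σ hσ
  exact abs_mul_le_rpow hbound (by linarith [mem_Ioi.1 hσ]) _

/-- Moving along a characteristic changes the characteristic integral by a local term only. -/
theorem abs_charInt_add_sub_le (hF : Measurable (Function.uncurry F)) (hβ : 0 < β)
    (hbound : ∀ r > 0, ∀ t, |F r t| ≤ C₀ * r ^ (-(2 + β))) {ε : ℝ} (hε : ε = 1 ∨ ε = -1)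
    (t : ℝ) {δ r : ℝ} (hr : 0 < r) (hδ : |δ| ≤ r / 2) :
    |charInt F ε (t + δ) r - charInt F ε t (-(ε * δ) + r)| ≤ C₀ * (r / 2) ^ (-(1 + β)) * |δ| := by
  have hεε : ε * ε = 1 := by rcases hε with rfl | rfl <;> norm_num
  have hεδ : |ε * δ| = |δ| := by rcases hε with rfl | rfl <;> simp
  have hle := abs_le.1 (hεδ.le.trans hδ)
  have hC := nonneg_of_bound hbound
  -- The point `(q, t)` lies on the characteristic through `(r, t + δ)`; its parameter is shifted by
  -- `ε δ`. Since `|δ| ≤ r/2`, the segment between the two stays at radius at least `r/2`.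
  set q := -(ε * δ) + r with hq
  set H : ℝ → ℝ := fun σ => (q + σ) * F (q + σ) (t + ε * σ) with hH
  have h1 : charInt F ε (t + δ) r = ∫ σ in Ioi (ε * δ), H σ := by
    have := (measurePreserving_add_left volume (ε * δ)).setIntegral_preimage_emb
      (measurableEmbedding_addLeft (ε * δ)) H (Ioi (ε * δ))
    rw [← this, charInt]
    simp only [preimage_const_add_Ioi, sub_self]
    refine setIntegral_congr_fun measurableSet_Ioi fun σ _ => ?_
    simp only [hH, hq]
    rw [show -(ε * δ) + r + (ε * δ + σ) = r + σ by ring,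
      show t + ε * (ε * δ + σ) = t + ε * ε * δ + ε * σ by ring, hεε, one_mul]
  have hi1 : IntegrableOn H (Ioi (ε * δ)) :=
    integrableOn_char_Ioi hF hβ hbound ε t (by rw [hq]; linarith)
  have hi2 : IntegrableOn H (Ioi 0) :=
    integrableOn_char_Ioi hF hβ hbound ε t (by rw [hq]; linarith)
  have h2 := intervalIntegral.integral_interval_add_Ioi hi1 hi2
  have h3 : charInt F ε t q = ∫ σ in Ioi 0, H σ := rfl
  rw [h1, h3, ← h2, add_sub_cancel_right, ← Real.norm_eq_abs]
  have h4 := intervalIntegral.norm_integral_le_of_norm_le_const (a := ε * δ) (b := 0) (f := H)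
    (C := C₀ * (r / 2) ^ (-(1 + β))) fun σ hσ => ?_
  · simpa [hεδ] using h4
  · have hσ' : r / 2 ≤ q + σ := by
      rw [uIoc, mem_Ioc] at hσ
      have h5 := hσ.1.le
      rcases min_le_iff.1 h5 with h6 | h6
      · rw [hq]; linarith
      · rw [hq]; linarith
    refine (abs_mul_le_rpow hbound (by linarith) _).trans ?_
    gcongr ?_ * ?_
    exact Real.rpow_le_rpow_of_nonpos (by positivity) hσ' (by linarith)

/-- By `abs_charInt_add_sub_le` a change of time is a translation in `r`, which is continuous in
`L²`, plus an error of size `|t - t₀| r^{-(1+β)}`. -/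
theorem continuousInL2_charInt (hF : Measurable (Function.uncurry F)) (hβ : 1 / 2 < β)
    (hbound : ∀ r > 0, ∀ t, |F r t| ≤ C₀ * r ^ (-(2 + β))) {ε : ℝ} (hε : ε = 1 ∨ ε = -1)
    {R : ℝ} (hR : 0 < R) :
    ContinuousInL2 (volume.restrict (Ici R)) fun t => charInt F ε t := by
  refine ⟨fun t => memLp_charInt hF hβ hbound ε t hR, fun t₀ => ?_⟩
  have hR2 : 0 < R / 2 := by positivity
  have hεε : |ε| = 1 := by rcases hε with rfl | rfl <;> norm_num
  -- Translation continuity is available on the whole line, so the function is truncated. Cutting at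
  -- `R/2` rather than `R` makes the truncation invisible for `r ≥ R` after shifts by less than
  -- `R/2`.
  set f : ℝ → ℝ := (Ici (R / 2)).indicator (charInt F ε t₀) with hf
  have hfm : MemLp f 2 volume :=
    (memLp_indicator_iff_restrict measurableSet_Ici).2 (memLp_charInt hF hβ hbound ε t₀ hR2)
  have hshift : Tendsto (fun t : ℝ => -(ε * (t - t₀))) (𝓝 t₀) (𝓝 0) := by
    have : Continuous fun t : ℝ => -(ε * (t - t₀)) := by fun_prop
    simpa using this.tendsto t₀
  have hT1 := (tendsto_eLpNorm_translate_sub hfm).comp hshift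
  set E : ℝ → ℝ := fun r => C₀ * (r / 2) ^ (-(1 + β)) with hE
  have hEm : MemLp E 2 (volume.restrict (Ici R)) := by
    have := (memLp_rpow_Ici (a := -(1 + β)) (by linarith) hR).const_mul (C₀ * (1 / 2) ^ (-(1 + β)))
    refine this.ae_eq ?_
    filter_upwards [ae_restrict_mem measurableSet_Ici] with r hr
    have hr' : 0 ≤ r := hR.le.trans hr
    rw [hE]
    simp only
    rw [div_eq_mul_one_div r 2, Real.mul_rpow hr' (by norm_num)]
    ring
  have hT2 : Tendsto (fun t : ℝ => ‖t - t₀‖ₑ * eLpNorm E 2 (volume.restrict (Ici R))) (𝓝 t₀) (𝓝 0) := by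
    have h1 : Tendsto (fun t : ℝ => ‖t - t₀‖ₑ) (𝓝 t₀) (𝓝 0) := by
      have : Continuous fun t : ℝ => ‖t - t₀‖ₑ := by fun_prop
      simpa using this.tendsto t₀
    simpa using ENNReal.Tendsto.mul_const h1 (Or.inr hEm.2.ne)
  have hT := hT1.add hT2
  rw [add_zero] at hT
  refine tendsto_of_tendsto_of_tendsto_of_le_of_le' tendsto_const_nhds hT
    (Eventually.of_forall fun _ => zero_le) ?_
  filter_upwards [Metric.ball_mem_nhds t₀ hR2] with t ht
  rw [Metric.mem_ball, Real.dist_eq] at ht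
  set g : ℝ → ℝ := fun r => f (-(ε * (t - t₀)) + r) - f r with hg
  have hgm : AEStronglyMeasurable g (volume.restrict (Ici R)) := by
    have : Measurable f := (measurable_charInt hF ε t₀).indicator measurableSet_Ici
    exact ((this.comp (measurable_const_add _)).sub this).aestronglyMeasurable
  have h1 : eLpNorm (fun r => charInt F ε t r - charInt F ε t₀ r) 2 (volume.restrict (Ici R)) ≤
      eLpNorm (fun r => ‖g r‖ + ‖(t - t₀) • E r‖) 2 (volume.restrict (Ici R)) := by
    refine eLpNorm_mono_ae ?_
    filter_upwards [ae_restrict_mem measurableSet_Ici] with r hr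
    have hr : R ≤ r := hr
    have hle := abs_le.1 (show |ε * (t - t₀)| ≤ R / 2 by rw [abs_mul, hεε, one_mul]; exact ht.le)
    have h3 := abs_charInt_add_sub_le hF (by linarith) hbound hε t₀ (δ := t - t₀) (r := r)
      (by linarith) (by linarith)
    rw [add_sub_cancel] at h3
    have h4 : g r = charInt F ε t₀ (-(ε * (t - t₀)) + r) - charInt F ε t₀ r := by
      rw [hg, hf]
      simp only
      rw [indicator_of_mem, indicator_of_mem] <;> simp only [mem_Ici] <;> linarith
    have h5 : ‖(t - t₀) • E r‖ = E r * |t - t₀| := by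
      have : 0 ≤ E r := mul_nonneg (nonneg_of_bound hbound) (Real.rpow_nonneg (by linarith) _)
      rw [norm_smul, Real.norm_eq_abs, Real.norm_of_nonneg this, mul_comm]
    rw [h5, h4]
    refine le_trans ?_ (Real.le_norm_self _)
    have h6 := abs_sub_le (charInt F ε t r) (charInt F ε t₀ (-(ε * (t - t₀)) + r))
      (charInt F ε t₀ r)
    rw [Real.norm_eq_abs, Real.norm_eq_abs]
    linarith
  have h2 : eLpNorm (fun r => ‖g r‖ + ‖(t - t₀) • E r‖) 2 (volume.restrict (Ici R)) ≤
      eLpNorm (fun r => ‖g r‖) 2 (volume.restrict (Ici R))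
        + eLpNorm (fun r => ‖(t - t₀) • E r‖) 2 (volume.restrict (Ici R)) :=
    eLpNorm_add_le hgm.norm (hEm.1.const_smul (t - t₀)).norm one_le_two
  have h3 : eLpNorm (fun r => ‖(t - t₀) • E r‖) 2 (volume.restrict (Ici R))
      = ‖t - t₀‖ₑ * eLpNorm E 2 (volume.restrict (Ici R)) := by
    clear_value E
    rw [eLpNorm_norm, ← eLpNorm_const_smul]
    rfl
  have h4 : eLpNorm (fun r => ‖g r‖) 2 (volume.restrict (Ici R)) ≤ eLpNorm g 2 volume :=
    (eLpNorm_norm _).trans_le (eLpNorm_mono_measure _ Measure.restrict_le_self)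
  rw [h3] at h2
  exact h1.trans (h2.trans (add_le_add_left h4 _))

end CharInt

end RadialWave
end

noncomputable section

namespace RadialWave


/-! ### The first derivatives of `w = r u` -/

/-- The derivative of `w = r u` with respect to `r`. -/
def radialDeriv (F : ℝ → ℝ → ℝ) (r t : ℝ) : ℝ := 1 / 2 * (charInt F (-1) t r + charInt F 1 t r)

/-- The derivative of `w = r u` with respect to `t`. -/
def timeDeriv (F : ℝ → ℝ → ℝ) (r t : ℝ) : ℝ := 1 / 2 * (charInt F (-1) t r - charInt F 1 t r)

/-- A radial solution with pre-compact trajectory and a force of order `|x|^{-2-β}`. -/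
structure IsCompactRadialSolution (s β C₀ : ℝ) (F u : ℝ → ℝ → ℝ)
    (U : ℝ → HomSobolev s × HomSobolev (s - 1)) : Prop where
  half_lt : 1 / 2 < β
  lt_one : β < 1
  s_eq : s = 3 / 2 - β
  measurable : Measurable (Function.uncurry F)
  isSolution : IsGlobalRadialSolution s F u U
  isCompact : IsCompact (closure (range U))
  force_integrable : ∀ a b : ℝ, ∫⁻ τ in Icc a b, sliceNorm s F τ < ⊤
  bound : ∀ r > 0, ∀ t, |F r t| ≤ C₀ * r ^ (-(2 + β))

theorem locallyIntegrableOn_Ioi_of_le_rpow {f : ℝ → ℝ} (hf : Measurable f) {K a : ℝ}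
    (hle : ∀ r > 0, |f r| ≤ K * r ^ a) : LocallyIntegrableOn f (Ioi 0) := by
  have h1 : LocallyIntegrableOn (fun r : ℝ => K * r ^ a) (Ioi 0) := by
    refine ContinuousOn.locallyIntegrableOn ?_ measurableSet_Ioi
    exact continuousOn_const.mul
      (continuousOn_id.rpow_const fun r hr => Or.inl (ne_of_gt hr))
  rw [locallyIntegrableOn_iff isOpen_Ioi.isLocallyClosed] at h1 ⊢
  intro k hk hkc
  refine (h1 k hk hkc).mono' hf.aestronglyMeasurable ?_
  filter_upwards [ae_restrict_mem hkc.measurableSet] with r hr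
  exact hle r (hk hr)

namespace IsCompactRadialSolution

variable {s β C₀ : ℝ} {F u : ℝ → ℝ → ℝ} {U : ℝ → HomSobolev s × HomSobolev (s - 1)}

theorem β_pos (h : IsCompactRadialSolution s β C₀ F u U) : 0 < β := by linarith [h.half_lt]

theorem s_pos (h : IsCompactRadialSolution s β C₀ F u U) : 0 < s := by
  linarith [h.s_eq, h.lt_one]

theorem s_lt_one (h : IsCompactRadialSolution s β C₀ F u U) : s < 1 := by
  linarith [h.s_eq, h.half_lt]

theorem measurable_radialDeriv (h : IsCompactRadialSolution s β C₀ F u U) (t : ℝ) :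
    Measurable fun r => radialDeriv F r t :=
  ((measurable_charInt h.measurable _ t).add (measurable_charInt h.measurable _ t)).const_mul _

theorem measurable_timeDeriv (h : IsCompactRadialSolution s β C₀ F u U) (t : ℝ) :
    Measurable fun r => timeDeriv F r t :=
  ((measurable_charInt h.measurable _ t).sub (measurable_charInt h.measurable _ t)).const_mul _

theorem abs_radialDeriv_le (h : IsCompactRadialSolution s β C₀ F u U) (t : ℝ) {r : ℝ} (hr : 0 < r) :
    |radialDeriv F r t| ≤ C₀ / β * r ^ (-β) := by
  have h1 := abs_le.1 (abs_charInt_le h.β_pos h.bound (-1) t hr)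
  have h2 := abs_le.1 (abs_charInt_le h.β_pos h.bound 1 t hr)
  rw [radialDeriv, abs_le]
  constructor <;> linarith

theorem abs_timeDeriv_le (h : IsCompactRadialSolution s β C₀ F u U) (t : ℝ) {r : ℝ} (hr : 0 < r) :
    |timeDeriv F r t| ≤ C₀ / β * r ^ (-β) := by
  have h1 := abs_le.1 (abs_charInt_le h.β_pos h.bound (-1) t hr)
  have h2 := abs_le.1 (abs_charInt_le h.β_pos h.bound 1 t hr)
  rw [timeDeriv, abs_le]
  constructor <;> linarith

theorem const_nonneg (h : IsCompactRadialSolution s β C₀ F u U) : 0 ≤ C₀ / β :=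
  div_nonneg (nonneg_of_bound h.bound) h.β_pos.le

theorem continuousInL2_radialDeriv (h : IsCompactRadialSolution s β C₀ F u U) {R : ℝ} (hR : 0 < R) :
    ContinuousInL2 (volume.restrict (Ici R)) fun t r => radialDeriv F r t :=
  ((continuousInL2_charInt h.measurable h.half_lt h.bound (Or.inr rfl) hR).add
    (continuousInL2_charInt h.measurable h.half_lt h.bound (Or.inl rfl) hR)).const_smul (1 / 2)

theorem continuousInL2_timeDeriv (h : IsCompactRadialSolution s β C₀ F u U) {R : ℝ} (hR : 0 < R) :
    ContinuousInL2 (volume.restrict (Ici R)) fun t r => timeDeriv F r t := by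
  have := ((continuousInL2_charInt h.measurable h.half_lt h.bound (Or.inr rfl) hR).add
    ((continuousInL2_charInt h.measurable h.half_lt h.bound (Or.inl rfl) hR).const_smul
      (-1))).const_smul (1 / 2)
  simpa only [timeDeriv, smul_eq_mul, neg_one_mul, ← sub_eq_add_neg] using this

theorem fst_radialTest (h : IsCompactRadialSolution s β C₀ F u U) (t : ℝ) {ψ : ℝ → ℂ}
    (hψ : IsHalfLineTest ψ) : (U t).1.toDistribution (radialTest ψ hψ)
      = ∫ r in Ioi (0 : ℝ), ((r * u r t : ℝ) : ℂ) * ψ r := by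
  rw [h.isSolution.fst_eq]
  exact integral_mul_radialFun (fun r => u r t) ψ

theorem integrable_charInt_mul (h : IsCompactRadialSolution s β C₀ F u U) (ε t : ℝ) {ψ : ℝ → ℂ}
    (hψ : IsHalfLineTest ψ) :
    IntegrableOn (fun r => (charInt F ε t r : ℂ) * ψ r) (Ioi 0) := by
  have h1 := (integrable_char_mul h.measurable h.β_pos h.bound ε t hψ).integral_prod_right
  refine h1.congr (Eventually.of_forall fun r => ?_)
  simp only
  rw [integral_mul_const, charInt]
  congr 1
  exact integral_ofReal

/-- Half the sum of the representations for `ε = 1` and `ε = -1` eliminates the radial derivative;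
half their difference gives `fst_radialTest_deriv`. -/
theorem snd_radialTest (h : IsCompactRadialSolution s β C₀ F u U) (t : ℝ) {ψ : ℝ → ℂ}
    (hψ : IsHalfLineTest ψ) : (U t).2.toDistribution (radialTest ψ hψ)
      = ∫ r in Ioi (0 : ℝ), (timeDeriv F r t : ℂ) * ψ r := by
  have h1 := characteristic_representation h.s_pos h.s_lt_one h.measurable h.isSolution h.isCompact
    h.force_integrable h.β_pos h.bound (Or.inl rfl) t hψ
  have h2 := characteristic_representation h.s_pos h.s_lt_one h.measurable h.isSolution h.isCompact
    h.force_integrable h.β_pos h.bound (Or.inr rfl) t hψ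
  have h3 : ∫ r in Ioi (0 : ℝ), (timeDeriv F r t : ℂ) * ψ r
      = 1 / 2 * ((∫ r in Ioi (0 : ℝ), (charInt F (-1) t r : ℂ) * ψ r)
        - ∫ r in Ioi (0 : ℝ), (charInt F 1 t r : ℂ) * ψ r) := by
    rw [← integral_sub (h.integrable_charInt_mul _ t hψ) (h.integrable_charInt_mul _ t hψ),
      ← integral_const_mul]
    congr 1
    ext r
    simp only [timeDeriv]
    push_cast
    ring
  rw [h3]
  push_cast at h1 h2
  linear_combination (1 / 2) * h1 + (1 / 2) * h2

theorem fst_radialTest_deriv (h : IsCompactRadialSolution s β C₀ F u U) (t : ℝ) {ψ : ℝ → ℂ}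
    (hψ : IsHalfLineTest ψ) : (U t).1.toDistribution (radialTest _ hψ.deriv)
      = -∫ r in Ioi (0 : ℝ), (radialDeriv F r t : ℂ) * ψ r := by
  have h1 := characteristic_representation h.s_pos h.s_lt_one h.measurable h.isSolution h.isCompact
    h.force_integrable h.β_pos h.bound (Or.inl rfl) t hψ
  have h2 := characteristic_representation h.s_pos h.s_lt_one h.measurable h.isSolution h.isCompact
    h.force_integrable h.β_pos h.bound (Or.inr rfl) t hψ
  have h3 : ∫ r in Ioi (0 : ℝ), (radialDeriv F r t : ℂ) * ψ r
      = 1 / 2 * ((∫ r in Ioi (0 : ℝ), (charInt F (-1) t r : ℂ) * ψ r)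
        + ∫ r in Ioi (0 : ℝ), (charInt F 1 t r : ℂ) * ψ r) := by
    rw [← integral_add (h.integrable_charInt_mul _ t hψ) (h.integrable_charInt_mul _ t hψ),
      ← integral_const_mul]
    congr 1
    ext r
    simp only [radialDeriv]
    push_cast
    ring
  rw [h3]
  push_cast at h1 h2
  linear_combination (1 / 2) * h1 - (1 / 2) * h2

theorem locallyIntegrableOn_mul (h : IsCompactRadialSolution s β C₀ F u U) (t : ℝ) :
    LocallyIntegrableOn (fun r => r * u r t) (Ioi 0) := by
  have h1 : LocallyIntegrableOn (fun r : ℝ => r ^ 2 * u r t) (Ioi 0) := by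
    intro r hr
    have h2 : IntegrableOn (fun x : E3 => u ‖x‖ t) (Metric.ball 0 (r + 1)) :=
      ((h.isSolution.locallyIntegrable t).integrableOn_isCompact
        (isCompact_closedBall 0 (r + 1))).mono_set Metric.ball_subset_closedBall
    have h3 := (integrableOn_fun_norm_addHaar volume (f := fun r => u r t)).1 h2
    rw [finrank_E3_sub_one] at h3
    exact ⟨Ioo 0 (r + 1), mem_nhdsWithin_of_mem_nhds (Ioo_mem_nhds hr (by linarith)), h3⟩
  have h4 : ContinuousOn (fun r : ℝ => r⁻¹) (Ioi 0) :=
    continuousOn_inv₀.mono fun r hr => ne_of_gt hr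
  have h5 := h1.continuousOn_mul h4 isOpen_Ioi.isLocallyClosed
  rw [locallyIntegrableOn_iff isOpen_Ioi.isLocallyClosed] at h5 ⊢
  intro k hk hkc
  refine (h5 k hk hkc).congr_fun (fun r hr => ?_) hkc.measurableSet
  have : r ≠ 0 := ne_of_gt (hk hr)
  simp only
  field_simp

theorem isHalfLineTest_ofReal {ψ : ℝ → ℝ} (h1 : ContDiff ℝ ∞ ψ) (h2 : HasCompactSupport ψ)
    (h3 : tsupport ψ ⊆ Ioi 0) : IsHalfLineTest fun r => (ψ r : ℂ) where
  contDiff := Complex.ofRealCLM.contDiff.comp h1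
  hasCompactSupport := h2.comp_left (g := fun y : ℝ => (y : ℂ)) (by simp)
  tsupport_subset := (closure_mono fun r hr => by
    simpa [Function.mem_support] using hr).trans h3

theorem isWeakDeriv (h : IsCompactRadialSolution s β C₀ F u U) (t : ℝ) :
    IsWeakDeriv (fun r => r * u r t) fun r => radialDeriv F r t := by
  refine ⟨h.locallyIntegrableOn_mul t, locallyIntegrableOn_Ioi_of_le_rpow
    (h.measurable_radialDeriv t) fun r hr => h.abs_radialDeriv_le t hr, fun ψ h1 h2 h3 => ?_⟩
  have hψ := isHalfLineTest_ofReal h1 h2 h3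
  have h4 := h.fst_radialTest_deriv t hψ
  rw [h.fst_radialTest t hψ.deriv] at h4
  have h5 : ∀ r, deriv (fun r => (ψ r : ℂ)) r = ((deriv ψ r : ℝ) : ℂ) := fun r =>
    ((h1.differentiable (by simp)) r).hasDerivAt.ofReal_comp.deriv
  simp only [h5, ← Complex.ofReal_mul] at h4
  have h6 : ((∫ r in Ioi (0 : ℝ), r * u r t * deriv ψ r : ℝ) : ℂ)
      = ((-∫ r in Ioi (0 : ℝ), radialDeriv F r t * ψ r : ℝ) : ℂ) := by
    rw [Complex.ofReal_neg, ← integral_complex_ofReal, ← integral_complex_ofReal]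
    exact h4
  exact_mod_cast h6

theorem isTimeDeriv (h : IsCompactRadialSolution s β C₀ F u U) :
    IsTimeDeriv (fun r t => r * u r t) (timeDeriv F) := by
  refine fun t => ⟨h.locallyIntegrableOn_mul t, locallyIntegrableOn_Ioi_of_le_rpow
    (h.measurable_timeDeriv t) fun r hr => h.abs_timeDeriv_le t hr, fun ψ h1 h2 h3 => ?_⟩
  have hψ := isHalfLineTest_ofReal h1 h2 h3
  have h4 := h.isSolution.snd_eq t (radialTest _ hψ)
  simp only [h.fst_radialTest _ hψ, h.snd_radialTest t hψ, ← Complex.ofReal_mul,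
    integral_complex_ofReal] at h4
  simpa [Function.comp_def] using Complex.reCLM.hasFDerivAt.comp_hasDerivAt t h4

/-- The energy of `w` on `[R, 4R]` in terms of the characteristic integrals. -/
theorem energy_eq (R t : ℝ) :
    ∫ r in R..(4 * R), ((radialDeriv F r t) ^ 2 + (timeDeriv F r t) ^ 2)
      = 1 / 2 * ∫ r in R..(4 * R), ((charInt F (-1) t r) ^ 2 + (charInt F 1 t r) ^ 2) := by
  -- Parallelogram identity, so the first inequality of the theorem holds with equality.
  rw [← intervalIntegral.integral_const_mul]
  congr 1
  ext r
  rw [radialDeriv, timeDeriv]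
  ring

/-- The interval has length `3R` and each square is at most `(C₀/β · R^{-β})²`, which gives the
constant. The exponent is `1 - 2β = -2(1-s)`. -/
theorem charInt_energy_le (h : IsCompactRadialSolution s β C₀ F u U) {R : ℝ} (hR : 0 < R) (t : ℝ) :
    1 / 2 * ∫ r in R..(4 * R), ((charInt F (-1) t r) ^ 2 + (charInt F 1 t r) ^ 2)
      ≤ 3 * (C₀ / β) ^ 2 * R ^ (-(2 * (1 - s))) := by
  have hK := h.const_nonneg
  have h1 := intervalIntegral.norm_integral_le_of_norm_le_const (a := R) (b := 4 * R)
    (f := fun r => (charInt F (-1) t r) ^ 2 + (charInt F 1 t r) ^ 2)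
    (C := 2 * (C₀ / β * R ^ (-β)) ^ 2) fun r hr => ?_
  · rw [abs_of_pos (by linarith)] at h1
    have h2 : R ^ (-(2 * (1 - s))) = (R ^ (-β)) ^ 2 * R := by
      rw [sq, ← Real.rpow_add hR]
      nth_rewrite 3 [← Real.rpow_one R]
      rw [← Real.rpow_add hR, h.s_eq]
      congr 1
      ring
    rw [h2]
    refine (mul_le_mul_of_nonneg_left ((Real.le_norm_self _).trans h1) (by norm_num)).trans_eq ?_
    ring
  · rw [uIoc_of_le (by linarith)] at hr
    have hr0 : 0 < r := hR.trans hr.1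
    have h3 : ∀ ε, (charInt F ε t r) ^ 2 ≤ (C₀ / β * R ^ (-β)) ^ 2 := fun ε => by
      refine sq_le_sq' ?_ ?_ <;>
      have h4 := abs_le.1 ((abs_charInt_le h.β_pos h.bound ε t hr0).trans
        (mul_le_mul_of_nonneg_left (Real.rpow_le_rpow_of_nonpos hR hr.1.le
          (by linarith [h.β_pos])) hK))
      · exact h4.1
      · exact h4.2
    rw [Real.norm_of_nonneg (by positivity)]
    linarith [h3 1, h3 (-1)]

end IsCompactRadialSolution

end RadialWave
end

noncomputable section

namespace RadialWave


/-! ### Spherical means of test functions -/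

/-- The integral of `φ` over the sphere of radius `ρ > 0`. -/
def sphereIntegral (φ : E3 → ℂ) (ρ : ℝ) : ℂ :=
  (Ioi (0 : ℝ)).indicator (fun ρ => ((ρ ^ 2 : ℝ) : ℂ) *
    ∫ θ : Metric.sphere (0 : E3) 1, φ (ρ • (θ : E3)) ∂sphereMeasure) ρ

/-- The spherical mean is written as the value at `0` of a convolution of the constant `1` with a
`ρ`-dependent kernel, over the sphere measure pushed to `ℝ³`, so that smoothness of convolutions in
a parameter applies. The bump `χ` is `1` on the unit sphere and only supplies compact support. -/
theorem contDiff_integral_sphere {φ : E3 → ℂ} (hφ : ContDiff ℝ ∞ φ) :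
    ContDiff ℝ ∞ fun ρ : ℝ => ∫ θ : Metric.sphere (0 : E3) 1, φ (ρ • (θ : E3)) ∂sphereMeasure := by
  let χ : ContDiffBump (0 : E3) := ⟨1, 2, one_pos, one_lt_two⟩
  set μ : Measure E3 := sphereMeasure.map Subtype.val with hμ
  have hemb : MeasurableEmbedding (Subtype.val : Metric.sphere (0 : E3) 1 → E3) :=
    MeasurableEmbedding.subtype_coe Metric.isClosed_sphere.measurableSet
  let g : ℝ → E3 → ℂ := fun ρ z => χ z • φ (-(ρ • z))
  have hg : ContDiff ℝ ∞ ↿g := by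
    have h1 : ContDiff ℝ ∞ fun q : ℝ × E3 => χ q.2 := χ.contDiff.comp contDiff_snd
    have h2 : ContDiff ℝ ∞ fun q : ℝ × E3 => φ (-(q.1 • q.2)) :=
      hφ.comp (contDiff_fst.smul contDiff_snd).neg
    exact h1.smul h2
  have h := contDiffOn_convolution_right_with_param_comp (n := ⊤) (μ := μ)
    (ContinuousLinearMap.lsmul ℝ ℝ : ℝ →L[ℝ] ℂ →L[ℝ] ℂ) (s := univ) (v := fun _ : ℝ => (0 : E3))
    contDiffOn_const (f := fun _ => (1 : ℝ)) (g := g) isOpen_univ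
    (isCompact_closedBall (0 : E3) 2) (fun ρ z _ hz => ?_) ?_ hg.contDiffOn
  · rw [contDiffOn_univ] at h
    refine (congrArg (ContDiff ℝ ∞) (funext fun ρ => ?_)).mp h
    rw [convolution_def, hμ, hemb.integral_map]
    refine integral_congr_ae (Eventually.of_forall fun θ => ?_)
    have hθ : ‖(θ : E3)‖ = 1 := by simp
    have : χ (-(θ : E3)) = 1 := χ.one_of_mem_closedBall (by simp [χ])
    simp [g, this]
  · have : χ z = 0 := χ.zero_of_le_dist (by simpa [χ] using (not_le.1 (by simpa using hz)).le)
    simp [g, this]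
  · have : IsFiniteMeasure μ := by rw [hμ]; infer_instance
    exact locallyIntegrable_const _

/-- Test functions on `ℝ³ ∖ {0}`. -/
structure IsPuncturedTest (φ : E3 → ℂ) : Prop where
  contDiff : ContDiff ℝ ∞ φ
  hasCompactSupport : HasCompactSupport φ
  tsupport_subset : tsupport φ ⊆ {0}ᶜ

namespace IsPuncturedTest

variable {φ : E3 → ℂ}

theorem exists_bounds (h : IsPuncturedTest φ) :
    ∃ a b : ℝ, 0 < a ∧ a < b ∧ ∀ x, φ x ≠ 0 → ‖x‖ ∈ Icc a b := by
  have hK : IsCompact (norm '' tsupport φ) := h.hasCompactSupport.isCompact.image continuous_norm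
  obtain ⟨b, hb⟩ := hK.bddAbove
  rcases (norm '' tsupport φ).eq_empty_or_nonempty with he | hne
  · refine ⟨1, 2, one_pos, by norm_num, fun r hr => ?_⟩
    have := mem_image_of_mem norm (subset_tsupport φ hr)
    simp [he] at this
  · obtain ⟨a, ha, hmin⟩ := hK.exists_isLeast hne
    refine ⟨a, b + 1, ?_, by linarith [hb ha], fun r hr => ?_⟩
    · obtain ⟨x, hx, rfl⟩ := ha
      exact norm_pos_iff.2 (h.tsupport_subset hx)
    · have := mem_image_of_mem norm (subset_tsupport φ hr)
      exact ⟨hmin this, by linarith [hb this]⟩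

theorem isHalfLineTest (h : IsPuncturedTest φ) : IsHalfLineTest (sphereIntegral φ) := by
  obtain ⟨a, b, ha, hab, hsupp⟩ := h.exists_bounds
  have hz : ∀ ρ : ℝ, ρ ∉ Icc a b → sphereIntegral φ ρ = 0 := fun ρ hρ => by
    rw [sphereIntegral]
    refine indicator_apply_eq_zero.2 fun hpos => ?_
    have : ∀ θ : Metric.sphere (0 : E3) 1, φ (ρ • (θ : E3)) = 0 := fun θ => by
      by_contra hne
      have h1 := hsupp _ hne
      have hθ : ‖(θ : E3)‖ = 1 := by simp
      rw [norm_smul, hθ, mul_one, Real.norm_of_nonneg (le_of_lt hpos)] at h1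
      exact hρ h1
    simp [this]
  have hsub : tsupport (sphereIntegral φ) ⊆ Icc a b :=
    closure_minimal (fun ρ hρ => by by_contra hne; exact hρ (hz ρ hne)) isClosed_Icc
  refine ⟨contDiff_iff_contDiffAt.2 fun ρ => ?_, isCompact_Icc.of_isClosed_subset
    (isClosed_tsupport _) hsub, fun ρ hρ => ha.trans_le (hsub hρ).1⟩
  by_cases hρ : 0 < ρ
  · have h1 : ContDiff ℝ ∞ fun ρ : ℝ => ((ρ ^ 2 : ℝ) : ℂ) *
        ∫ θ : Metric.sphere (0 : E3) 1, φ (ρ • (θ : E3)) ∂sphereMeasure :=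
      (Complex.ofRealCLM.contDiff.comp (contDiff_id.pow 2)).mul (contDiff_integral_sphere h.contDiff)
    refine h1.contDiffAt.congr_of_eventuallyEq ?_
    filter_upwards [Ioi_mem_nhds hρ] with x hx
    exact indicator_of_mem hx _
  · refine (contDiffAt_const (c := (0 : ℂ))).congr_of_eventuallyEq ?_
    filter_upwards [Iio_mem_nhds (show ρ < a by linarith)] with x hx
    exact hz x fun h => not_le.2 hx h.1

theorem integrable_mul (h : IsPuncturedTest φ) {f : E3 → ℂ} (hf : LocallyIntegrableOn f {0}ᶜ) :
    Integrable fun x => f x * φ x := by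
  have h1 := hf.integrableOn_compact_subset h.tsupport_subset h.hasCompactSupport.isCompact
  have h2 := h1.mul_continuousOn h.contDiff.continuous.continuousOn h.hasCompactSupport.isCompact
  rwa [integrableOn_iff_integrable_of_support_subset] at h2
  intro x hx
  exact subset_tsupport _ (right_ne_zero_of_mul hx)

/-- Integration against a radial function in polar coordinates. -/
theorem integral_radial_mul (h : IsPuncturedTest φ) {f : ℝ → ℂ}
    (hf : LocallyIntegrableOn (fun x : E3 => f ‖x‖) {0}ᶜ) :
    ∫ x : E3, f ‖x‖ * φ x = ∫ ρ in Ioi (0 : ℝ), f ρ * sphereIntegral φ ρ := by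
  have hi := integrable_polar (h.integrable_mul hf)
  rw [integral_polar, integral_prod_symm _ hi]
  have h1 : ∀ ρ : Ioi (0 : ℝ), ∫ θ : Metric.sphere (0 : E3) 1, f ‖(ρ : ℝ) • (θ : E3)‖
      * φ ((ρ : ℝ) • (θ : E3)) ∂sphereMeasure = (fun r : ℝ => f r *
        ∫ θ : Metric.sphere (0 : E3) 1, φ (r • (θ : E3)) ∂sphereMeasure) ρ := fun ρ => by
    simp only
    rw [← integral_const_mul]
    refine integral_congr_ae (Eventually.of_forall fun θ => ?_)
    have hθ : ‖(θ : E3)‖ = 1 := by simp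
    simp only
    rw [norm_smul, hθ, mul_one, Real.norm_of_nonneg (le_of_lt ρ.2)]
  rw [integral_congr_ae (Eventually.of_forall h1), integral_volumeIoiPow (fun r : ℝ => f r *
        ∫ θ : Metric.sphere (0 : E3) 1, φ (r • (θ : E3)) ∂sphereMeasure)]
  refine setIntegral_congr_fun measurableSet_Ioi fun ρ hρ => ?_
  simp only [sphereIntegral]
  rw [indicator_of_mem hρ]
  ring

end IsPuncturedTest

theorem IsHalfLineTest.setIntegral_mul {χ : ℝ → ℂ} (h : IsHalfLineTest χ) (f : ℝ → ℂ) :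
    ∫ r in Ioi (0 : ℝ), f r * χ r = ∫ r, f r * χ r := by
  refine setIntegral_eq_integral_of_forall_compl_eq_zero fun r hr => ?_
  rw [h.eq_zero_of_nonpos (by simpa using hr), mul_zero]

theorem IsPuncturedTest.fderiv_apply {ψ : E3 → ℂ} (h : IsPuncturedTest ψ) (e : E3) :
    IsPuncturedTest fun x => fderiv ℝ ψ x e where
  contDiff := (h.contDiff.fderiv_right (m := ∞) (by simp)).clm_apply contDiff_const
  hasCompactSupport := h.hasCompactSupport.fderiv_apply ℝ e
  tsupport_subset := (tsupport_fderiv_apply_subset ℝ e).trans h.tsupport_subset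

theorem IsPuncturedTest.mul_left {ψ : E3 → ℂ} (h : IsPuncturedTest ψ) {q : E3 → ℂ}
    (hq : ∀ x ≠ 0, ContDiffAt ℝ ∞ q x) : IsPuncturedTest fun x => q x * ψ x where
  contDiff := contDiff_iff_contDiffAt.2 fun x => by
    rcases eq_or_ne x 0 with rfl | hx
    · refine (contDiffAt_const (c := (0 : ℂ))).congr_of_eventuallyEq ?_
      filter_upwards [(isClosed_tsupport ψ).isOpen_compl.mem_nhds
        (fun h0 => h.tsupport_subset h0 rfl)] with y hy
      rw [image_eq_zero_of_notMem_tsupport hy, mul_zero]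
    · exact (hq x hx).mul h.contDiff.contDiffAt
  hasCompactSupport := h.hasCompactSupport.mul_left
  tsupport_subset := (tsupport_mul_subset_right (f := q)).trans h.tsupport_subset

theorem IsPuncturedTest.inner_mul {ψ : E3 → ℂ} (h : IsPuncturedTest ψ) (e : E3) :
    IsPuncturedTest fun x => ((inner ℝ x e / ‖x‖ : ℝ) : ℂ) * ψ x := by
  refine h.mul_left fun x hx => Complex.ofRealCLM.contDiff.contDiffAt.comp x ?_
  exact (contDiffAt_id.inner ℝ contDiffAt_const).div (contDiffAt_id.norm ℝ hx)
    (norm_ne_zero_iff.2 hx)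

/-- The divergence theorem on spheres: `∂_ρ ∫_{|x|=ρ} (x·e/|x|) ψ = ∫_{|x|=ρ} ∂_e ψ`. -/
theorem deriv_sphereIntegral_ae_eq {ψ : E3 → ℂ} (h : IsPuncturedTest ψ) (e : E3) :
    ∀ᵐ ρ : ℝ, ρ ∈ Ioi (0 : ℝ) →
      deriv (sphereIntegral fun x => ((inner ℝ x e / ‖x‖ : ℝ) : ℂ) * ψ x) ρ
        = sphereIntegral (fun x => fderiv ℝ ψ x e) ρ := by
  have hQ := (h.inner_mul e)
  have hD := h.fderiv_apply e
  set Q : E3 → ℂ := fun x => ((inner ℝ x e / ‖x‖ : ℝ) : ℂ) * ψ x with hQdef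
  have hSQ := hQ.isHalfLineTest
  have hSD := hD.isHalfLineTest
  have hcont : Continuous fun ρ => deriv (sphereIntegral Q) ρ
      - sphereIntegral (fun x => fderiv ℝ ψ x e) ρ :=
    hSQ.deriv.contDiff.continuous.sub hSD.contDiff.continuous
  -- The difference is tested against `χ(ρ)`. Integration by parts in `ℝ³` with `χ(|x|)`, whose
  -- gradient is `χ'(|x|) x/|x|`, matches integration by parts in `ρ` after passing to polar
  -- coordinates.
  have key := isOpen_Ioi.ae_eq_zero_of_integral_contDiff_smul_eq_zero (U := Ioi (0 : ℝ))
    (μ := volume) (hcont.locallyIntegrable.locallyIntegrableOn _) fun χ h1 h2 h3 => ?_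
  · filter_upwards [key] with ρ hρ hpos
    exact sub_eq_zero.1 (hρ hpos)
  have hχ := IsCompactRadialSolution.isHalfLineTest_ofReal h1 h2 h3
  set X : ℝ → ℂ := fun r => (χ r : ℂ) with hX
  have hXd : Differentiable ℝ X := hχ.contDiff.differentiable (by simp)
  have hXc : Continuous fun x : E3 => X ‖x‖ := hχ.contDiff.continuous.comp continuous_norm
  have hX'c : Continuous fun x : E3 => deriv X ‖x‖ :=
    hχ.deriv.contDiff.continuous.comp continuous_norm
  have hfd : ∀ x : E3, fderiv ℝ (fun y : E3 => X ‖y‖) x e * ψ x = deriv X ‖x‖ * Q x := by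
    intro x
    rcases eq_or_ne x 0 with rfl | hx
    · have : ψ 0 = 0 := image_eq_zero_of_notMem_tsupport fun h0 => h.tsupport_subset h0 rfl
      simp [hQdef, this]
    · rw [(hasFDerivAt_comp_norm hx (hXd ‖x‖).hasDerivAt).fderiv]
      simp [hQdef]
      ring
  have hparts := integral_mul_fderiv_eq_neg_fderiv_mul_of_integrable (μ := volume)
    (f := fun x : E3 => X ‖x‖) (g := ψ) (v := e)
    (by simpa only [hfd] using
      hQ.integrable_mul (hX'c.locallyIntegrable.locallyIntegrableOn _))
    (hD.integrable_mul (hXc.locallyIntegrable.locallyIntegrableOn _))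
    (h.integrable_mul (hXc.locallyIntegrable.locallyIntegrableOn _))
    (fun x hx => (hasFDerivAt_comp_norm (h.tsupport_subset hx)
      (hXd ‖x‖).hasDerivAt).differentiableAt)
    (fun x _ => (h.contDiff.differentiable (by simp)) x)
  simp only [hfd] at hparts
  rw [hD.integral_radial_mul (f := X) (hXc.locallyIntegrable.locallyIntegrableOn _),
    hQ.integral_radial_mul (f := deriv X) (hX'c.locallyIntegrable.locallyIntegrableOn _),
    hSD.setIntegral_mul, hSQ.setIntegral_mul] at hparts
  have hi : ∀ {f g : ℝ → ℂ}, IsHalfLineTest f → IsHalfLineTest g →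
      Integrable (fun r => f r * g r) := fun hf hg =>
    (hf.contDiff.continuous.mul hg.contDiff.continuous).integrable_of_hasCompactSupport
      hg.hasCompactSupport.mul_left
  have hparts1 : ∫ r, X r * deriv (sphereIntegral Q) r = -∫ r, deriv X r * sphereIntegral Q r :=
    integral_mul_deriv_eq_deriv_mul_of_integrable (fun r _ => (hXd r).hasDerivAt)
      (fun r _ => (hSQ.contDiff.differentiable (by simp) r).hasDerivAt)
      (hi hχ hSQ.deriv) (hi hχ.deriv hSQ) (hi hχ hSQ)
  have : ∀ r, χ r • (deriv (sphereIntegral Q) r - sphereIntegral (fun x => fderiv ℝ ψ x e) r)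
      = X r * deriv (sphereIntegral Q) r - X r * sphereIntegral (fun x => fderiv ℝ ψ x e) r :=
    fun r => by rw [Complex.real_smul, mul_sub]
  simp only [this]
  rw [integral_sub (hi hχ hSQ.deriv) (hi hχ hSD), hparts1, hparts, sub_self]

end RadialWave
end

noncomputable section

namespace RadialWave


/-! ### Functions with vanishing weak derivative -/

/-- Real-valued test functions on the half-line `(0,∞)`. -/
structure IsRealTest (ψ : ℝ → ℝ) : Prop where
  contDiff : ContDiff ℝ ∞ ψ
  hasCompactSupport : HasCompactSupport ψ
  tsupport_subset : tsupport ψ ⊆ Ioi 0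

namespace IsRealTest

variable {ψ φ η : ℝ → ℝ}

theorem ofReal (h : IsRealTest ψ) : IsHalfLineTest fun r => (ψ r : ℂ) :=
  IsCompactRadialSolution.isHalfLineTest_ofReal h.contDiff h.hasCompactSupport h.tsupport_subset

theorem exists_bounds (h : IsRealTest ψ) :
    ∃ a b : ℝ, 0 < a ∧ a < b ∧ ∀ r, r ∉ Icc a b → ψ r = 0 := by
  obtain ⟨a, b, ha, hab, hsupp⟩ := h.ofReal.exists_bounds
  refine ⟨a, b, ha, hab, fun r hr => ?_⟩
  by_contra hne
  exact hr (hsupp r (by simpa using hne))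

theorem of_bounds (h : ContDiff ℝ ∞ ψ) {a b : ℝ} (ha : 0 < a) (hab : ∀ r, r ∉ Icc a b → ψ r = 0) :
    IsRealTest ψ := by
  have hsub : tsupport ψ ⊆ Icc a b :=
    closure_minimal (fun ρ hρ => by by_contra hne; exact hρ (hab ρ hne)) isClosed_Icc
  exact ⟨h, isCompact_Icc.of_isClosed_subset (isClosed_tsupport _) hsub,
    fun r hr => ha.trans_le (hsub hr).1⟩

theorem integrable (h : IsRealTest ψ) : Integrable ψ :=
  h.contDiff.continuous.integrable_of_hasCompactSupport h.hasCompactSupport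

theorem setIntegral_mul (h : IsRealTest ψ) (f : ℝ → ℝ) :
    ∫ r in Ioi (0 : ℝ), f r * ψ r = ∫ r, f r * ψ r := by
  refine setIntegral_eq_integral_of_forall_compl_eq_zero fun r hr => ?_
  have : ψ r = 0 := by
    by_contra hne
    exact hr (h.tsupport_subset (subset_tsupport ψ hne))
  rw [this, mul_zero]

theorem integrableOn_mul (h : IsRealTest ψ) {f : ℝ → ℝ} (hf : LocallyIntegrableOn f (Ioi 0)) :
    IntegrableOn (fun r => f r * ψ r) (Ioi 0) := by
  have h1 := hf.integrableOn_compact_subset h.tsupport_subset h.hasCompactSupport.isCompact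
  have h2 := h1.mul_continuousOn h.contDiff.continuous.continuousOn h.hasCompactSupport.isCompact
  rw [integrableOn_iff_integrable_of_support_subset] at h2
  · exact h2.integrableOn
  · intro x hx
    exact subset_tsupport _ (right_ne_zero_of_mul hx)

/-- A test function of vanishing integral is the derivative of a test function. -/
theorem exists_primitive (h : IsRealTest φ) (h0 : ∫ r, φ r = 0) :
    ∃ ψ, IsRealTest ψ ∧ deriv ψ = φ := by
  obtain ⟨a, b, ha, hab, hz⟩ := h.exists_bounds
  have hc := h.contDiff.continuous
  have hd : deriv (fun r => ∫ x in (0 : ℝ)..r, φ x) = φ := funext fun r =>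
    hc.deriv_integral φ 0 r
  have hsub : Function.support φ ⊆ Icc a b := fun r hr => by
    by_contra hne
    exact hr (hz r hne)
  refine ⟨fun r => ∫ x in (0 : ℝ)..r, φ x, of_bounds ?_ ha (b := b) fun r hr => ?_, hd⟩
  · rw [contDiff_infty_iff_deriv, hd]
    exact ⟨fun r => (hc.integral_hasStrictDerivAt 0 r).hasDerivAt.differentiableAt, h.contDiff⟩
  · rw [mem_Icc, not_and_or, not_le, not_le] at hr
    rcases hr with hr | hr
    · refine intervalIntegral.integral_zero_ae (Eventually.of_forall fun x hx => hz x fun hx' => ?_)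
      rw [uIoc, mem_Ioc] at hx
      have := hx.2
      rcases le_max_iff.1 this with h1 | h1 <;> linarith [hx'.1]
    · rw [intervalIntegral.integral_eq_integral_of_support_subset, h0]
      intro x hx
      have := hsub hx
      exact ⟨ha.trans_le this.1, this.2.trans hr.le⟩

/-- The du Bois-Reymond argument: `φ - (∫ φ) η` has integral zero, hence is the derivative of a test
function and is annihilated by `f`. -/
theorem integral_mul_eq_of_forall_integral_mul_deriv (hφ : IsRealTest φ) (hη : IsRealTest η)
    (hη1 : ∫ r, η r = 1) {f : ℝ → ℝ} (hf : LocallyIntegrableOn f (Ioi 0))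
    (h0 : ∀ ψ, IsRealTest ψ → ∫ r in Ioi (0 : ℝ), f r * deriv ψ r = 0) :
    ∫ r in Ioi (0 : ℝ), f r * φ r = (∫ r, φ r) * ∫ r in Ioi (0 : ℝ), f r * η r := by
  set c := ∫ r, φ r with hc
  have hdiff : IsRealTest fun r => φ r - c * η r := by
    obtain ⟨a, b, ha, -, hab⟩ := hφ.exists_bounds
    obtain ⟨a', b', ha', -, hab'⟩ := hη.exists_bounds
    refine of_bounds (hφ.contDiff.sub (contDiff_const.mul hη.contDiff)) (lt_min ha ha')
      (b := max b b') fun r hr => ?_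
    rw [hab r, hab' r, mul_zero, sub_zero]
    · exact fun h => hr ⟨(min_le_right _ _).trans h.1, h.2.trans (le_max_right _ _)⟩
    · exact fun h => hr ⟨(min_le_left _ _).trans h.1, h.2.trans (le_max_left _ _)⟩
  have hz : ∫ r, (φ r - c * η r) = 0 := by
    rw [integral_sub hφ.integrable (hη.integrable.const_mul c), integral_const_mul, hη1, ← hc]
    ring
  obtain ⟨ψ, hψ, hd⟩ := hdiff.exists_primitive hz
  have h1 := h0 ψ hψ
  rw [hd] at h1
  have h2 : ∀ r, f r * (φ r - c * η r) = f r * φ r - c * (f r * η r) := fun r => by ring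
  simp only [h2] at h1
  rw [integral_sub (hφ.integrableOn_mul hf) ((hη.integrableOn_mul hf).const_mul c),
    integral_const_mul] at h1
  linarith

theorem exists_integral_eq_one : ∃ η, IsRealTest η ∧ ∫ r, η r = 1 := by
  let χ : ContDiffBump (2 : ℝ) := ⟨1 / 4, 1 / 2, by norm_num, by norm_num⟩
  refine ⟨χ.normed volume, of_bounds χ.contDiff_normed (a := 1) (b := 3) one_pos fun r hr => ?_,
    χ.integral_normed⟩
  by_contra hne
  have : r ∈ Function.support (χ.normed volume) := hne
  rw [χ.support_normed_eq, Metric.mem_ball, Real.dist_eq, abs_lt] at this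
  refine hr ⟨?_, ?_⟩ <;> norm_num [χ] at this <;> linarith

/-- The factor `l⁻¹` preserves the integral; as `l → 0` the mass concentrates at `r = 0`. -/
theorem dilate (h : IsRealTest ψ) {l : ℝ} (hl : 0 < l) : IsRealTest fun r => l⁻¹ * ψ (l⁻¹ * r) := by
  obtain ⟨a, b, ha, hab, hz⟩ := h.exists_bounds
  refine of_bounds (contDiff_const.mul (h.contDiff.comp (contDiff_const.mul contDiff_id)))
    (mul_pos hl ha) (b := l * b) fun r hr => ?_
  rw [hz, mul_zero]
  exact fun hr' => hr ⟨(le_inv_mul_iff₀ hl).1 hr'.1, (inv_mul_le_iff₀ hl).1 hr'.2⟩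

theorem integral_dilate {l : ℝ} (hl : 0 < l) (f : ℝ → ℝ) :
    ∫ r, f r * (l⁻¹ * ψ (l⁻¹ * r)) = ∫ r, f (l * r) * ψ r := by
  have h1 := Measure.integral_comp_mul_left (fun r => f (l * r) * ψ r) l⁻¹
  rw [inv_inv, abs_of_pos hl, smul_eq_mul] at h1
  have h2 : ∀ r, f (l * (l⁻¹ * r)) = f r := fun r => by rw [mul_inv_cancel_left₀ hl.ne']
  simp only [h2] at h1
  have h3 : ∀ r, f r * (l⁻¹ * ψ (l⁻¹ * r)) = l⁻¹ * (f r * ψ (l⁻¹ * r)) := fun r => by ring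
  simp only [h3]
  rw [integral_const_mul, h1, inv_mul_cancel_left₀ hl.ne']

end IsRealTest

/-! ### Concentrating test functions -/

/-- As a function on `ℝ³` the dilated test function is `l⁻²` times the original at `x/l`; the
Jacobian `l³` leaves one factor `l`. -/
theorem fourierInv_radialTest_dilate {ψ : ℝ → ℝ} (h : IsRealTest ψ) {l : ℝ} (hl : 0 < l) (ξ : E3) :
    (𝓕⁻ (radialTest _ (h.dilate hl).ofReal)) ξ = (l : ℂ) * (𝓕⁻ (radialTest _ h.ofReal)) (l • ξ) := by
  have hlc : (l : ℂ) ≠ 0 := by exact_mod_cast hl.ne'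
  rw [fourierInv_apply_eq_neg, fourierInv_apply_eq_neg, fourier_radialTest, fourier_radialTest]
  have h1 := Measure.integral_comp_smul (volume : Measure E3) (fun y : E3 =>
    Complex.exp (↑(-2 * Real.pi * inner ℝ y (-(l • ξ))) * Complex.I) •
      radialFun (fun r => (ψ r : ℂ)) y) l⁻¹
  rw [finrank_euclideanSpace_fin, abs_of_pos (by positivity), inv_pow, inv_inv, Complex.real_smul] at h1
  have h2 : ∀ x : E3, Complex.exp (↑(-2 * Real.pi * inner ℝ x (-ξ)) * Complex.I) •
      radialFun (fun r => ((l⁻¹ * ψ (l⁻¹ * r) : ℝ) : ℂ)) x = ((l ^ 2 : ℝ) : ℂ)⁻¹ *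
      (Complex.exp (↑(-2 * Real.pi * inner ℝ (l⁻¹ • x) (-(l • ξ))) * Complex.I) •
      radialFun (fun r => (ψ r : ℂ)) (l⁻¹ • x)) := fun x => by
    have h3 : inner ℝ (l⁻¹ • x) (-(l • ξ)) = inner ℝ x (-ξ) := by
      rw [← smul_neg, inner_smul_left, inner_smul_right]
      simp [hl.ne']
    rw [h3, smul_eq_mul, smul_eq_mul]
    simp only [radialFun, norm_smul, norm_inv, Real.norm_of_nonneg hl.le]
    rcases eq_or_ne x 0 with rfl | hx
    · simp
    · have hx' : (‖x‖ : ℂ) ≠ 0 := by exact_mod_cast (norm_ne_zero_iff.2 hx)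
      have hpi : (Real.pi : ℂ) ≠ 0 := by exact_mod_cast Real.pi_ne_zero
      push_cast
      field_simp
  simp only [h2]
  rw [integral_const_mul, h1, ← mul_assoc]
  congr 1
  push_cast
  field_simp

theorem eLpNorm_comp_smul (G : E3 → ℂ) {l : ℝ} (hl : 0 < l) :
    eLpNorm (fun ξ => G (l • ξ)) 2 volume
      = ENNReal.ofReal ((l ^ 3)⁻¹) ^ (1 / 2 : ℝ) * eLpNorm G 2 volume := by
  have h1 := (Homeomorph.smulOfNeZero l hl.ne' (α := E3)).measurableEmbedding.eLpNorm_map_measure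
    (g := G) (p := 2) (μ := volume)
  have h2 := Measure.map_addHaar_smul (volume : Measure E3) hl.ne'
  rw [finrank_euclideanSpace_fin, abs_of_pos (by positivity)] at h2
  have h3 : Measure.map (Homeomorph.smulOfNeZero l hl.ne' (α := E3)) volume
    = ENNReal.ofReal ((l ^ 3)⁻¹) • (volume : Measure E3) := h2
  rw [h3, eLpNorm_smul_measure_of_ne_top (by simp)] at h1
  rw [smul_eq_mul] at h1
  simpa [Function.comp_def] using h1.symm

/-- The dilated test function has `Ḣ⁻ˢ` norm of order `l^{1+s-3/2} = l^{s-1/2}`, which vanishes with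
`l` exactly because `s > 1/2`. Against `1/|x|` the pairings would all equal `∫ ψ`. -/
theorem tendsto_apply_radialTest_dilate {s : ℝ} (hs : 1 / 2 < s) (hs1 : s ≤ 1) (D : HomSobolev s)
    {ψ : ℝ → ℝ} (h : IsRealTest ψ) :
    Tendsto (fun n : ℕ => D.toDistribution
      (radialTest _ (h.dilate (inv_pos.2 (n.cast_add_one_pos (α := ℝ)))).ofReal)) atTop (𝓝 0) := by
  set G : E3 → ℂ := fun ξ => ((‖ξ‖ ^ (-s) : ℝ) : ℂ) * (𝓕⁻ (radialTest _ h.ofReal)) ξ with hG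
  have hle : ∀ l : ℝ, ∀ hl : 0 < l, ‖D.toDistribution (radialTest _ (h.dilate hl).ofReal)‖
      ≤ l ^ (s - 1 / 2) * ((eLpNorm G 2 volume).toReal * ‖D‖) := by
    intro l hl
    have h1 := D.norm_integral_mul_fourierFun_le (m := fun _ => 1)
      (memLp_rpow_mul (a := -s) (by linarith) (by linarith)
        (𝓕⁻ (radialTest _ (h.dilate hl).ofReal))) (by simp)
    simp only [one_mul] at h1
    rw [D.toDistribution_apply]
    refine h1.trans (le_of_eq ?_)
    have h2 : (fun ξ => ((‖ξ‖ ^ (-s) : ℝ) : ℂ) * (𝓕⁻ (radialTest _ (h.dilate hl).ofReal)) ξ)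
        = ((l ^ (1 + s) : ℝ) : ℂ) • fun ξ => G (l • ξ) := by
      ext ξ
      rw [fourierInv_radialTest_dilate h hl, Pi.smul_apply, hG, smul_eq_mul]
      simp only [norm_smul, Real.norm_of_nonneg hl.le]
      rw [Real.mul_rpow hl.le (norm_nonneg _), Real.rpow_add hl, Real.rpow_one]
      have : ((l ^ s : ℝ) : ℂ) * ((l ^ (-s) : ℝ) : ℂ) = 1 := by
        rw [← Complex.ofReal_mul, ← Real.rpow_add hl]
        simp
      push_cast
      linear_combination (-(l : ℂ) * ((‖ξ‖ ^ (-s) : ℝ) : ℂ) * (𝓕⁻ (radialTest _ h.ofReal)) (l • ξ)) * this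
    rw [h2, eLpNorm_const_smul, eLpNorm_comp_smul G hl, ENNReal.toReal_mul, ENNReal.toReal_mul,
      ← ENNReal.toReal_rpow, ENNReal.toReal_ofReal (by positivity)]
    have h3 : ‖((l ^ (1 + s) : ℝ) : ℂ)‖ₑ.toReal = l ^ (1 + s) := by
      rw [toReal_enorm, Complex.norm_real, Real.norm_of_nonneg (by positivity)]
    have h4 : ((l ^ 3)⁻¹ : ℝ) ^ (1 / 2 : ℝ) = l ^ (-(3 / 2) : ℝ) := by
      rw [← Real.rpow_natCast, ← Real.rpow_neg hl.le, ← Real.rpow_mul hl.le]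
      norm_num
    have h5 : l ^ (s - 1 / 2) = l ^ (1 + s) * l ^ (-(3 / 2) : ℝ) := by
      rw [← Real.rpow_add hl]
      congr 1
      ring
    rw [h3, h4, h5]
    ring
  refine squeeze_zero_norm (fun n => hle _ (inv_pos.2 (n.cast_add_one_pos (α := ℝ)))) ?_
  have h5 : Tendsto (fun n : ℕ => ((n : ℝ) + 1)⁻¹) atTop (𝓝 0) := by
    simpa using tendsto_one_div_add_atTop_nhds_zero_nat (𝕜 := ℝ)
  have h6 := h5.rpow_const (p := s - 1 / 2) (Or.inr (by linarith))
  rw [Real.zero_rpow (by linarith)] at h6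
  simpa using h6.mul_const ((eLpNorm G 2 volume).toReal * ‖D‖)

end RadialWave
end

noncomputable section

namespace RadialWave


/-! ### The solution as a primitive of its radial derivative -/

/-- The primitive `∫₀ʳ ∂_r w`. -/
def radialPrimitive (F : ℝ → ℝ → ℝ) (r t : ℝ) : ℝ :=
  ∫ x in (0 : ℝ)..r, (Ioi (0 : ℝ)).indicator (fun x => radialDeriv F x t) x

namespace IsCompactRadialSolution

variable {s β C₀ : ℝ} {F u : ℝ → ℝ → ℝ} {U : ℝ → HomSobolev s × HomSobolev (s - 1)}

theorem measurable_indicator_radialDeriv (h : IsCompactRadialSolution s β C₀ F u U) (t : ℝ) :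
    Measurable ((Ioi (0 : ℝ)).indicator fun x => radialDeriv F x t) :=
  (h.measurable_radialDeriv t).indicator measurableSet_Ioi

/-- The singularity `r^{-β}` is integrable at the origin since `β < 1`, that is, `p > 3`; hence the
primitive may start at `0`. -/
theorem locallyIntegrable_indicator_radialDeriv (h : IsCompactRadialSolution s β C₀ F u U) (t : ℝ) :
    LocallyIntegrable ((Ioi (0 : ℝ)).indicator fun x => radialDeriv F x t) := by
  refine locallyIntegrable_of_norm_le_rpow (C := C₀ / β) (α := β) (by simp) (by simpa using h.lt_one)
    (Eventually.of_forall fun x => ?_) (h.measurable_indicator_radialDeriv t).aestronglyMeasurable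
  by_cases hx : x ∈ Ioi (0 : ℝ)
  · rw [indicator_of_mem hx, Real.norm_of_nonneg (mem_Ioi.1 hx).le]
    exact h.abs_radialDeriv_le t hx
  · rw [indicator_of_notMem hx, norm_zero]
    exact mul_nonneg h.const_nonneg (Real.rpow_nonneg (norm_nonneg _) _)

theorem intervalIntegrable_indicator_radialDeriv (h : IsCompactRadialSolution s β C₀ F u U)
    (t a b : ℝ) :
    IntervalIntegrable ((Ioi (0 : ℝ)).indicator fun x => radialDeriv F x t) volume a b :=
  ((h.locallyIntegrable_indicator_radialDeriv t).integrableOn_isCompact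
    isCompact_uIcc).intervalIntegrable

theorem continuous_radialPrimitive (h : IsCompactRadialSolution s β C₀ F u U) (t : ℝ) :
    Continuous fun r => radialPrimitive F r t :=
  intervalIntegral.continuous_primitive (h.intervalIntegrable_indicator_radialDeriv t) 0

theorem abs_radialPrimitive_le (h : IsCompactRadialSolution s β C₀ F u U) (t : ℝ) {r : ℝ}
    (hr : 0 < r) : |radialPrimitive F r t| ≤ C₀ / β / (1 - β) * r ^ (1 - β) := by
  have hi : IntervalIntegrable (fun x : ℝ => C₀ / β * x ^ (-β)) volume 0 r :=
    (intervalIntegral.intervalIntegrable_rpow' (by linarith [h.lt_one])).const_mul _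
  have h1 := intervalIntegral.norm_integral_le_of_norm_le hr.le
    (f := (Ioi (0 : ℝ)).indicator fun x => radialDeriv F x t)
    (g := fun x : ℝ => C₀ / β * x ^ (-β)) (μ := volume)
    (Eventually.of_forall fun x hx => ?_) hi
  · rw [intervalIntegral.integral_const_mul, integral_rpow (Or.inl (by linarith [h.lt_one])),
      show -β + 1 = 1 - β by ring, Real.zero_rpow (by linarith [h.lt_one]), sub_zero] at h1
    refine h1.trans_eq ?_
    ring
  · rw [indicator_of_mem (show x ∈ Ioi (0 : ℝ) from hx.1)]
    exact h.abs_radialDeriv_le t hx.1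

theorem integral_radialPrimitive_mul_deriv (h : IsCompactRadialSolution s β C₀ F u U) (t : ℝ)
    {ψ : ℝ → ℝ} (hψ : IsRealTest ψ) :
    ∫ r in Ioi (0 : ℝ), radialPrimitive F r t * deriv ψ r
      = -∫ r in Ioi (0 : ℝ), radialDeriv F r t * ψ r := by
  obtain ⟨a, b, ha, hab, hz⟩ := hψ.exists_bounds
  -- The endpoint `b + 1` lies outside the interval `[a, b]` carrying `ψ`, so the boundary term
  -- vanishes there.
  have hb1 : 0 ≤ b + 1 := by linarith
  have hz' : ∀ r, r ∉ Icc a b → deriv ψ r = 0 := fun r hr => by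
    have : tsupport ψ ⊆ Icc a b :=
      closure_minimal (fun ρ hρ => by by_contra hne; exact hρ (hz ρ hne)) isClosed_Icc
    exact image_eq_zero_of_notMem_tsupport fun h0 =>
      hr (this (tsupport_deriv_subset (𝕜 := ℝ) h0))
  have hset : ∀ f : ℝ → ℝ, (∀ r, r ∉ Icc a b → f r = 0) →
      ∫ r in Ioi (0 : ℝ), f r = ∫ r in (0 : ℝ)..(b + 1), f r := fun f hf => by
    rw [intervalIntegral.integral_of_le hb1]
    refine setIntegral_eq_of_subset_of_forall_sdiff_eq_zero measurableSet_Ioi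
      (fun r hr => hr.1) fun r hr => hf r fun hr' => hr.2 ⟨hr.1, by linarith [hr'.2]⟩
  rw [hset _ fun r hr => by rw [hz' r hr, mul_zero], hset _ fun r hr => by rw [hz r hr, mul_zero]]
  have hi := h.intervalIntegrable_indicator_radialDeriv t 0 (b + 1)
  have hac : AbsolutelyContinuousOnInterval (fun r => radialPrimitive F r t) 0 (b + 1) :=
    hi.absolutelyContinuousOnInterval_intervalIntegral (by simp)
  have hψac : AbsolutelyContinuousOnInterval ψ 0 (b + 1) :=
    (hψ.contDiff.of_le (by simp)).contDiffOn.absolutelyContinuousOnInterval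
  rw [hac.integral_mul_deriv_eq_deriv_mul hψac, hz (b + 1) fun h => by linarith [h.2],
    hz 0 fun h => by linarith [h.1], mul_zero, mul_zero, sub_zero, zero_sub]
  congr 1
  refine intervalIntegral.integral_congr_ae ?_
  filter_upwards [hi.ae_hasDerivAt_integral] with r hr hmem
  have h1 : HasDerivAt (fun r => radialPrimitive F r t) _ r :=
    hr (uIoc_subset_uIcc hmem) 0 (by simp)
  rw [uIoc_of_le hb1] at hmem
  rw [h1.deriv, indicator_of_mem (show r ∈ Ioi (0 : ℝ) from hmem.1)]

/-- `r u = ∫₀ʳ ∂_r w`: the constant of integration vanishes, since `1/|x|` is too singular for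
`Ḣˢ`, `s > 1/2`. -/
theorem mul_ae_eq_radialPrimitive (h : IsCompactRadialSolution s β C₀ F u U) (t : ℝ) :
    ∀ᵐ r : ℝ, r ∈ Ioi (0 : ℝ) → r * u r t = radialPrimitive F r t := by
  have hWl : LocallyIntegrableOn (fun r => radialPrimitive F r t) (Ioi 0) :=
    (h.continuous_radialPrimitive t).locallyIntegrable.locallyIntegrableOn _
  have hwl := h.locallyIntegrableOn_mul t
  set f : ℝ → ℝ := fun r => r * u r t - radialPrimitive F r t with hf
  have hfl : LocallyIntegrableOn f (Ioi 0) := hwl.sub hWl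
  have hsplit : ∀ φ, IsRealTest φ → ∫ r in Ioi (0 : ℝ), f r * φ r
      = (∫ r in Ioi (0 : ℝ), r * u r t * φ r) - ∫ r in Ioi (0 : ℝ), radialPrimitive F r t * φ r := by
    intro φ hφ
    rw [← integral_sub (hφ.integrableOn_mul hwl) (hφ.integrableOn_mul hWl)]
    simp only [hf, sub_mul]
  have h0 : ∀ ψ, IsRealTest ψ → ∫ r in Ioi (0 : ℝ), f r * deriv ψ r = 0 := by
    intro ψ hψ
    have hψ' : IsRealTest (deriv ψ) :=
      ⟨(contDiff_infty_iff_deriv.1 hψ.contDiff).2, hψ.hasCompactSupport.deriv,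
        (tsupport_deriv_subset (𝕜 := ℝ)).trans hψ.tsupport_subset⟩
    rw [hsplit _ hψ', h.integral_radialPrimitive_mul_deriv t hψ,
      (h.isWeakDeriv t).2.2 ψ hψ.contDiff hψ.hasCompactSupport hψ.tsupport_subset, sub_self]
  obtain ⟨η, hη, hη1⟩ := IsRealTest.exists_integral_eq_one
  have hpos : ∀ n : ℕ, (0 : ℝ) < ((n : ℝ) + 1)⁻¹ := fun n => inv_pos.2 (n.cast_add_one_pos (α := ℝ))
  -- The difference `f` is weakly constant, and its value is read off from any test function of
  -- integral one, in particular from all dilates of `η`. Along them the part from `r u` tends to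
  -- zero by Sobolev duality, and the part from the primitive by its continuity and its zero at `r =
  -- 0`.
  have hconst : ∀ n : ℕ, ∫ r in Ioi (0 : ℝ), f r * η r
      = (∫ r in Ioi (0 : ℝ), r * u r t * (((n : ℝ) + 1)⁻¹⁻¹ * η (((n : ℝ) + 1)⁻¹⁻¹ * r)))
        - ∫ r, radialPrimitive F (((n : ℝ) + 1)⁻¹ * r) t * η r := by
    intro n
    have h1 := (hη.dilate (hpos n)).integral_mul_eq_of_forall_integral_mul_deriv hη hη1 hfl h0
    have h2 : ∫ r, ((n : ℝ) + 1)⁻¹⁻¹ * η (((n : ℝ) + 1)⁻¹⁻¹ * r) = 1 := by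
      have := IsRealTest.integral_dilate (ψ := η) (hpos n) fun _ => 1
      simpa only [one_mul, hη1] using this
    rw [h2, one_mul] at h1
    rw [← h1, hsplit _ (hη.dilate (hpos n)), (hη.dilate (hpos n)).setIntegral_mul
      (fun r => radialPrimitive F r t), IsRealTest.integral_dilate (hpos n)]
  have hlim1 : Tendsto (fun n : ℕ => ∫ r in Ioi (0 : ℝ), r * u r t *
      (((n : ℝ) + 1)⁻¹⁻¹ * η (((n : ℝ) + 1)⁻¹⁻¹ * r))) atTop (𝓝 0) := by
    have h1 := tendsto_apply_radialTest_dilate (by linarith [h.s_eq, h.lt_one]) h.s_lt_one.le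
      (U t).1 hη
    simp only [h.fst_radialTest, ← Complex.ofReal_mul, integral_complex_ofReal] at h1
    simpa [Function.comp_def] using (Complex.continuous_re.tendsto 0).comp h1
  have hlim2 : Tendsto (fun n : ℕ => ∫ r, radialPrimitive F (((n : ℝ) + 1)⁻¹ * r) t * η r)
      atTop (𝓝 0) := by
    obtain ⟨a, b, ha, hab, hz⟩ := hη.exists_bounds
    have h1 : Continuous fun l : ℝ => ∫ r in a..b, radialPrimitive F (l * r) t * η r :=
      intervalIntegral.continuous_parametric_intervalIntegral_of_continuous'
        (((h.continuous_radialPrimitive t).comp (continuous_fst.mul continuous_snd)).mul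
          (hη.contDiff.continuous.comp continuous_snd)) a b
    have h2 : Tendsto (fun n : ℕ => ((n : ℝ) + 1)⁻¹) atTop (𝓝 0) := by
      simpa using tendsto_one_div_add_atTop_nhds_zero_nat (𝕜 := ℝ)
    have h3 := (h1.tendsto 0).comp h2
    simp only [zero_mul, radialPrimitive, intervalIntegral.integral_same,
      intervalIntegral.integral_zero] at h3
    refine h3.congr fun n => ?_
    simp only [Function.comp_apply]
    rw [intervalIntegral.integral_of_le hab.le, ← integral_Icc_eq_integral_Ioc]
    exact setIntegral_eq_integral_of_forall_compl_eq_zero fun r hr => by rw [hz r hr, mul_zero]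
  have hc : ∫ r in Ioi (0 : ℝ), f r * η r = 0 := by
    have := hlim1.sub hlim2
    simp only [← hconst, sub_zero] at this
    exact tendsto_nhds_unique tendsto_const_nhds this
  have key := isOpen_Ioi.ae_eq_zero_of_integral_contDiff_smul_eq_zero (U := Ioi (0 : ℝ))
    (μ := volume) hfl fun χ h1 h2 h3 => ?_
  · filter_upwards [key] with r hr hpos
    exact sub_eq_zero.1 (hr hpos)
  · have hχ : IsRealTest χ := ⟨h1, h2, h3⟩
    have h4 := hχ.integral_mul_eq_of_forall_integral_mul_deriv hη hη1 hfl h0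
    rw [hc, mul_zero, hχ.setIntegral_mul] at h4
    simpa only [smul_eq_mul, mul_comm] using h4

end IsCompactRadialSolution

end RadialWave
end

noncomputable section

namespace RadialWave


/-! ### Radial functions on the exterior of a ball -/

theorem lintegral_fun_norm {f : ℝ → ℝ≥0∞} (hf : Measurable f) :
    ∫⁻ x : E3, f ‖x‖ = sphereMeasure univ *
      ∫⁻ r in Ioi (0 : ℝ), ENNReal.ofReal (r ^ 2) * f r := by
  have hmp := (volume : Measure E3).measurePreserving_homeomorphUnitSphereProd
  rw [finrank_E3_sub_one] at hmp
  have h1 : ∫⁻ x : E3, f ‖x‖ = ∫⁻ x : ({(0)}ᶜ : Set E3), f ‖(x : E3)‖ ∂(volume.comap Subtype.val) := by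
    rw [lintegral_subtype_comap (measurableSet_singleton _).compl (fun x : E3 => f ‖x‖),
      restrict_compl_singleton]
  have h2 := hmp.lintegral_comp_emb (Homeomorph.measurableEmbedding _)
    (fun q : Metric.sphere (0 : E3) 1 × Ioi (0 : ℝ) => f q.2)
  have hfm : Measurable fun r : Ioi (0 : ℝ) => f r := hf.comp measurable_subtype_coe
  have hfm2 : Measurable fun q : Metric.sphere (0 : E3) 1 × Ioi (0 : ℝ) => f q.2 :=
    hfm.comp measurable_snd
  rw [lintegral_prod _ hfm2.aemeasurable] at h2
  simp only [homeomorphUnitSphereProd_apply_snd_coe, lintegral_const] at h2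
  rw [h1, h2, mul_comm]
  congr 1
  rw [Measure.volumeIoiPow, lintegral_withDensity_eq_lintegral_mul _ (by fun_prop) hfm]
  exact lintegral_subtype_comap measurableSet_Ioi fun r : ℝ => ENNReal.ofReal (r ^ 2) * f r

/-- By polar coordinates the preimage under the norm of a null set of radii is null. The measurable
hull is used because the exceptional set need not be measurable. -/
theorem ae_norm_of_ae {P : ℝ → Prop} (h : ∀ᵐ r : ℝ, r ∈ Ioi (0 : ℝ) → P r) :
    ∀ᵐ x : E3, x ≠ 0 → P ‖x‖ := by
  set M := toMeasurable volume {r : ℝ | ¬(r ∈ Ioi (0 : ℝ) → P r)} with hM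
  have hM0 : volume M = 0 := by rw [hM, measure_toMeasurable]; exact h
  have hMm : MeasurableSet M := measurableSet_toMeasurable _ _
  have h1 := lintegral_fun_norm (f := M.indicator fun _ => 1) (measurable_const.indicator hMm)
  have h2 : ∫⁻ r in Ioi (0 : ℝ), ENNReal.ofReal (r ^ 2) * M.indicator (fun _ => 1) r = 0 := by
    refine (lintegral_congr_ae ?_).trans lintegral_zero
    refine ae_restrict_of_ae ?_
    filter_upwards [measure_eq_zero_iff_ae_notMem.1 hM0] with r hr
    rw [indicator_of_notMem hr, mul_zero]
  have h3 : Measurable fun x : E3 => M.indicator (fun _ => (1 : ℝ≥0∞)) ‖x‖ :=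
    (measurable_const.indicator hMm).comp measurable_norm
  rw [h2, mul_zero, lintegral_eq_zero_iff h3] at h1
  filter_upwards [h1] with x hx hx0
  by_contra hP
  have hmem : ‖x‖ ∈ M := subset_toMeasurable _ _ fun hh => hP (hh (norm_pos_iff.2 hx0))
  simp [hmem] at hx

theorem eLpNorm_two_eq {α G : Type*} [MeasurableSpace α] [NormedAddCommGroup G] {μ : Measure α}
    (f : α → G) : eLpNorm f 2 μ = (∫⁻ a, ‖f a‖ₑ ^ (2 : ℝ) ∂μ) ^ (1 / 2 : ℝ) := by
  rw [eLpNorm_eq_lintegral_rpow_enorm_toReal (by simp) (by simp)]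
  simp

/-- The `L²` norm of `g(|x|)/|x|` outside a ball. -/
theorem eLpNorm_radial_div {g : ℝ → ℝ} (hg : Measurable g) {R : ℝ} (hR : 0 < R) :
    eLpNorm (fun x : E3 => g ‖x‖ / ‖x‖) 2 (volume.restrict (Metric.ball 0 R)ᶜ)
      = sphereMeasure univ ^ (1 / 2 : ℝ) * eLpNorm g 2 (volume.restrict (Ici R)) := by
  rw [eLpNorm_two_eq, eLpNorm_two_eq, ← ENNReal.mul_rpow_of_nonneg _ _ (by norm_num)]
  congr 1
  have h1 := lintegral_fun_norm (f := (Ici R).indicator fun r => ‖g r / r‖ₑ ^ (2 : ℝ))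
    ((((hg.div measurable_id).enorm).pow_const _).indicator measurableSet_Ici)
  have h2 : ∀ x : E3, (Ici R).indicator (fun r => ‖g r / r‖ₑ ^ (2 : ℝ)) ‖x‖
      = (Metric.ball (0 : E3) R)ᶜ.indicator (fun x => ‖g ‖x‖ / ‖x‖‖ₑ ^ (2 : ℝ)) x := fun x => by
    simp [indicator]
  simp only [h2] at h1
  rw [lintegral_indicator measurableSet_ball.compl] at h1
  rw [h1]
  congr 1
  have h3 : ∀ r : ℝ, ENNReal.ofReal (r ^ 2) * (Ici R).indicator (fun r => ‖g r / r‖ₑ ^ (2 : ℝ)) r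
      = (Ici R).indicator (fun r => ‖g r‖ₑ ^ (2 : ℝ)) r := fun r => by
    by_cases hr : r ∈ Ici R
    · have hr0 : 0 < r := hR.trans_le hr
      rw [indicator_of_mem hr, indicator_of_mem hr]
      rw [← Real.enorm_eq_ofReal (sq_nonneg r), ENNReal.rpow_two, ENNReal.rpow_two, ← enorm_pow,
        ← enorm_mul, ← enorm_pow]
      congr 1
      field_simp
    · rw [indicator_of_notMem hr, indicator_of_notMem hr, mul_zero]
  simp only [h3]
  rw [lintegral_indicator measurableSet_Ici, Measure.restrict_restrict measurableSet_Ici]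
  congr 2
  exact inter_eq_left.2 fun r hr => hR.trans_le hr

theorem ContinuousInL2.radial {g : ℝ → ℝ → ℝ} (hg : ∀ t, Measurable (g t)) {R : ℝ} (hR : 0 < R)
    (h : ContinuousInL2 (volume.restrict (Ici R)) g) :
    ContinuousInL2 (volume.restrict (Metric.ball (0 : E3) R)ᶜ) fun t x => g t ‖x‖ / ‖x‖ := by
  have hfin : sphereMeasure univ ^ (1 / 2 : ℝ) ≠ ⊤ :=
    (ENNReal.rpow_lt_top_of_nonneg (by norm_num) (measure_ne_top _ _)).ne
  refine ⟨fun t => ⟨(((hg t).comp measurable_norm).div measurable_norm).aestronglyMeasurable, ?_⟩,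
    fun t₀ => ?_⟩
  · rw [eLpNorm_radial_div (hg t) hR]
    exact ENNReal.mul_lt_top hfin.lt_top (h.1 t).2
  · have h1 := ENNReal.Tendsto.const_mul (h.2 t₀) (Or.inr hfin)
    rw [mul_zero] at h1
    refine h1.congr fun t => ?_
    have h2 := eLpNorm_radial_div (g := fun r => g t r - g t₀ r) ((hg t).sub (hg t₀)) hR
    rw [← h2]
    simp only [sub_div]

theorem ContinuousInL2.radial_vector {g : ℝ → ℝ → ℝ} (hg : ∀ t, Measurable (g t)) {R : ℝ}
    (hR : 0 < R) (h : ContinuousInL2 (volume.restrict (Ici R)) g) :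
    ContinuousInL2 (volume.restrict (Metric.ball (0 : E3) R)ᶜ)
      fun t x => (g t ‖x‖ / ‖x‖) • (‖x‖⁻¹ • x) := by
  have h1 := h.radial hg hR
  have hnorm : ∀ c : E3 → ℝ, ∀ᵐ x ∂(volume.restrict (Metric.ball (0 : E3) R)ᶜ),
      ‖c x • (‖x‖⁻¹ • x)‖ = ‖c x‖ := fun c => by
    filter_upwards [ae_restrict_mem measurableSet_ball.compl] with x hx
    have hx0 : ‖x‖ ≠ 0 := by
      have : R ≤ ‖x‖ := by simpa using hx
      linarith
    rw [norm_smul, norm_smul, norm_inv, norm_norm, inv_mul_cancel₀ hx0, mul_one]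
  refine ⟨fun t => ?_, fun t₀ => ?_⟩
  · refine (h1.1 t).of_le ?_ ((hnorm _).mono fun x hx => hx.le)
    exact ((((hg t).comp measurable_norm).div measurable_norm).smul
      (measurable_norm.inv.smul measurable_id)).aestronglyMeasurable
  · refine (h1.2 t₀).congr fun t => ?_
    refine eLpNorm_congr_norm_ae ?_
    filter_upwards [hnorm fun x => g t ‖x‖ / ‖x‖ - g t₀ ‖x‖ / ‖x‖] with x hx
    rw [← hx, sub_smul]

theorem locallyIntegrableOn_compl_zero_of_le_rpow {H : Type*} [NormedAddCommGroup H] {f : E3 → H}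
    (hf : AEStronglyMeasurable f volume) {K a : ℝ} (hle : ∀ x ≠ 0, ‖f x‖ ≤ K * ‖x‖ ^ a) :
    LocallyIntegrableOn f {0}ᶜ := by
  have h1 : LocallyIntegrableOn (fun x : E3 => K * ‖x‖ ^ a) {0}ᶜ := by
    refine ContinuousOn.locallyIntegrableOn ?_ (measurableSet_singleton _).compl
    exact continuousOn_const.mul
      (continuous_norm.continuousOn.rpow_const fun x hx => Or.inl (norm_ne_zero_iff.2 hx))
  rw [locallyIntegrableOn_iff isOpen_compl_singleton.isLocallyClosed] at h1 ⊢
  intro k hk hkc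
  refine (h1 k hk hkc).mono' hf.restrict ?_
  filter_upwards [ae_restrict_mem hkc.measurableSet] with x hx
  exact hle x (hk hx)

/-- In polar coordinates the sixth power becomes `r^{2-6β}`, integrable at infinity because `6β >
3`. -/
theorem memLp_norm_rpow {β : ℝ} (hβ : 1 / 2 < β) {R : ℝ} (hR : 0 < R) :
    MemLp (fun x : E3 => ‖x‖ ^ (-β)) 6 (volume.restrict (Metric.ball 0 R)ᶜ) := by
  refine ⟨(measurable_norm.pow_const _).aestronglyMeasurable, ?_⟩
  rw [eLpNorm_lt_top_iff_lintegral_rpow_enorm_lt_top (by simp) (by simp)]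
  have h1 := lintegral_fun_norm (f := (Ici R).indicator fun r => ‖r ^ (-β)‖ₑ ^ (6 : ℝ))
    (Measurable.indicator (by fun_prop) measurableSet_Ici)
  have h2 : ∀ x : E3, (Ici R).indicator (fun r => ‖r ^ (-β)‖ₑ ^ (6 : ℝ)) ‖x‖
      = (Metric.ball (0 : E3) R)ᶜ.indicator (fun x => ‖‖x‖ ^ (-β)‖ₑ ^ (6 : ℝ)) x := fun x => by
    simp [indicator]
  simp only [h2] at h1
  rw [lintegral_indicator measurableSet_ball.compl] at h1
  simp only [ENNReal.toReal_ofNat]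
  rw [h1]
  refine ENNReal.mul_lt_top (measure_lt_top _ _) ?_
  have h3 : ∀ r : ℝ, ENNReal.ofReal (r ^ 2) * (Ici R).indicator (fun r => ‖r ^ (-β)‖ₑ ^ (6 : ℝ)) r
      = (Ici R).indicator (fun r => ‖r ^ (2 - 6 * β)‖ₑ) r := fun r => by
    by_cases hr : r ∈ Ici R
    · have hr0 : 0 < r := hR.trans_le hr
      rw [indicator_of_mem hr, indicator_of_mem hr, ← Real.enorm_eq_ofReal (sq_nonneg r),
        ← Nat.cast_ofNat (R := ℝ) (n := 6), ENNReal.rpow_natCast, ← enorm_pow, ← enorm_mul]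
      congr 1
      rw [← Real.rpow_natCast, ← Real.rpow_natCast, ← Real.rpow_mul hr0.le, ← Real.rpow_add hr0]
      congr 1
      push_cast
      ring
    · rw [indicator_of_notMem hr, indicator_of_notMem hr, mul_zero]
  simp only [h3]
  have h4 : IntegrableOn (fun r : ℝ => r ^ (2 - 6 * β)) (Ici R) :=
    (integrableOn_Ici_iff_integrableOn_Ioi (by simp)).2
      (integrableOn_Ioi_rpow_of_lt (by linarith) hR)
  refine lt_of_le_of_lt (setLIntegral_le_lintegral _ _) ?_
  rw [lintegral_indicator measurableSet_Ici]
  exact h4.2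

end RadialWave
end

noncomputable section

namespace RadialWave


/-! ### The exterior energy of the solution -/

/-- The radial component of the gradient of `u = w/r`, multiplied by `r`. -/
def gradAmplitude (F : ℝ → ℝ → ℝ) (t r : ℝ) : ℝ := radialDeriv F r t - radialPrimitive F r t / r

/-- The gradient of the solution. -/
def gradSolution (F : ℝ → ℝ → ℝ) (t : ℝ) (x : E3) : E3 :=
  (gradAmplitude F t ‖x‖ / ‖x‖) • (‖x‖⁻¹ • x)

/-- The time derivative of the solution. -/
def timeDerivSolution (F : ℝ → ℝ → ℝ) (t : ℝ) (x : E3) : ℝ := timeDeriv F ‖x‖ t / ‖x‖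

theorem IsHalfLineTest.integrableOn_mul {ψ : ℝ → ℂ} (h : IsHalfLineTest ψ) {f : ℝ → ℂ}
    (hf : LocallyIntegrableOn f (Ioi 0)) : IntegrableOn (fun r => f r * ψ r) (Ioi 0) := by
  have h1 := hf.integrableOn_compact_subset h.tsupport_subset h.hasCompactSupport.isCompact
  have h2 := h1.mul_continuousOn h.contDiff.continuous.continuousOn h.hasCompactSupport.isCompact
  rw [integrableOn_iff_integrable_of_support_subset] at h2
  · exact h2.integrableOn
  · intro x hx
    exact subset_tsupport _ (right_ne_zero_of_mul hx)

theorem IsHalfLineTest.inv_mul {ψ : ℝ → ℂ} (h : IsHalfLineTest ψ) :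
    IsHalfLineTest fun r => ((r⁻¹ : ℝ) : ℂ) * ψ r where
  contDiff := contDiff_iff_contDiffAt.2 fun r => by
    rcases eq_or_ne r 0 with rfl | hr
    · refine (contDiffAt_const (c := (0 : ℂ))).congr_of_eventuallyEq ?_
      filter_upwards [(isClosed_tsupport ψ).isOpen_compl.mem_nhds
        (fun h0 => lt_irrefl (0 : ℝ) (mem_Ioi.1 (h.tsupport_subset h0)))] with y hy
      rw [image_eq_zero_of_notMem_tsupport hy, mul_zero]
    · exact (Complex.ofRealCLM.contDiff.contDiffAt.comp r (contDiffAt_inv ℝ hr)).mul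
        h.contDiff.contDiffAt
  hasCompactSupport := h.hasCompactSupport.mul_left
  tsupport_subset := (tsupport_mul_subset_right (f := fun r : ℝ => ((r⁻¹ : ℝ) : ℂ))).trans
    h.tsupport_subset

theorem locallyIntegrableOn_ofReal {X : Type*} [TopologicalSpace X] [MeasurableSpace X]
    {μ : Measure X} {f : X → ℝ} {S : Set X} (hf : LocallyIntegrableOn f S μ) :
    LocallyIntegrableOn (fun x => (f x : ℂ)) S μ := fun x hx => by
  obtain ⟨t, ht, hi⟩ := hf x hx
  exact ⟨t, ht, hi.ofReal⟩

namespace IsCompactRadialSolution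

variable {s β C₀ : ℝ} {F u : ℝ → ℝ → ℝ} {U : ℝ → HomSobolev s × HomSobolev (s - 1)}

/-- The part of the primitive near `0` is small uniformly in time by the pointwise bound; on the
remaining bounded interval `L²` continuity of the radial derivative implies convergence of the
integrals. -/
theorem tendsto_radialPrimitive (h : IsCompactRadialSolution s β C₀ F u U) {r : ℝ} (hr : 0 < r)
    (t₀ : ℝ) : Tendsto (fun t => radialPrimitive F r t) (𝓝 t₀) (𝓝 (radialPrimitive F r t₀)) := by
  set K := C₀ / β / (1 - β) with hK
  have hsplit : ∀ η, 0 < η → η ≤ r → ∀ t,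
      radialPrimitive F r t = radialPrimitive F η t + ∫ x in Ioc η r, radialDeriv F x t := by
    intro η hη hηr t
    have h1 := intervalIntegral.integral_add_adjacent_intervals
      (h.intervalIntegrable_indicator_radialDeriv t 0 η)
      (h.intervalIntegrable_indicator_radialDeriv t η r)
    rw [radialPrimitive, ← h1, radialPrimitive, intervalIntegral.integral_of_le hηr]
    congr 1
    refine setIntegral_congr_fun measurableSet_Ioc fun x hx => ?_
    exact indicator_of_mem (show x ∈ Ioi (0 : ℝ) from hη.trans hx.1) _
  have hmid : ∀ η, 0 < η → Tendsto (fun t => ∫ x in Ioc η r, radialDeriv F x t) (𝓝 t₀)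
      (𝓝 (∫ x in Ioc η r, radialDeriv F x t₀)) := by
    intro η hη
    have hc := h.continuousInL2_radialDeriv hη
    have hsub : volume.restrict (Ioc η r) ≤ volume.restrict (Ici η) :=
      Measure.restrict_mono (fun x hx => hx.1.le) le_rfl
    have h1 := tendsto_setIntegral_of_L1' (μ := volume.restrict (Ioc η r))
      (fun x => radialDeriv F x t₀) (h.measurable_radialDeriv t₀).aestronglyMeasurable
      (F := fun t x => radialDeriv F x t) (l := 𝓝 t₀)
      (Eventually.of_forall fun t => ((hc.1 t).mono_measure hsub).integrable (by norm_num)) ?_ univ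
    · simpa using h1
    · have hfin : (volume.restrict (Ioc η r)) univ ^ (1 / (1 : ℝ≥0∞).toReal - 1 / (2 : ℝ≥0∞).toReal)
          ≠ ⊤ := (ENNReal.rpow_lt_top_of_nonneg (by norm_num) (by simp)).ne
      have h2 := ENNReal.Tendsto.mul_const (hc.2 t₀) (Or.inr hfin)
      rw [zero_mul] at h2
      refine tendsto_of_tendsto_of_tendsto_of_le_of_le tendsto_const_nhds h2 (fun _ => zero_le)
        fun t => ?_
      refine (eLpNorm_le_eLpNorm_mul_rpow_measure_univ (q := 2) (by norm_num)
        ((h.measurable_radialDeriv t).sub (h.measurable_radialDeriv t₀)).aestronglyMeasurable).trans ?_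
      exact mul_le_mul_left (eLpNorm_mono_measure _ hsub) _
  have hsmall : Tendsto (fun η : ℝ => K * η ^ (1 - β)) (𝓝[>] 0) (𝓝 0) := by
    have h1 : Tendsto (fun η : ℝ => η ^ (1 - β)) (𝓝 0) (𝓝 0) := by
      have := (Real.continuous_rpow_const (q := 1 - β) (by linarith [h.lt_one])).tendsto 0
      rwa [Real.zero_rpow (by linarith [h.lt_one])] at this
    simpa using (h1.mono_left nhdsWithin_le_nhds).const_mul K
  rw [Metric.tendsto_nhds]
  intro ε hε
  obtain ⟨η, hη1, hη0, hηr⟩ : ∃ η, K * η ^ (1 - β) < ε / 4 ∧ 0 < η ∧ η ≤ r := by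
    have h1 := hsmall.eventually (gt_mem_nhds (show (0 : ℝ) < ε / 4 by linarith))
    have h2 : ∀ᶠ η : ℝ in 𝓝[>] 0, 0 < η ∧ η ≤ r := by
      filter_upwards [Ioc_mem_nhdsGT hr] with η hη using hη
    exact (h1.and h2).exists
  filter_upwards [Metric.tendsto_nhds.1 (hmid η hη0) (ε / 4) (by linarith)] with t ht
  rw [Real.dist_eq, abs_lt] at ht ⊢
  rw [hsplit η hη0 hηr t, hsplit η hη0 hηr t₀]
  have h1 := abs_le.1 (h.abs_radialPrimitive_le t hη0)
  have h2 := abs_le.1 (h.abs_radialPrimitive_le t₀ hη0)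
  rw [← hK] at h1 h2
  constructor <;> linarith

theorem abs_radialPrimitive_div_le (h : IsCompactRadialSolution s β C₀ F u U) (t : ℝ) {r : ℝ}
    (hr : 0 < r) : |radialPrimitive F r t / r| ≤ C₀ / β / (1 - β) * r ^ (-β) := by
  rw [abs_div, abs_of_pos hr, div_le_iff₀ hr]
  refine (h.abs_radialPrimitive_le t hr).trans_eq ?_
  rw [show 1 - β = -β + 1 by ring, Real.rpow_add hr, Real.rpow_one]
  ring

/-- Dominated convergence: pointwise continuity in time comes from `tendsto_radialPrimitive`, the
time-independent majorant is a multiple of `r^{-β}`. -/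
theorem continuousInL2_radialPrimitive_div (h : IsCompactRadialSolution s β C₀ F u U) {R : ℝ}
    (hR : 0 < R) :
    ContinuousInL2 (volume.restrict (Ici R)) fun t r => radialPrimitive F r t / r := by
  have hm : ∀ t, Measurable fun r => radialPrimitive F r t / r := fun t =>
    (h.continuous_radialPrimitive t).measurable.div measurable_id
  refine ⟨fun t => memLp_Ici_of_le_rpow (hm t) h.half_lt
    (fun r hr => h.abs_radialPrimitive_div_le t hr) hR, fun t₀ => ?_⟩
  set K := C₀ / β / (1 - β) with hK
  have hdom := ((memLp_rpow_Ici (a := -β) (by linarith [h.half_lt]) hR).const_mul (2 * K))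
  have hlim : Tendsto (fun t => ∫⁻ r in Ici R,
      ‖radialPrimitive F r t / r - radialPrimitive F r t₀ / r‖ₑ ^ (2 : ℝ)) (𝓝 t₀)
      (𝓝 (∫⁻ _ in Ici R, 0)) := by
    refine tendsto_lintegral_filter_of_dominated_convergence
      (fun r => ‖2 * K * r ^ (-β)‖ₑ ^ (2 : ℝ))
      (Eventually.of_forall fun t => (((hm t).sub (hm t₀)).enorm.pow_const _))
      (Eventually.of_forall fun t => ?_) ?_ ?_
    · filter_upwards [ae_restrict_mem measurableSet_Ici] with r hr
      have hr0 : 0 < r := hR.trans_le hr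
      refine ENNReal.rpow_le_rpow (enorm_le_iff_norm_le.2 ?_) (by norm_num)
      have h1 := abs_le.1 (h.abs_radialPrimitive_div_le t hr0)
      have h2 := abs_le.1 (h.abs_radialPrimitive_div_le t₀ hr0)
      rw [← hK] at h1 h2
      refine le_trans ?_ (Real.le_norm_self _)
      rw [Real.norm_eq_abs, abs_le]
      constructor <;> linarith
    · have := hdom.2
      rw [eLpNorm_lt_top_iff_lintegral_rpow_enorm_lt_top (by simp) (by simp)] at this
      simpa using this.ne
    · filter_upwards [ae_restrict_mem measurableSet_Ici] with r hr
      have h1 := ((h.tendsto_radialPrimitive (hR.trans_le hr) t₀).div_const r).sub_const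
        (radialPrimitive F r t₀ / r)
      rw [sub_self] at h1
      have h2 := (ENNReal.continuous_rpow_const (y := 2)).tendsto _ |>.comp
        ((continuous_enorm.tendsto _).comp h1)
      simpa [Function.comp_def] using h2
  rw [lintegral_zero] at hlim
  have h3 := (ENNReal.continuous_rpow_const (y := 1 / 2)).tendsto _ |>.comp hlim
  rw [ENNReal.zero_rpow_of_pos (by norm_num)] at h3
  refine h3.congr fun t => ?_
  rw [eLpNorm_two_eq]
  rfl

theorem measurable_gradAmplitude (h : IsCompactRadialSolution s β C₀ F u U) (t : ℝ) :
    Measurable (gradAmplitude F t) :=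
  (h.measurable_radialDeriv t).sub ((h.continuous_radialPrimitive t).measurable.div measurable_id)

theorem continuousInL2_gradSolution (h : IsCompactRadialSolution s β C₀ F u U) {R : ℝ}
    (hR : 0 < R) :
    ContinuousInL2 (volume.restrict (Metric.ball (0 : E3) R)ᶜ) (gradSolution F) := by
  refine ContinuousInL2.radial_vector h.measurable_gradAmplitude hR ?_
  change ContinuousInL2 _ fun t r => radialDeriv F r t - radialPrimitive F r t / r
  have := (h.continuousInL2_radialDeriv hR).add
    ((h.continuousInL2_radialPrimitive_div hR).const_smul (-1))
  simpa only [smul_eq_mul, neg_one_mul, ← sub_eq_add_neg] using this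

theorem continuousInL2_timeDerivSolution (h : IsCompactRadialSolution s β C₀ F u U) {R : ℝ}
    (hR : 0 < R) :
    ContinuousInL2 (volume.restrict (Metric.ball (0 : E3) R)ᶜ) (timeDerivSolution F) :=
  (h.continuousInL2_timeDeriv hR).radial h.measurable_timeDeriv hR

theorem norm_gradSolution_le (h : IsCompactRadialSolution s β C₀ F u U) (t : ℝ) {x : E3}
    (hx : x ≠ 0) :
    ‖gradSolution F t x‖ ≤ (C₀ / β + C₀ / β / (1 - β)) * ‖x‖ ^ (-(1 + β)) := by
  have hpos := norm_pos_iff.2 hx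
  rw [gradSolution, norm_smul, norm_smul, norm_inv, norm_norm, inv_mul_cancel₀ hpos.ne', mul_one,
    norm_div, norm_norm, div_le_iff₀ hpos, mul_assoc]
  have h1 : ‖x‖ ^ (-(1 + β)) * ‖x‖ = ‖x‖ ^ (-β) := by
    nth_rewrite 2 [← Real.rpow_one ‖x‖]
    rw [← Real.rpow_add hpos]
    congr 1
    ring
  rw [h1, add_mul, gradAmplitude]
  exact (norm_sub_le _ _).trans (add_le_add (h.abs_radialDeriv_le t hpos)
    (h.abs_radialPrimitive_div_le t hpos))

theorem abs_timeDerivSolution_le (h : IsCompactRadialSolution s β C₀ F u U) (t : ℝ) {x : E3}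
    (hx : x ≠ 0) : |timeDerivSolution F t x| ≤ C₀ / β * ‖x‖ ^ (-(1 + β)) := by
  have hpos := norm_pos_iff.2 hx
  rw [timeDerivSolution, abs_div, abs_of_pos hpos, div_le_iff₀ hpos, mul_assoc]
  have h1 : ‖x‖ ^ (-(1 + β)) * ‖x‖ = ‖x‖ ^ (-β) := by
    nth_rewrite 2 [← Real.rpow_one ‖x‖]
    rw [← Real.rpow_add hpos]
    congr 1
    ring
  rw [h1]
  exact h.abs_timeDeriv_le t hpos

theorem memLp_solution (h : IsCompactRadialSolution s β C₀ F u U) (t : ℝ) {R : ℝ} (hR : 0 < R) :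
    MemLp (fun x : E3 => u ‖x‖ t) 6 (volume.restrict (Metric.ball 0 R)ᶜ) := by
  refine ((memLp_norm_rpow h.half_lt hR).const_mul (C₀ / β / (1 - β))).mono'
    (h.isSolution.locallyIntegrable t).aestronglyMeasurable.restrict ?_
  filter_upwards [ae_restrict_of_ae (ae_norm_of_ae (h.mul_ae_eq_radialPrimitive t)),
    ae_restrict_mem measurableSet_ball.compl] with x hx hmem
  have hle : R ≤ ‖x‖ := by simpa using hmem
  have hpos : 0 < ‖x‖ := hR.trans_le hle
  have h1 := h.abs_radialPrimitive_div_le t hpos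
  rwa [← hx (norm_pos_iff.1 hpos), mul_div_cancel_left₀ _ hpos.ne'] at h1

/-- The integrand is at most a constant times `R^{-2(1+β)}` on the shell, which sits in the ball of
radius `4R` and volume `(4π/3) · 64 R³`. The resulting exponent is `1 - 2β = -2(1-s)`. -/
theorem exterior_energy_le (h : IsCompactRadialSolution s β C₀ F u U) {R : ℝ} (hR : 0 < R)
    (t : ℝ) :
    ∫ x in {x : E3 | R < ‖x‖ ∧ ‖x‖ < 4 * R},
        (‖gradSolution F t x‖ ^ 2 + (timeDerivSolution F t x) ^ 2)
      ≤ ((C₀ / β + C₀ / β / (1 - β)) ^ 2 + (C₀ / β) ^ 2) * (Real.pi * 4 / 3 * 64)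
        * R ^ (-(2 * (1 - s))) := by
  set A := C₀ / β + C₀ / β / (1 - β) with hA
  set B := C₀ / β with hB
  have hsub : {x : E3 | R < ‖x‖ ∧ ‖x‖ < 4 * R} ⊆ Metric.ball 0 (4 * R) := fun x hx => by
    simpa using hx.2
  have hvol : (volume : Measure E3) {x : E3 | R < ‖x‖ ∧ ‖x‖ < 4 * R} < ⊤ :=
    (measure_mono hsub).trans_lt measure_ball_lt_top
  have hvol2 : (volume : Measure E3).real {x : E3 | R < ‖x‖ ∧ ‖x‖ < 4 * R}
      ≤ Real.pi * 4 / 3 * 64 * R ^ 3 := by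
    refine (measureReal_mono hsub measure_ball_lt_top.ne).trans_eq ?_
    rw [measureReal_def, Measure.addHaar_ball_of_pos _ _ (by positivity), ENNReal.toReal_mul,
      ← measureReal_def, volume_real_unitBall, finrank_euclideanSpace_fin,
      ENNReal.toReal_ofReal (by positivity)]
    ring
  have h1 := norm_setIntegral_le_of_norm_le_const (f := fun x : E3 =>
      ‖gradSolution F t x‖ ^ 2 + (timeDerivSolution F t x) ^ 2)
      (C := (A ^ 2 + B ^ 2) * (R ^ (-(1 + β))) ^ 2) hvol fun x hx => ?_
  · refine (Real.le_norm_self _).trans (h1.trans ?_)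
    refine (mul_le_mul_of_nonneg_left hvol2 (by positivity)).trans_eq ?_
    have h2 : R ^ (-(2 * (1 - s))) = (R ^ (-(1 + β))) ^ 2 * R ^ 3 := by
      rw [← Real.rpow_natCast R 3, sq, ← Real.rpow_add hR, ← Real.rpow_add hR, h.s_eq]
      congr 1
      push_cast
      ring
    rw [h2]
    ring
  · have hpos : 0 < ‖x‖ := hR.trans hx.1
    have hx0 : x ≠ 0 := norm_pos_iff.1 hpos
    have hRx : ‖x‖ ^ (-(1 + β)) ≤ R ^ (-(1 + β)) :=
      Real.rpow_le_rpow_of_nonpos hR hx.1.le (by linarith [h.β_pos])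
    have hB0 : 0 ≤ B := h.const_nonneg
    have hA0 : 0 ≤ A := add_nonneg hB0 (div_nonneg hB0 (by linarith [h.lt_one]))
    have h3 : ‖gradSolution F t x‖ ^ 2 ≤ (A * R ^ (-(1 + β))) ^ 2 :=
      pow_le_pow_left₀ (norm_nonneg _) ((h.norm_gradSolution_le t hx0).trans
        (mul_le_mul_of_nonneg_left hRx hA0)) 2
    have h4 : (timeDerivSolution F t x) ^ 2 ≤ (B * R ^ (-(1 + β))) ^ 2 := by
      rw [← sq_abs]
      exact pow_le_pow_left₀ (abs_nonneg _) ((h.abs_timeDerivSolution_le t hx0).trans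
        (mul_le_mul_of_nonneg_left hRx hB0)) 2
    rw [Real.norm_of_nonneg (by positivity)]
    linarith

end IsCompactRadialSolution

end RadialWave
end

/-! ### Weak gradient and velocity of the solution off the origin. -/

noncomputable section

namespace RadialWave


namespace IsCompactRadialSolution

variable {s β C₀ : ℝ} {F u : ℝ → ℝ → ℝ} {U : ℝ → HomSobolev s × HomSobolev (s - 1)}

theorem locallyIntegrableOn_solution (h : IsCompactRadialSolution s β C₀ F u U) (t : ℝ) :
    LocallyIntegrableOn (fun x : E3 => ((u ‖x‖ t : ℝ) : ℂ)) {0}ᶜ :=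
  locallyIntegrableOn_ofReal ((h.isSolution.locallyIntegrable t).locallyIntegrableOn _)

/-- As `u` is radial at every time, a general test function may be replaced by the radial one with
the same spherical integrals. The two pairings with `u` agree for all times, hence so do their time
derivatives, and the velocity is known on radial test functions. The profile is divided by `r`
because these test `r u`. -/
theorem eqFunAwayFromZero (h : IsCompactRadialSolution s β C₀ F u U) (t : ℝ) :
    EqFunAwayFromZero (U t).2.toDistribution (timeDerivSolution F t) := by
  have hm : AEStronglyMeasurable (timeDerivSolution F t) volume :=
    (((h.measurable_timeDeriv t).comp measurable_norm).div measurable_norm).aestronglyMeasurable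
  have hloc := locallyIntegrableOn_compl_zero_of_le_rpow hm
    fun x hx => h.abs_timeDerivSolution_le t hx
  refine ⟨hloc, fun φ hc hsupp => ?_⟩
  have hφ : IsPuncturedTest φ := ⟨φ.smooth ⊤, hc, hsupp⟩
  have hS := hφ.isHalfLineTest
  have h1 : ∀ τ, (U τ).1.toDistribution φ = (U τ).1.toDistribution (radialTest _ hS.inv_mul) := by
    intro τ
    rw [h.isSolution.fst_eq, h.fst_radialTest, hφ.integral_radial_mul
      (f := fun r => ((u r τ : ℝ) : ℂ)) (h.locallyIntegrableOn_solution τ)]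
    refine setIntegral_congr_fun measurableSet_Ioi fun r hr => ?_
    have hr' : (r : ℂ) ≠ 0 := by exact_mod_cast (ne_of_gt hr)
    push_cast
    field_simp
  have h2 := h.isSolution.snd_eq t φ
  simp only [h1] at h2
  rw [h2.unique (h.isSolution.snd_eq t (radialTest _ hS.inv_mul)), h.snd_radialTest]
  have h3 := hφ.integral_radial_mul (f := fun r => ((timeDeriv F r t / r : ℝ) : ℂ))
    (locallyIntegrableOn_ofReal hloc)
  rw [show (∫ x, (timeDerivSolution F t x : ℂ) * φ x)
    = ∫ x : E3, ((timeDeriv F ‖x‖ t / ‖x‖ : ℝ) : ℂ) * φ x from rfl, h3]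
  refine setIntegral_congr_fun measurableSet_Ioi fun r hr => ?_
  push_cast
  ring

/-- Spherical integration reduces the claim to the half-line. With `S` the integral of `(x·e/|x|) ψ`
over the sphere of radius `r`, the divergence theorem turns `∂_e ψ` into `S'`, and the weak
derivative of `w = r u` is then tested with `S/r`. -/
theorem isWeakGradient (h : IsCompactRadialSolution s β C₀ F u U) (t : ℝ) :
    IsWeakGradient (fun x => u ‖x‖ t) (gradSolution F t) := by
  have hm : AEStronglyMeasurable (gradSolution F t) volume :=
    ((((h.measurable_gradAmplitude t).comp measurable_norm).div measurable_norm).smul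
      (measurable_norm.inv.smul measurable_id)).aestronglyMeasurable
  have hloc := locallyIntegrableOn_compl_zero_of_le_rpow hm
    fun x hx => h.norm_gradSolution_le t hx
  refine ⟨(h.isSolution.locallyIntegrable t).locallyIntegrableOn _, hloc,
    fun ψ h1 h2 h3 e => ?_⟩
  set Ψ : E3 → ℂ := fun x => (ψ x : ℂ) with hΨ
  have hψ : IsPuncturedTest Ψ := ⟨Complex.ofRealCLM.contDiff.comp h1,
    h2.comp_left (g := fun y : ℝ => (y : ℂ)) (by simp),
    (closure_mono fun r hr => by simpa [hΨ, Function.mem_support] using hr).trans h3⟩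
  have hQ := hψ.inner_mul e
  set Q : E3 → ℂ := fun x => ((inner ℝ x e / ‖x‖ : ℝ) : ℂ) * Ψ x with hQdef
  have hS := hQ.isHalfLineTest
  set S := sphereIntegral Q with hSdef
  have hS' : ∀ r, HasDerivAt S (deriv S r) r := fun r =>
    (hS.contDiff.differentiable (by simp) r).hasDerivAt
  have hfd : ∀ x, fderiv ℝ Ψ x e = ((fderiv ℝ ψ x e : ℝ) : ℂ) := fun x => by
    have := (Complex.ofRealCLM.hasFDerivAt (x := ψ x)).comp x
      ((h1.differentiable (by simp)) x).hasFDerivAt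
    have h4 : fderiv ℝ Ψ x = Complex.ofRealCLM.comp (fderiv ℝ ψ x) := this.fderiv
    rw [h4]
    rfl
  have hleft : ((∫ x : E3, u ‖x‖ t * fderiv ℝ ψ x e : ℝ) : ℂ)
      = ∫ r in Ioi (0 : ℝ), (u r t : ℂ) * deriv S r := by
    rw [← integral_complex_ofReal]
    have h4 := (hψ.fderiv_apply e).integral_radial_mul (f := fun r => ((u r t : ℝ) : ℂ))
      (h.locallyIntegrableOn_solution t)
    simp only [hfd, ← Complex.ofReal_mul] at h4
    rw [h4]
    refine setIntegral_congr_ae measurableSet_Ioi ?_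
    filter_upwards [deriv_sphereIntegral_ae_eq hψ e] with r hr hpos
    rw [hSdef, hr hpos]
    simp only [hfd]
  have hright : ((∫ x : E3, inner ℝ (gradSolution F t x) e * ψ x : ℝ) : ℂ)
      = ∫ r in Ioi (0 : ℝ), ((gradAmplitude F t r / r : ℝ) : ℂ) * S r := by
    rw [← integral_complex_ofReal]
    have hlocA : LocallyIntegrableOn (fun x : E3 => gradAmplitude F t ‖x‖ / ‖x‖) {0}ᶜ := by
      refine locallyIntegrableOn_compl_zero_of_le_rpow
        (K := C₀ / β + C₀ / β / (1 - β)) (a := -(1 + β)) (((h.measurable_gradAmplitude t).comp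
        measurable_norm).div measurable_norm).aestronglyMeasurable fun x hx => ?_
      · refine le_trans (le_of_eq ?_) (h.norm_gradSolution_le t hx)
        rw [gradSolution, norm_smul, norm_smul, norm_inv, norm_norm,
          inv_mul_cancel₀ (norm_ne_zero_iff.2 hx), mul_one]
    rw [← hQ.integral_radial_mul (f := fun r => ((gradAmplitude F t r / r : ℝ) : ℂ))
      (locallyIntegrableOn_ofReal hlocA)]
    congr 1
    ext x
    rw [gradSolution, inner_smul_left, inner_smul_left, hQdef]
    simp only [hΨ, conj_trivial]
    push_cast
    ring
  have hP := h.fst_radialTest_deriv t hS.inv_mul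
  rw [h.fst_radialTest t hS.inv_mul.deriv] at hP
  have hPd : ∀ r > 0, deriv (fun r : ℝ => ((r⁻¹ : ℝ) : ℂ) * S r) r
      = ((r⁻¹ : ℝ) : ℂ) * deriv S r - (((r ^ 2)⁻¹ : ℝ) : ℂ) * S r := fun r hr => by
    have h4 := ((hasDerivAt_inv (ne_of_gt hr)).ofReal_comp.fun_mul (hS' r)).deriv
    rw [h4]
    push_cast
    ring
  have hWloc : LocallyIntegrableOn (fun r => ((radialPrimitive F r t / r ^ 2 : ℝ) : ℂ)) (Ioi 0) := by
    refine locallyIntegrableOn_ofReal (ContinuousOn.locallyIntegrableOn ?_ measurableSet_Ioi)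
    exact (h.continuous_radialPrimitive t).continuousOn.div (continuous_pow 2).continuousOn
      fun r hr => pow_ne_zero 2 (ne_of_gt hr)
  have hwrloc : LocallyIntegrableOn (fun r => ((radialDeriv F r t : ℝ) : ℂ)) (Ioi 0) :=
    locallyIntegrableOn_ofReal (h.isWeakDeriv t).2.1
  -- Product rule: `u S' = w (S/r)' + (w/r²) S`. The last term is the one that corrects `w_r` to
  -- `w_r - w/r` in the gradient.
  have hsum : ∫ r in Ioi (0 : ℝ), (u r t : ℂ) * deriv S r
      = (∫ r in Ioi (0 : ℝ), ((r * u r t : ℝ) : ℂ) * deriv (fun r : ℝ => ((r⁻¹ : ℝ) : ℂ) * S r) r)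
        + ∫ r in Ioi (0 : ℝ), ((radialPrimitive F r t / r ^ 2 : ℝ) : ℂ) * S r := by
    rw [← integral_add (hS.inv_mul.deriv.integrableOn_mul
      (locallyIntegrableOn_ofReal (h.locallyIntegrableOn_mul t))) (hS.integrableOn_mul hWloc)]
    refine setIntegral_congr_ae measurableSet_Ioi ?_
    filter_upwards [h.mul_ae_eq_radialPrimitive t] with r hr hpos
    have hr' : (r : ℂ) ≠ 0 := by exact_mod_cast (ne_of_gt hpos)
    rw [hPd r hpos, ← hr hpos]
    push_cast
    field_simp
    ring
  have hgrad : ∫ r in Ioi (0 : ℝ), ((gradAmplitude F t r / r : ℝ) : ℂ) * S r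
      = (∫ r in Ioi (0 : ℝ), (radialDeriv F r t : ℂ) * (((r⁻¹ : ℝ) : ℂ) * S r))
        - ∫ r in Ioi (0 : ℝ), ((radialPrimitive F r t / r ^ 2 : ℝ) : ℂ) * S r := by
    rw [← integral_sub (hS.inv_mul.integrableOn_mul hwrloc) (hS.integrableOn_mul hWloc)]
    refine setIntegral_congr_fun measurableSet_Ioi fun r hr => ?_
    have hr' : (r : ℂ) ≠ 0 := by exact_mod_cast (ne_of_gt hr)
    simp only [gradAmplitude]
    push_cast
    field_simp
  have hfinal : ((∫ x : E3, u ‖x‖ t * fderiv ℝ ψ x e : ℝ) : ℂ)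
      = ((-∫ x : E3, inner ℝ (gradSolution F t x) e * ψ x : ℝ) : ℂ) := by
    rw [Complex.ofReal_neg, hleft, hright, hsum, hgrad, hP]
    ring
  exact_mod_cast hfinal

end IsCompactRadialSolution

end RadialWave
end

/-! ### Assembly for `β = 2/(p-1)`. -/

open RadialWave in
theorem mainTheorem4 (p : ℝ) (hp3 : 3 < p) (hp5 : p < 5) (F u : ℝ → ℝ → ℝ)
    (U : ℝ → HomSobolev (sp p) × HomSobolev (sp p - 1))
    (hF : Measurable (Function.uncurry F))
    (hsol : IsGlobalRadialSolution (sp p) F u U)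
    (hcompact : IsCompact (closure (Set.range U)))
    (hZ : ∀ a b : ℝ, ZNorm p (Set.Icc a b) (fun x t => F ‖x‖ t) < ⊤)
    (C₀ : ℝ) (hbound : ∀ r > 0, ∀ t, |F r t| ≤ C₀ * r ^ (-(2 * p / (p - 1)))) :
    (∃ wr wt : ℝ → ℝ → ℝ,
      (∀ t, IsWeakDeriv (fun r => r * u r t) (fun r => wr r t)) ∧
      IsTimeDeriv (fun r t => r * u r t) wt ∧
      (∀ R > 0, ContinuousInL2 (volume.restrict (Set.Ici R)) (fun t r => wr r t) ∧
        ContinuousInL2 (volume.restrict (Set.Ici R)) (fun t r => wt r t)) ∧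
      ∃ C₁ : ℝ, ∀ R > 0, ∀ t₀ : ℝ,
        ∫ r in R..(4 * R), ((wr r t₀) ^ 2 + (wt r t₀) ^ 2)
          ≤ 1 / 2 * ∫ r in R..(4 * R),
              ((∫ t in Set.Ioi 0, (r + t) * F (r + t) (t₀ - t)) ^ 2
                + (∫ t in Set.Ioi 0, (r + t) * F (r + t) (t₀ + t)) ^ 2) ∧
        1 / 2 * ∫ r in R..(4 * R),
              ((∫ t in Set.Ioi 0, (r + t) * F (r + t) (t₀ - t)) ^ 2
                + (∫ t in Set.Ioi 0, (r + t) * F (r + t) (t₀ + t)) ^ 2)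
          ≤ C₁ * R ^ (-(2 * (1 - sp p)))) ∧
    (∃ (Du : ℝ → E3 → E3) (ut : ℝ → E3 → ℝ),
      (∀ t, IsWeakGradient (fun x => u ‖x‖ t) (Du t)) ∧
      (∀ t, EqFunAwayFromZero (U t).2.toDistribution (ut t)) ∧
      (∀ R > 0, ContinuousInHomH1 (Metric.ball 0 R)ᶜ (fun t x => u ‖x‖ t) Du ∧
        ContinuousInL2 (volume.restrict (Metric.ball 0 R)ᶜ) ut) ∧
      ∃ C₂ : ℝ, ∀ R > 0, ∀ t : ℝ,
        ∫ x in {x : E3 | R < ‖x‖ ∧ ‖x‖ < 4 * R}, (‖Du t x‖ ^ 2 + (ut t x) ^ 2)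
          ≤ C₂ * R ^ (-(2 * (1 - sp p)))) := by
  have hp1 : (0 : ℝ) < p - 1 := by linarith
  -- The range of `p` enters only here: `p > 3` is `β < 1` and `p < 5` is `β > 1/2`, which together
  -- place `s_p = 3/2 - β` between `1/2` and `1`.
  have hβ1 : 2 / (p - 1) < 1 := by rw [div_lt_one hp1]; linarith
  have hβ2 : 1 / 2 < 2 / (p - 1) := by rw [lt_div_iff₀ hp1]; linarith
  have hs : sp p = 3 / 2 - 2 / (p - 1) := rfl
  have h : IsCompactRadialSolution (sp p) (2 / (p - 1)) C₀ F u U :=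
    { half_lt := hβ2
      lt_one := hβ1
      s_eq := hs
      measurable := hF
      isSolution := hsol
      isCompact := hcompact
      force_integrable := fun a b =>
        lintegral_sliceNorm_lt_top (s := sp p) (by linarith) (by linarith) (hZ a b)
      bound := fun r hr t => by
        have hexp : 2 * p / (p - 1) = 2 + 2 / (p - 1) := by
          field_simp
          ring
        rw [← hexp]
        exact hbound r hr t }
  have hA : ∀ t₀ r, ∫ t in Set.Ioi 0, (r + t) * F (r + t) (t₀ - t) = charInt F (-1) t₀ r :=
    fun t₀ r => by simp only [charInt, neg_one_mul, ← sub_eq_add_neg]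
  have hB : ∀ t₀ r, ∫ t in Set.Ioi 0, (r + t) * F (r + t) (t₀ + t) = charInt F 1 t₀ r :=
    fun t₀ r => by simp only [charInt, one_mul]
  refine ⟨⟨radialDeriv F, timeDeriv F, h.isWeakDeriv, h.isTimeDeriv, fun R hR =>
    ⟨h.continuousInL2_radialDeriv hR, h.continuousInL2_timeDeriv hR⟩,
    3 * (C₀ / (2 / (p - 1))) ^ 2, fun R hR t₀ => ?_⟩,
    ⟨gradSolution F, timeDerivSolution F, h.isWeakGradient, h.eqFunAwayFromZero, fun R hR =>
    ⟨⟨fun t => h.memLp_solution t hR, h.continuousInL2_gradSolution hR⟩,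
      h.continuousInL2_timeDerivSolution hR⟩, _, fun R hR t => h.exterior_energy_le hR t⟩⟩
  simp only [hA, hB]
  exact ⟨(IsCompactRadialSolution.energy_eq R t₀).le, h.charInt_energy_le hR t₀⟩
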